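/- Conventions. Let $G$ be a graph on $N$ sites. Each site $i$ carries two fermionic modes $a_{i\uparrow},a_{i\downarrow}$, and there are $A$ further ancilla modes; all modes satisfy the canonical anticommutation relations. For coefficients $h_{ij\sigma}\in\mathbb C$ with $\overline{h_{ij\sigma}}=h_{ji\sigma}$ and $h_{ij\sigma}=0$ unless $i,j$ are adjacent in $G$, and $\omega_{i\sigma},\xi_i\in\mathbb R$, consider the Hubbard Hamiltonian $$H=\sum_{i,j}\sum_{\sigma}h_{ij\sigma}a^\dagger_{i\sigma}a_{j\sigma}+\sum_{i,\sigma}\omega_{i\sigma}n_{i\sigma}+\sum_i\xi_i n_{i\uparrow}n_{i\downarrow},\qquad n_{i\sigma}=a_{i\sigma}^\dagger a_{i\sigma}.$$ A two-mode FLO unitary is $e^{-iK}$ with $K$ a Hermitian quadratic form $e_1n_1+e_2n_2+(\alpha c_1^\dagger c_2+\mathrm{h.c.})+(\beta c_1^\dagger c_2^\dagger+\mathrm{h.c.})$ in the operators of two distinct modes $c_1,c_2$ (system or ancilla); a two-mode Gaussian state is the image of the vacuum of the two modes under such a unitary. An experiment consists of preparing two-mode Gaussian states on disjoint pairs of modes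 (all other modes being empty), applying a sequence, fixed or randomly drawn from a specified distribution, of two-mode FLO unitaries and of evolutions $e^{-iHt}$, $t\ge 0$, under the unknown $H$, and finally measuring the occupation number of every mode. A protocol consists of finitely many independent experiments, together with an estimator $\hat\lambda$ of each coefficient $\lambda$ that is a function of the measurement outcomes; the experiments and the estimators are chosen without knowledge of the coefficients. State preparation and measurement (SPAM) error of size at most $\delta$ means the following. In each experiment the prepared state is some density operator whose fidelity with the target is at least $1-\delta$ on each prepared two-mode block and on each mode that should be empty; and the outcomes are reported through some stochastic map (possibly correlated between modes) which reports the occupation number of each single mode wrongly with probability at most $\delta$. The errors may differ from experiment to experiment. Theorem. There are a number $k$ and a constant $\delta>0$ such that for every degree bound $D$ and every $\Lambda>0$ there is a constant $C>0$ with the following property. For every $N$, every graph $G$ on $N$ sites with maximum degree at most $D$, and every $0<\varepsilon\le 1/2$, there is a protocol, depending only on these data, such that 1. its total evolution time is at most $C/\varepsilon$, 2. its number of experiments is at most $C\log^k(1/\varepsilon)$, 3. its number of ancilla modes is at most $CN$, 4. its total number of two-mode FLO unitaries is at most $CN\varepsilon^{-2}\log^k(1/\varepsilon)$, and such that, for every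 Hamiltonian of the above form all of whose coefficients have absolute value at most $\Lambda$, each coefficient $\lambda\in\{h_{ij\sigma},\omega_{i\sigma},\xi_i\}$ is estimated with root-mean-square error $\sqrt{\mathbb E|\hat\lambda-\lambda|^2}\le\varepsilon$, both without SPAM error and in the presence of arbitrary SPAM error of size at most $\delta$. -/

import Mathlib

open scoped Matrix ComplexOrder

noncomputable section

namespace Hubbard

/-! ### Fermionic Fock space over a finite, linearly ordered set of modes -/

section Fock

variable {M : Type} [Fintype M] [LinearOrder M]

/-- Operators on the fermionic Fock space of the modes `M`, as matrices in the occupation-number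
basis.  The basis vector labelled by `S : Finset M` is the state in which exactly the modes in
`S` are occupied. -/
abbrev Op (M : Type) : Type := Matrix (Finset M) (Finset M) ℂ

/-- The annihilation operator of mode `m` (Jordan-Wigner signs): it sends the basis vector of `S`
to `(-1) ^ #{k ∈ S | k < m}` times the basis vector of `S \ {m}` if `m ∈ S`, and to `0`
otherwise. -/
def ann (m : M) : Op M := fun T S =>
  if m ∈ S ∧ T = S.erase m then (-1 : ℂ) ^ (S.filter (fun k => k < m)).card else 0

/-- The creation operator of mode `m`. -/
def cre (m : M) : Op M := (ann m)ᴴ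

/-- The occupation number operator of mode `m`. -/
def num (m : M) : Op M := cre m * ann m

/-- The vacuum vector. -/
def vac : Finset M → ℂ := fun S => if S = ∅ then 1 else 0

/-- The rank one operator `|ψ⟩⟨ψ|`. -/
def ketbra (ψ : Finset M → ℂ) : Op M := Matrix.vecMulVec ψ (star ψ)

/-- The unitary `exp (- i t K)`. -/
def expI (t : ℝ) (K : Op M) : Op M := NormedSpace.exp ((-(Complex.I * (t : ℂ))) • K)

/-- A density operator. -/
def IsDensity (ρ : Op M) : Prop := ρ.PosSemidef ∧ ρ.trace = 1

/-- A two-mode fermionic linear optics (FLO) gate: two distinct modes, and the coefficients of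
a Hermitian form that is quadratic in their creation and annihilation operators. -/
structure FLO (M : Type) where
  fst : M
  snd : M
  ne : fst ≠ snd
  e₁ : ℝ
  e₂ : ℝ
  hop : ℂ
  pair : ℂ

namespace FLO

/-- The pair of modes on which the gate acts. -/
def modes (g : FLO M) : Finset M := {g.fst, g.snd}

/-- The quadratic Hermitian generator
`e₁ n₁ + e₂ n₂ + (hop a₁† a₂ + h.c.) + (pair a₁† a₂† + h.c.)`. -/
def gen (g : FLO M) : Op M :=
  (g.e₁ : ℂ) • num g.fst + (g.e₂ : ℂ) • num g.snd
    + (g.hop • (cre g.fst * ann g.snd) + star g.hop • (cre g.snd * ann g.fst))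
    + (g.pair • (cre g.fst * cre g.snd) + star g.pair • (ann g.snd * ann g.fst))

/-- The unitary implemented by the gate. -/
def unitary (g : FLO M) : Op M := expI 1 g.gen

/-- The projection onto the two-mode Gaussian state `g.unitary |vacuum⟩` of the two modes
of `g` (the identity on all other modes). -/
def stateProj (g : FLO M) : Op M :=
  g.unitary * ((1 - num g.fst) * (1 - num g.snd)) * (g.unitary)ᴴ

end FLO

/-- A state preparation: two-mode Gaussian states (a two-mode FLO unitary applied to the vacuum)
on pairwise disjoint pairs of modes; every other mode is left empty. -/
structure Preparation (M : Type) [LinearOrder M] where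
  blocks : List (FLO M)
  disjoint : blocks.Pairwise (fun g g' => Disjoint g.modes g'.modes)

/-- The state vector prepared in the absence of errors. -/
def Preparation.ideal (p : Preparation M) : Finset M → ℂ :=
  (p.blocks.map FLO.unitary).prod *ᵥ vac

/-- One step of a circuit: evolution for a time `t ≥ 0` under the unknown Hamiltonian, or a
two-mode FLO gate. -/
inductive Step (M : Type) : Type
  | evolve (t : NNReal) : Step M
  | gate (g : FLO M) : Step M

/-- The unitary of a step if the unknown Hamiltonian is `H`. -/
def Step.unitary (H : Op M) : Step M → Op M
  | .evolve t => expI t H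
  | .gate g => g.unitary

/-- The evolution time used by a step. -/
def Step.time : Step M → ℝ
  | .evolve t => t
  | .gate _ => 0

/-- The number of FLO gates in a step. -/
def Step.gates : Step M → ℕ
  | .evolve _ => 0
  | .gate _ => 1

/-- A circuit: a finite sequence of steps, the head of the list being applied first. -/
abbrev Circuit (M : Type) : Type := List (Step M)

/-- The unitary of a circuit. -/
def circuitUnitary (H : Op M) : Circuit M → Op M
  | [] => 1
  | s :: c => circuitUnitary H c * s.unitary H

/-- The total evolution time of a circuit. -/
def circuitTime (c : Circuit M) : ℝ := (c.map Step.time).sum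

/-- The total number of FLO gates of a circuit. -/
def circuitGates (c : Circuit M) : ℕ := (c.map Step.gates).sum

/-- An experiment: prepare two-mode Gaussian states, run a circuit that is drawn from a finitely
supported probability distribution, and measure the occupation number of every mode. -/
structure Experiment (M : Type) [LinearOrder M] where
  prep : Preparation M
  Seed : Type
  [seedFintype : Fintype Seed]
  weight : Seed → ℝ
  weight_nonneg : ∀ s, 0 ≤ weight s
  weight_sum : ∑ s, weight s = 1
  circuit : Seed → Circuit M

attribute [instance] Experiment.seedFintype

/-- The state that is really prepared in an experiment and the way in which the occupation
numbers are really read out: `readout x y` is the probability to report the set of occupied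
modes `y` when the true one is `x`. -/
structure Spam (M : Type) where
  state : Op M
  readout : Finset M → Finset M → ℝ

/-- Error-free state preparation and measurement. -/
def idealSpam (p : Preparation M) : Spam M where
  state := ketbra p.ideal
  readout := fun x y => if x = y then 1 else 0

/-- State preparation and measurement errors of size at most `δ` per two-mode block and per
measured mode.  The prepared state is an arbitrary density operator, each block of which has
fidelity at least `1 - δ` with its target; the readout is an arbitrary, possibly correlated,
stochastic map which reports each single occupation number wrongly with probability at
most `δ`. -/
structure Spam.IsBounded (n : Spam M) (p : Preparation M) (δ : ℝ) : Prop where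
  density : IsDensity n.state
  block : ∀ g ∈ p.blocks, 1 - δ ≤ ((n.state * g.stateProj).trace).re
  empty : ∀ m : M, (∀ g ∈ p.blocks, m ∉ g.modes) → 1 - δ ≤ ((n.state * (1 - num m)).trace).re
  readout_nonneg : ∀ x y, 0 ≤ n.readout x y
  readout_sum : ∀ x, ∑ y, n.readout x y = 1
  readout_flip : ∀ x m, ∑ y, (if (m ∈ x ↔ m ∈ y) then 0 else n.readout x y) ≤ δ

/-- The probability of reporting the set `y` of occupied modes in an experiment, when the unknown
Hamiltonian is `H`: averaged over the random circuit, the diagonal entries of the final density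
operator (Born rule), followed by the readout map. -/
def Experiment.prob (e : Experiment M) (H : Op M) (n : Spam M) (y : Finset M) : ℝ :=
  ∑ s, e.weight s *
    ∑ x, ((circuitUnitary H (e.circuit s) * n.state *
      (circuitUnitary H (e.circuit s))ᴴ) x x).re * n.readout x y

end Fock

/-! ### The Hubbard model -/

/-- The two spin orientations; `0` is up and `1` is down. -/
abbrev Spin : Type := Fin 2

/-- The modes: two spin modes for each of the `N` sites, and `A` ancilla modes. -/
def Mode (N A : ℕ) : Type := (Fin N ×ₗ Spin) ⊕ₗ Fin A

instance instFintypeMode (N A : ℕ) : Fintype (Mode N A) :=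
  inferInstanceAs (Fintype ((Fin N ×ₗ Spin) ⊕ₗ Fin A))

instance instLinearOrderMode (N A : ℕ) : LinearOrder (Mode N A) :=
  inferInstanceAs (LinearOrder ((Fin N ×ₗ Spin) ⊕ₗ Fin A))

/-- The system mode of spin `σ` at site `i`. -/
def sysMode {N : ℕ} (A : ℕ) (i : Fin N) (σ : Spin) : Mode N A := Sum.inlₗ (toLex (i, σ))

/-- The coefficients of a Hubbard Hamiltonian on the graph `G`: hopping amplitudes (Hermitian, and
zero for pairs of sites that are not joined by an edge), chemical potentials and on-site
interactions. -/
structure Coeffs {N : ℕ} (G : SimpleGraph (Fin N)) where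
  h : Fin N → Fin N → Spin → ℂ
  ω : Fin N → Spin → ℝ
  ξ : Fin N → ℝ
  h_conj : ∀ i j σ, star (h i j σ) = h j i σ
  h_supp : ∀ i j σ, ¬ G.Adj i j → h i j σ = 0

/-- All coefficients have absolute value at most `Λ`. -/
structure Coeffs.BoundedBy {N : ℕ} {G : SimpleGraph (Fin N)} (c : Coeffs G) (Λ : ℝ) : Prop where
  h : ∀ i j σ, ‖c.h i j σ‖ ≤ Λ
  ω : ∀ i σ, |c.ω i σ| ≤ Λ
  ξ : ∀ i, |c.ξ i| ≤ Λ

/-- The Hubbard Hamiltonian, on the Fock space of the system and `A` ancilla modes (on which it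
acts trivially).  The first sum is effectively over ordered pairs of adjacent sites. -/
def Coeffs.hamiltonian {N : ℕ} {G : SimpleGraph (Fin N)} (c : Coeffs G) (A : ℕ) :
    Op (Mode N A) :=
  (∑ i, ∑ j, ∑ σ, c.h i j σ • (cre (sysMode A i σ) * ann (sysMode A j σ)))
    + (∑ i, ∑ σ, (c.ω i σ : ℂ) • num (sysMode A i σ))
    + ∑ i, (c.ξ i : ℂ) • (num (sysMode A i 0) * num (sysMode A i 1))

/-! ### Learning protocols -/

/-- A learning protocol for `N` sites with `A` ancilla modes: finitely many experiments, fixed in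
advance, and estimators of all coefficients, which are functions of the record of the reported
measurement outcomes. -/
structure Protocol (N A : ℕ) where
  numExp : ℕ
  exp : Fin numExp → Experiment (Mode N A)
  hEst : (Fin numExp → Finset (Mode N A)) → Fin N → Fin N → Spin → ℂ
  ωEst : (Fin numExp → Finset (Mode N A)) → Fin N → Spin → ℝ
  ξEst : (Fin numExp → Finset (Mode N A)) → Fin N → ℝ

namespace Protocol

variable {N A : ℕ}

/-- Across all experiments, the evolution time is at most `T`, for every choice of the random
circuits. -/
def TimeLE (P : Protocol N A) (T : ℝ) : Prop :=
  ∀ s : (e : Fin P.numExp) → (P.exp e).Seed, ∑ e, circuitTime ((P.exp e).circuit (s e)) ≤ T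

/-- Across all experiments, the number of FLO gates is at most `B`, for every choice of the random
circuits. -/
def GatesLE (P : Protocol N A) (B : ℝ) : Prop :=
  ∀ s : (e : Fin P.numExp) → (P.exp e).Seed,
    ((∑ e, circuitGates ((P.exp e).circuit (s e)) : ℕ) : ℝ) ≤ B

/-- The expectation of a function of the record of outcomes, the experiments being independent. -/
def expect (P : Protocol N A) (H : Op (Mode N A)) (n : Fin P.numExp → Spam (Mode N A))
    (f : (Fin P.numExp → Finset (Mode N A)) → ℝ) : ℝ :=
  ∑ r : Fin P.numExp → Finset (Mode N A), (∏ e, (P.exp e).prob H (n e) (r e)) * f r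

/-- Every coefficient is estimated with root-mean-square error at most `ε`. -/
structure Learns {G : SimpleGraph (Fin N)} (P : Protocol N A) (c : Coeffs G)
    (n : Fin P.numExp → Spam (Mode N A)) (ε : ℝ) : Prop where
  h : ∀ i j σ,
    Real.sqrt (P.expect (c.hamiltonian A) n (fun r => ‖P.hEst r i j σ - c.h i j σ‖ ^ 2)) ≤ ε
  ω : ∀ i σ,
    Real.sqrt (P.expect (c.hamiltonian A) n (fun r => (P.ωEst r i σ - c.ω i σ) ^ 2)) ≤ ε
  ξ : ∀ i,
    Real.sqrt (P.expect (c.hamiltonian A) n (fun r => (P.ξEst r i - c.ξ i) ^ 2)) ≤ ε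

end Protocol

end Hubbard

end

/-! Two modes `a`, `b` are prepared in an equal superposition of both empty and both occupied; FLO
gates preserve parity, so a superposition of zero and one particle in a single mode is not
available. The coherence of this state is the expectation of `pairOp`, the operator that annihilates
the pair, restricted to configurations in which at most two further modes `z` are empty. If the
Hamiltonian were diagonal in the occupation numbers and gave the pair the energy `lam`, this
operator would only acquire the phase exp(-i lam t), and a final pairing gate would turn a
quadrature of the phase into a function of at most four occupation numbers
(`Layout.pairGates_conj_obs`).

Diagonality is enforced by random signs. The evolution is cut into R cycles of length τ = t/R, each
conjugated by a fixed frame change F and by fresh uniformly random signs of all modes. To first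
order in τ the averaged Heisenberg evolution sees only the diagonal part of F†HF (`sum_twirlU_conj`,
`norm_channel_pairOp_sub_le`). The second order is controlled by a double commutator of H with an
operator on at most two sites, which bounded degree makes independent of N
(`Coeffs.norm_double_commutator_le`). The averaged cycle is a contraction, so the errors add up to
O(t²/R). As t reaches order 1/ε, taking R of order ε⁻² keeps this error a small constant; this costs
gates but no evolution time.

Three kinds of layout produce all coefficients. The two spins of a site give ω↑ + ω↓ + ξ. One spin
paired with an inert ancilla gives ω. One spin, after a balanced beam splitter along a matching,
gives (ω_i + ω_j)/2 + Re(conj(η) h_ij), with η = 1 and η = i (`Coeffs.siteLayout_energy`,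
`Coeffs.mixLayout_energy`). In the last two the opposite spins are in `z`, which removes the
interaction. All blocks are probed in parallel, and a number of matchings depending only on D covers
the edges (`exists_matchings`).

It remains to learn a frequency from phases that are known only up to a constant error, which is why
constant SPAM error is harmless (`Layout.Probes.abs_mean_sub_le`). Round j measures the phase at
time 2^j/B and halves the error of the estimate if the phase is right within 1/4. Round j is
repeated a multiple of J - j times, so it fails with probability of order 16^-(J-j) while a failure
costs a factor 4^(J-j) in the squared error; the mean square error is thus O(4^-J) and the total
time O(2^J), without logarithms (`prodExpect_sq_freqEst_le`, `sum_sub_mul_two_pow_le`,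
`freqExp_error`). -/

set_option linter.unusedSectionVars false

noncomputable section

namespace Hubbard

open scoped Matrix.Norms.L2Operator

/-! ### Canonical anticommutation relations in the occupation basis. -/

section CAR

variable {M : Type} [Fintype M] [LinearOrder M]

/-- The Jordan-Wigner sign of mode `m` in the configuration `S`. -/
def jw (m : M) (S : Finset M) : ℂ := (-1 : ℂ) ^ (S.filter (fun k => k < m)).card

lemma jw_mul_self (m : M) (S : Finset M) : jw m S * jw m S = 1 := by
  unfold jw; rw [← pow_add, ← two_mul, pow_mul]; simp

lemma star_jw (m : M) (S : Finset M) : star (jw m S) = jw m S := by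
  unfold jw; simp

lemma jw_insert_self (m : M) (S : Finset M) : jw m (insert m S) = jw m S := by
  unfold jw; congr 2; ext k; simp only [Finset.mem_filter, Finset.mem_insert]
  constructor
  · rintro ⟨rfl | h, h'⟩
    · exact absurd h' (lt_irrefl _)
    · exact ⟨h, h'⟩
  · rintro ⟨h, h'⟩; exact ⟨Or.inr h, h'⟩

lemma jw_insert {m k : M} {S : Finset M} (hk : k ∉ S) :
    jw m (insert k S) = (if k < m then -1 else 1) * jw m S := by
  unfold jw
  rw [Finset.filter_insert]
  split_ifs with h
  · rw [Finset.card_insert_of_notMem (by simp [hk]), pow_succ]; ring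
  · simp

lemma jw_erase {m k : M} {S : Finset M} (hk : k ∈ S) :
    jw m (S.erase k) = (if k < m then -1 else 1) * jw m S := by
  conv_rhs => rw [← Finset.insert_erase hk, jw_insert (Finset.notMem_erase k S)]
  split_ifs <;> ring

/-- A column of a ladder operator has at most one nonzero entry, so right multiplication picks one
column. The algebraic identities below are read off from this formula and its counterpart for `cre`.
-/
lemma mul_ann_apply (X : Op M) (m : M) (T S : Finset M) :
    (X * ann m) T S = if m ∈ S then jw m S * X T (S.erase m) else 0 := by
  rw [Matrix.mul_apply]
  split_ifs with h
  · rw [Finset.sum_eq_single (S.erase m)]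
    · simp [ann, h, jw, mul_comm]
    · intro R _ hR; simp [ann, hR]
    · simp
  · simp [ann, h]

lemma mul_cre_apply (X : Op M) (m : M) (T S : Finset M) :
    (X * cre m) T S = if m ∈ S then 0 else jw m S * X T (insert m S) := by
  rw [Matrix.mul_apply]
  split_ifs with h
  · apply Finset.sum_eq_zero
    intro R _
    simp only [cre, Matrix.conjTranspose_apply, ann]
    rw [if_neg]; · simp
    rintro ⟨_, rfl⟩; simp at h
  · rw [Finset.sum_eq_single (insert m S)]
    · have : ann m S (insert m S) = jw m S := by
        rw [← jw_insert_self m S]; simp [ann, jw, Finset.erase_insert h]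
      simp [cre, Matrix.conjTranspose_apply, this, star_jw, mul_comm]
    · intro R _ hR
      simp only [cre, Matrix.conjTranspose_apply, ann]
      rw [if_neg]; · simp
      rintro ⟨h1, rfl⟩; exact hR (Finset.insert_erase h1).symm
    · simp

lemma ann_conjTranspose (m : M) : (ann m)ᴴ = cre m := rfl
lemma cre_conjTranspose (m : M) : (cre m)ᴴ = ann m := Matrix.conjTranspose_conjTranspose _

lemma ann_mul_ann_apply (a b : M) (T S : Finset M) :
    (ann a * ann b) T S = if b ∈ S ∧ a ∈ S ∧ a ≠ b ∧ T = (S.erase b).erase a then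
      jw b S * jw a (S.erase b) else 0 := by
  rw [mul_ann_apply]
  by_cases hb : b ∈ S <;> by_cases ha : a ∈ S <;> by_cases hab : a = b <;>
    by_cases hT : T = (S.erase b).erase a <;> simp_all [ann, jw]

/-- The algebra of the annihilation operators. -/
lemma ann_mul_ann (a b : M) : ann a * ann b = -(ann b * ann a) := by
  ext T S
  rw [Matrix.neg_apply, ann_mul_ann_apply, ann_mul_ann_apply, show (S.erase b).erase a = (S.erase a).erase b from Finset.erase_right_comm]
  by_cases h : b ∈ S ∧ a ∈ S ∧ a ≠ b ∧ T = (S.erase a).erase b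
  · obtain ⟨hb, ha, hab, hT⟩ := h
    rw [if_pos ⟨hb, ha, hab, hT⟩, if_pos ⟨ha, hb, hab.symm, hT⟩, jw_erase hb, jw_erase ha]
    rcases lt_or_gt_of_ne hab with h | h
    · simp [h, h.not_gt]; ring
    · simp [h, h.not_gt]; ring
  · rw [if_neg h, if_neg, neg_zero]
    rintro ⟨ha, hb, hab, hT⟩
    exact h ⟨hb, ha, fun h => hab h.symm, hT⟩

lemma eq_zero_of_eq_neg {X : Op M} (h : X = -X) : X = 0 := by
  ext T S
  exact self_eq_neg.mp (congrFun (congrFun h T) S)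

lemma ann_sq (a : M) : ann a * ann a = 0 := by
  exact eq_zero_of_eq_neg (ann_mul_ann a a)

lemma cre_mul_cre (a b : M) : cre a * cre b = -(cre b * cre a) := by
  have := congrArg Matrix.conjTranspose (ann_mul_ann b a)
  simpa [cre] using this

lemma cre_sq (a : M) : cre a * cre a = 0 := eq_zero_of_eq_neg (cre_mul_cre a a)

/-- The number operators are diagonal in the occupation number basis. -/
lemma num_eq_diagonal (m : M) :
    num m = Matrix.diagonal (fun S : Finset M => if m ∈ S then (1 : ℂ) else 0) := by
  ext T S
  rw [num, mul_ann_apply]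
  by_cases h : m ∈ S
  · rw [if_pos h, Matrix.diagonal_apply]
    have h1 : cre m T (S.erase m) = if T = S then jw m S else 0 := by
      simp only [cre, Matrix.conjTranspose_apply, ann]
      by_cases hT : T = S
      · subst hT; simp [h, jw]
      · rw [if_neg, if_neg hT, star_zero]
        rintro ⟨h1, h2⟩
        exact hT (by rw [← Finset.insert_erase h1, ← h2, Finset.insert_erase h])
    rw [h1]
    by_cases hT : T = S
    · subst hT; simp [h, jw_mul_self]
    · simp [hT]
  · rw [if_neg h, Matrix.diagonal_apply]
    by_cases hT : T = S
    · subst hT; simp [h]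
    · simp [hT]

lemma ann_mul_cre_self (m : M) :
    ann m * cre m = Matrix.diagonal (fun S : Finset M => if m ∈ S then (0 : ℂ) else 1) := by
  ext T S
  rw [mul_cre_apply]
  by_cases h : m ∈ S
  · rw [if_pos h, Matrix.diagonal_apply]
    by_cases hT : T = S
    · subst hT; simp [h]
    · simp [hT]
  · rw [if_neg h, Matrix.diagonal_apply]
    have h1 : ann m T (insert m S) = if T = S then jw m S else 0 := by
      rw [← jw_insert_self m S]
      simp [ann, jw, Finset.erase_insert h]
    rw [h1]
    by_cases hT : T = S
    · subst hT; simp [h, jw_mul_self]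
    · simp [hT]

lemma ann_mul_cre_add_self (m : M) : ann m * cre m + cre m * ann m = 1 := by
  change _ + num m = 1
  rw [ann_mul_cre_self, num_eq_diagonal, Matrix.diagonal_add, ← Matrix.diagonal_one]
  congr 1; ext S; split_ifs <;> simp

/-- Both orders lead from S to `insert b (S.erase a)`. Exactly one of the two Jordan-Wigner signs
notices the presence of the other mode, whichever of `a`, `b` is smaller, hence the relative minus
sign. -/
lemma ann_mul_cre {a b : M} (hab : a ≠ b) : ann a * cre b = -(cre b * ann a) := by
  ext T S
  rw [Matrix.neg_apply, mul_cre_apply, mul_ann_apply]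
  have hc : ∀ R : Finset M, cre b T R = if b ∉ R ∧ T = insert b R then jw b R else 0 := by
    intro R
    have := mul_cre_apply (1 : Op M) b T R
    rw [one_mul] at this
    rw [this, Matrix.one_apply]
    by_cases h1 : b ∈ R <;> by_cases h2 : T = insert b R <;> simp [h1, h2]
  by_cases hb : b ∈ S
  · rw [if_pos hb]
    split_ifs with ha
    · rw [hc, if_neg]; · simp
      simp [hb, hab.symm]
    · simp
  · rw [if_neg hb]
    split_ifs with ha
    · have h1 : a ∈ insert b S := Finset.mem_insert_of_mem ha
      have h2 : b ∉ S.erase a := fun h => hb (Finset.mem_of_mem_erase h)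
      have h3 : (insert b S).erase a = insert b (S.erase a) :=
        Finset.erase_insert_of_ne (fun h => hab h.symm)
      rw [hc]
      change jw b S * (if a ∈ insert b S ∧ T = (insert b S).erase a then jw a (insert b S) else 0) = _
      rw [h3, jw_insert hb, jw_erase ha]
      by_cases hT : T = insert b (S.erase a)
      · rw [if_pos ⟨h1, hT⟩, if_pos (show b ∉ S.erase a ∧ T = insert b (S.erase a) from ⟨h2, hT⟩)]
        rcases lt_or_gt_of_ne hab with h | h
        · simp [h, h.not_gt]; ring
        · simp [h, h.not_gt]; ring
      · rw [if_neg (fun h => hT h.2), if_neg (show ¬ (b ∉ S.erase a ∧ T = insert b (S.erase a)) from fun h => hT h.2)]; simp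
    · have h1 : a ∉ insert b S := by simp [ha, hab]
      simp [ann, h1]

lemma cre_mul_ann {a b : M} (hab : a ≠ b) : cre a * ann b = -(ann b * cre a) := by
  rw [ann_mul_cre hab.symm, neg_neg]

lemma ann_mul_cre_self' (m : M) : ann m * cre m = 1 - cre m * ann m :=
  eq_sub_of_add_eq (ann_mul_cre_add_self m)

lemma num_conjTranspose (m : M) : (num m)ᴴ = num m := by
  simp [num, cre]

lemma norm_num_le (m : M) : ‖num m‖ ≤ 1 := by
  rw [num_eq_diagonal, Matrix.l2_opNorm_diagonal, pi_norm_le_iff_of_nonneg zero_le_one]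
  intro S; split_ifs <;> simp

lemma norm_ann_le (m : M) : ‖ann m‖ ≤ 1 := by
  have h := Matrix.l2_opNorm_conjTranspose_mul_self (ann m)
  have h2 : ‖(ann m)ᴴ * ann m‖ ≤ 1 := norm_num_le m
  nlinarith [norm_nonneg (ann m)]

lemma norm_cre_le (m : M) : ‖cre m‖ ≤ 1 := by
  rw [cre, Matrix.l2_opNorm_conjTranspose]; exact norm_ann_le m

end CAR

end Hubbard

namespace Hubbard

open scoped Matrix.Norms.L2Operator

/-! ### Operators supported away from a mode, and unitarity of the gates. -/

section Locality

variable {M : Type} [Fintype M] [LinearOrder M]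

/-- `X` commutes with the creation and annihilation operators of the mode `m`. -/
def Avoids (X : Op M) (m : M) : Prop := Commute X (ann m) ∧ Commute X (cre m)

/-- Two sign changes cancel. This makes even operators on disjoint modes commute, so that locality
needs no further Jordan-Wigner bookkeeping. -/
lemma commute_mul_of_anti {A B X : Op M} (h1 : A * X = -(X * A)) (h2 : B * X = -(X * B)) :
    Commute (A * B) X := by
  unfold Commute SemiconjBy
  rw [mul_assoc, h2, mul_neg, ← mul_assoc, h1, neg_mul, neg_neg, mul_assoc]

namespace Avoids

variable {X Y : Op M} {m : M}

lemma mul (hX : Avoids X m) (hY : Avoids Y m) : Avoids (X * Y) m :=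
  ⟨hX.1.mul_left hY.1, hX.2.mul_left hY.2⟩

lemma add (hX : Avoids X m) (hY : Avoids Y m) : Avoids (X + Y) m :=
  ⟨hX.1.add_left hY.1, hX.2.add_left hY.2⟩

lemma sub (hX : Avoids X m) (hY : Avoids Y m) : Avoids (X - Y) m :=
  ⟨hX.1.sub_left hY.1, hX.2.sub_left hY.2⟩

lemma smul (z : ℂ) (hX : Avoids X m) : Avoids (z • X) m :=
  ⟨hX.1.smul_left z, hX.2.smul_left z⟩

lemma one : Avoids (1 : Op M) m := ⟨Commute.one_left _, Commute.one_left _⟩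

lemma zero : Avoids (0 : Op M) m := ⟨Commute.zero_left _, Commute.zero_left _⟩

lemma sum {ι : Type*} {s : Finset ι} {f : ι → Op M} (h : ∀ i ∈ s, Avoids (f i) m) :
    Avoids (∑ i ∈ s, f i) m :=
  ⟨Commute.sum_left _ _ _ fun i hi => (h i hi).1, Commute.sum_left _ _ _ fun i hi => (h i hi).2⟩

lemma conjTranspose (hX : Avoids X m) : Avoids Xᴴ m := by
  constructor
  · have := congrArg Matrix.conjTranspose hX.2.eq
    simp only [Matrix.conjTranspose_mul, cre_conjTranspose] at this
    exact this.symm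
  · have := congrArg Matrix.conjTranspose hX.1.eq
    simp only [Matrix.conjTranspose_mul, ann_conjTranspose] at this
    exact this.symm

lemma expI (t : ℝ) (hX : Avoids X m) : Avoids (expI t X) m :=
  ⟨((hX.smul _).1).exp_left, ((hX.smul _).2).exp_left⟩

lemma ann_ann {a b : M} (ha : a ≠ m) (hb : b ≠ m) : Avoids (ann a * ann b) m :=
  ⟨commute_mul_of_anti (ann_mul_ann a m) (ann_mul_ann b m),
    commute_mul_of_anti (ann_mul_cre ha) (ann_mul_cre hb)⟩

lemma cre_ann {a b : M} (ha : a ≠ m) (hb : b ≠ m) : Avoids (cre a * ann b) m :=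
  ⟨commute_mul_of_anti (cre_mul_ann ha) (ann_mul_ann b m),
    commute_mul_of_anti (cre_mul_cre a m) (ann_mul_cre hb)⟩

lemma cre_cre {a b : M} (ha : a ≠ m) (hb : b ≠ m) : Avoids (cre a * cre b) m :=
  ⟨commute_mul_of_anti (cre_mul_ann ha) (cre_mul_ann hb),
    commute_mul_of_anti (cre_mul_cre a m) (cre_mul_cre b m)⟩

lemma num {a : M} (ha : a ≠ m) : Avoids (num a) m := cre_ann ha ha

lemma gen {g : FLO M} (hm : m ∉ g.modes) : Avoids g.gen m := by
  have h1 : g.fst ≠ m := by rintro rfl; simp [FLO.modes] at hm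
  have h2 : g.snd ≠ m := by rintro rfl; simp [FLO.modes] at hm
  unfold FLO.gen
  exact ((((num h1).smul _).add ((num h2).smul _)).add
    (((cre_ann h1 h2).smul _).add ((cre_ann h2 h1).smul _))).add
    (((cre_cre h1 h2).smul _).add ((ann_ann h2 h1).smul _))

lemma unitary {g : FLO M} (hm : m ∉ g.modes) : Avoids g.unitary m := (gen hm).expI 1

lemma commute_num (hX : Avoids X m) : Commute X (Hubbard.num m) := hX.2.mul_right hX.1

lemma commute_gen {g : FLO M} (h1 : Avoids X g.fst) (h2 : Avoids X g.snd) : Commute X g.gen := by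
  unfold FLO.gen
  exact ((((h1.commute_num).smul_right _).add_right ((h2.commute_num).smul_right _)).add_right
    (((h1.2.mul_right h2.1).smul_right _).add_right ((h2.2.mul_right h1.1).smul_right _))).add_right
    (((h1.2.mul_right h2.2).smul_right _).add_right ((h2.1.mul_right h1.1).smul_right _))

lemma commute_unitary {g : FLO M} (h1 : Avoids X g.fst) (h2 : Avoids X g.snd) :
    Commute X g.unitary :=
  ((commute_gen h1 h2).smul_right _).exp_right

end Avoids

/-- The projection onto the configurations in which all modes of `z` are empty. -/
def emptyProj (z : Finset M) : Op M :=
  Matrix.diagonal fun S => if Disjoint z S then 1 else 0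

lemma emptyProj_empty : emptyProj (∅ : Finset M) = 1 := by
  simp [emptyProj]

lemma emptyProj_insert (m : M) (z : Finset M) :
    emptyProj (insert m z) = (1 - num m) * emptyProj z := by
  rw [num_eq_diagonal, emptyProj, emptyProj, ← Matrix.diagonal_one, Matrix.diagonal_sub,
    Matrix.diagonal_mul_diagonal]
  congr 1; ext S
  by_cases h : m ∈ S <;> simp [Finset.disjoint_insert_left, h]

lemma emptyProj_singleton (m : M) : emptyProj {m} = 1 - num m := by
  have := emptyProj_insert m ∅
  rwa [emptyProj_empty, mul_one, insert_empty_eq] at this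

lemma emptyProj_conjTranspose (z : Finset M) : (emptyProj z)ᴴ = emptyProj z := by
  rw [emptyProj, Matrix.diagonal_conjTranspose]
  congr 1; ext S; simp only [Pi.star_apply]; split_ifs <;> simp

lemma emptyProj_mul_self (z : Finset M) : emptyProj z * emptyProj z = emptyProj z := by
  rw [emptyProj, Matrix.diagonal_mul_diagonal]
  congr 1; ext S; split_ifs <;> simp

lemma Avoids.emptyProj {z : Finset M} {m : M} (h : m ∉ z) : Avoids (emptyProj z) m := by
  induction z using Finset.induction_on with
  | empty => rw [emptyProj_empty]; exact one
  | insert k z _ ih =>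
    rw [emptyProj_insert]
    exact (one.sub (num (by rintro rfl; simp at h))).mul (ih fun hk => h (by simp [hk]))

lemma expI_conjTranspose (t : ℝ) {K : Op M} (hK : Kᴴ = K) : (expI t K)ᴴ = expI (-t) K := by
  unfold expI
  rw [← Matrix.exp_conjTranspose, Matrix.conjTranspose_smul, hK]
  congr 2
  simp

lemma expI_add (s t : ℝ) (K : Op M) : expI (s + t) K = expI s K * expI t K := by
  unfold expI
  rw [← Matrix.exp_add_of_commute _ _ (((Commute.refl K).smul_left _).smul_right _), ← add_smul]
  congr 2
  push_cast; ring

lemma expI_zero (K : Op M) : expI 0 K = 1 := by simp [expI, NormedSpace.exp_zero]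

lemma expI_mem_unitary (t : ℝ) {K : Op M} (hK : Kᴴ = K) : expI t K ∈ unitary (Op M) := by
  rw [Unitary.mem_iff, Matrix.star_eq_conjTranspose, expI_conjTranspose t hK, ← expI_add,
    ← expI_add]
  simp [expI_zero]

lemma FLO.gen_conjTranspose (g : FLO M) : g.genᴴ = g.gen := by
  unfold FLO.gen
  simp only [Matrix.conjTranspose_add, Matrix.conjTranspose_smul, num_conjTranspose,
    Matrix.conjTranspose_mul, ann_conjTranspose, cre_conjTranspose, star_star]
  simp only [RCLike.star_def, Complex.conj_ofReal]
  abel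

lemma FLO.unitary_mem (g : FLO M) : g.unitary ∈ _root_.unitary (Op M) :=
  expI_mem_unitary 1 g.gen_conjTranspose

end Locality

/-! ### Reflections 1 - 2b†b and the mixing of two modes. -/

section Reflection

variable {M : Type} [Fintype M] [LinearOrder M]

/-- All positive powers of P equal P, so the series is that of the scalar exponential times P,
except that the zeroth term is 1 instead of P. -/
lemma exp_smul_idempotent {P : Op M} (hP : P * P = P) (z : ℂ) :
    NormedSpace.exp (z • P) = 1 + (Complex.exp z - 1) • P := by
  have h0 : ∀ n : ℕ, P ^ (n + 1) = P := by
    intro n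
    induction n with
    | zero => simp
    | succ n ih => rw [pow_succ, ih, hP]
  have h1 : HasSum (fun n : ℕ => ((n.factorial : ℂ)⁻¹ • z ^ n) • P) (NormedSpace.exp z • P) :=
    (NormedSpace.exp_series_hasSum_exp' (𝕂 := ℂ) z).smul_const P
  have h2 : HasSum (fun n : ℕ => if n = 0 then (1 - P : Op M) else 0) (1 - P) := by
    have := hasSum_ite_eq (0 : ℕ) (1 - P : Op M)
    convert this using 2
  have h3 := h2.add h1
  have h4 := NormedSpace.exp_series_hasSum_exp' (𝕂 := ℂ) (z • P)
  have h5 : (fun n : ℕ => (n.factorial : ℂ)⁻¹ • (z • P) ^ n) = fun n : ℕ =>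
      (if n = 0 then (1 - P : Op M) else 0) + ((n.factorial : ℂ)⁻¹ • z ^ n) • P := by
    ext1 n
    cases n with
    | zero => simp
    | succ n => simp [smul_pow, h0, smul_smul]
  rw [h5] at h4
  rw [h4.unique h3, ← Complex.exp_eq_exp_ℂ]
  module

lemma expI_pi_idempotent {P : Op M} (hP : P * P = P) :
    expI 1 ((Real.pi : ℂ) • P) = 1 - (2 : ℂ) • P := by
  unfold expI
  rw [smul_smul, exp_smul_idempotent hP]
  have : -(Complex.I * ((1 : ℝ) : ℂ)) * (Real.pi : ℂ) = -(Real.pi * Complex.I) := by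
    push_cast; ring
  rw [this, Complex.exp_neg, Complex.exp_pi_mul_I]
  norm_num
  module

/-- For a pairing gate the projection contains a_b a_b† = 1 - n_b; the resulting constant is not a
term of an FLO generator and has to be subtracted, at the price of a phase. -/
lemma expI_pi_idempotent_sub {P : Op M} (hP : P * P = P) (c : ℝ) :
    expI 1 ((Real.pi : ℂ) • P - (c : ℂ) • 1) =
      Complex.exp (Complex.I * c) • (1 - (2 : ℂ) • P) := by
  rw [← expI_pi_idempotent hP]
  unfold expI
  have h1 : -(Complex.I * ((1 : ℝ) : ℂ)) • ((Real.pi : ℂ) • P - (c : ℂ) • (1 : Op M)) =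
      -(Complex.I * ((1 : ℝ) : ℂ)) • ((Real.pi : ℂ) • P) + (Complex.I * c) • (1 : Op M) := by
    push_cast; module
  rw [h1, Matrix.exp_add_of_commute _ _ ((Commute.one_right _).smul_right _),
    exp_smul_idempotent (mul_one (1 : Op M))]
  have : (1 : Op M) + (Complex.exp (Complex.I * c) - 1) • 1 = Complex.exp (Complex.I * c) • 1 := by
    module
  rw [this, mul_smul_comm, mul_one]

/-- A pair of operators that satisfy the canonical anticommutation relations of two modes. -/
structure IsCARPair (x y : Op M) : Prop where
  xx : x * x = 0
  yy : y * y = 0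
  xy : x * y = -(y * x)
  xxH : x * xᴴ = 1 - xᴴ * x
  yyH : y * yᴴ = 1 - yᴴ * y
  xyH : x * yᴴ = -(yᴴ * x)

lemma isCARPair_ann_ann {a b : M} (hab : a ≠ b) : IsCARPair (ann a) (ann b) :=
  ⟨ann_sq a, ann_sq b, ann_mul_ann a b, ann_mul_cre_self' a, ann_mul_cre_self' b, ann_mul_cre hab⟩

lemma isCARPair_ann_cre {a b : M} (hab : a ≠ b) : IsCARPair (ann a) (cre b) where
  xx := ann_sq a
  yy := cre_sq b
  xy := ann_mul_cre hab
  xxH := ann_mul_cre_self' a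
  yyH := by rw [cre_conjTranspose, ann_mul_cre_self']; abel
  xyH := by rw [cre_conjTranspose]; exact ann_mul_ann a b

/-- The fermionic Householder reflection: the anticommutator of b† with x is the component c of x
along b, and conjugation flips the sign of that component. -/
lemma reflection_conj {b x : Op M} {c : ℂ} (hb : b * b = 0) (hbb : b * bᴴ = 1 - bᴴ * b)
    (hbx : b * x = -(x * b)) (hx : bᴴ * x = c • 1 - x * bᴴ) :
    (1 - (2 : ℂ) • (bᴴ * b)) * x * (1 - (2 : ℂ) • (bᴴ * b)) = x - (2 * c) • b := by
  have h1 : bᴴ * b * x = -(c • b) + x * (bᴴ * b) := by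
    rw [mul_assoc, hbx, mul_neg, ← mul_assoc, hx, sub_mul, smul_mul_assoc, one_mul, mul_assoc]
    abel
  have h2 : b * (bᴴ * b) = b := by
    rw [← mul_assoc, hbb, sub_mul, one_mul, mul_assoc, hb, mul_zero, sub_zero]
  have h3 : (bᴴ * b) * (bᴴ * b) = bᴴ * b := by
    rw [mul_assoc, h2]
  have h4 : (1 - (2 : ℂ) • (bᴴ * b)) * x = x * (1 - (2 : ℂ) • (bᴴ * b)) + (2 * c) • b := by
    rw [sub_mul, one_mul, smul_mul_assoc, h1, mul_sub, mul_one, mul_smul_comm]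
    module
  have h5 : (1 - (2 : ℂ) • (bᴴ * b)) * (1 - (2 : ℂ) • (bᴴ * b)) = 1 := by
    simp only [sub_mul, mul_sub, one_mul, mul_one, smul_mul_assoc, mul_smul_comm, h3]
    module
  have h6 : b * (1 - (2 : ℂ) • (bᴴ * b)) = -b := by
    rw [mul_sub, mul_one, mul_smul_comm, h2]
    module
  rw [h4, add_mul, mul_assoc, h5, mul_one, smul_mul_assoc, h6]
  module

/-- The projection `b† b` with `b = sin (π/8) x - η cos (π/8) y`. -/
def splitProj (x y : Op M) (η : ℂ) : Op M :=
  ((Real.sin (Real.pi / 8) : ℂ) • x - ((Real.cos (Real.pi / 8) : ℂ) * η) • y)ᴴ *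
    ((Real.sin (Real.pi / 8) : ℂ) • x - ((Real.cos (Real.pi / 8) : ℂ) * η) • y)

lemma splitProj_eq (x y : Op M) (η : ℂ) (hη : star η * η = 1) :
    splitProj x y η = ((Real.sin (Real.pi / 8) ^ 2 : ℝ) : ℂ) • (xᴴ * x)
      + ((Real.cos (Real.pi / 8) ^ 2 : ℝ) : ℂ) • (yᴴ * y)
      - ((Real.sin (Real.pi / 8) * Real.cos (Real.pi / 8) : ℝ) : ℂ) •
        (η • (xᴴ * y) + star η • (yᴴ * x)) := by
  unfold splitProj
  have hη' : (starRingEnd ℂ) η * η = 1 := hη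
  simp only [Matrix.conjTranspose_sub, Matrix.conjTranspose_smul, sub_mul, mul_sub,
    smul_mul_assoc, mul_smul_comm, RCLike.star_def, Complex.conj_ofReal, map_mul]
  match_scalars
  · ring
  · ring
  · ring
  · linear_combination (Complex.cos (Real.pi / 8 : ℂ)) ^ 2 * hη'

/-- A reflection doubles angles, so the direction π/8 yields the angle π/4, the balanced splitter
with amplitudes √2/2. -/
lemma sin_sq_pi_div_eight : 1 - 2 * Real.sin (Real.pi / 8) ^ 2 = √2 / 2 := by
  have h := Real.cos_sq' (Real.pi / 8)
  have h2 := Real.cos_two_mul (Real.pi / 8)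
  rw [show 2 * (Real.pi / 8) = Real.pi / 4 by ring, Real.cos_pi_div_four] at h2
  linarith

lemma cos_sq_pi_div_eight : 2 * Real.cos (Real.pi / 8) ^ 2 - 1 = √2 / 2 := by
  have h2 := Real.cos_two_mul (Real.pi / 8)
  rw [show 2 * (Real.pi / 8) = Real.pi / 4 by ring, Real.cos_pi_div_four] at h2
  linarith

lemma sin_mul_cos_pi_div_eight :
    2 * Real.sin (Real.pi / 8) * Real.cos (Real.pi / 8) = √2 / 2 := by
  have h2 := Real.sin_two_mul (Real.pi / 8)
  rw [show 2 * (Real.pi / 8) = Real.pi / 4 by ring, Real.sin_pi_div_four] at h2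
  linarith

/-- The unitary `1 - 2 b† b` with `b = sin (π/8) x - η cos (π/8) y`. -/
def splitter (x y : Op M) (η : ℂ) : Op M := 1 - (2 : ℂ) • splitProj x y η

variable {x y : Op M} {η : ℂ}

/-- As sin² + cos² = 1 and |η| = 1, the combination b of x and y is again a fermionic mode; hence
b†b is a projection and `reflection_conj` applies to x and to y. -/
lemma splitProj_idem (h : IsCARPair x y) (hη : star η * η = 1) :
    splitProj x y η * splitProj x y η = splitProj x y η ∧
    splitter x y η * x * splitter x y η = ((√2 / 2 : ℝ) : ℂ) • (x + η • y) ∧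
    splitter x y η * y * splitter x y η = ((√2 / 2 : ℝ) : ℂ) • (star η • x - y) := by
  have hsq : ((Real.sin (Real.pi / 8) : ℝ) : ℂ) ^ 2 + ((Real.cos (Real.pi / 8) : ℝ) : ℂ) ^ 2 = 1 := by
    exact_mod_cast Real.sin_sq_add_cos_sq (Real.pi / 8)
  have e1 : ((√2 / 2 : ℝ) : ℂ) = 1 - 2 * ((Real.sin (Real.pi / 8) : ℝ) : ℂ) ^ 2 := by
    rw [← sin_sq_pi_div_eight]; push_cast; rfl
  have e2 : ((√2 / 2 : ℝ) : ℂ) =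
      2 * ((Real.sin (Real.pi / 8) : ℝ) : ℂ) * ((Real.cos (Real.pi / 8) : ℝ) : ℂ) := by
    rw [← sin_mul_cos_pi_div_eight]; push_cast; rfl
  have e3 : ((√2 / 2 : ℝ) : ℂ) = 2 * ((Real.cos (Real.pi / 8) : ℝ) : ℂ) ^ 2 - 1 := by
    rw [← cos_sq_pi_div_eight]; push_cast; rfl
  have hη' : (starRingEnd ℂ) η * η = 1 := hη
  have hyxH : y * xᴴ = -(xᴴ * y) := by
    have := congrArg Matrix.conjTranspose h.xyH
    simpa using this
  unfold splitter splitProj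
  generalize Real.sin (Real.pi / 8) = s at *
  generalize Real.cos (Real.pi / 8) = q at *
  generalize √2 / 2 = κ at *
  generalize hb : (s : ℂ) • x - ((q : ℂ) * η) • y = b
  replace hb := hb.symm
  have hbH : bᴴ = (s : ℂ) • xᴴ - ((q : ℂ) * star η) • yᴴ := by
    simp [hb, Matrix.conjTranspose_sub, Matrix.conjTranspose_smul]
  have hbb0 : b * b = 0 := by
    simp only [hb, sub_mul, mul_sub, smul_mul_assoc, mul_smul_comm, h.xx, h.yy, h.xy]
    module
  have hbbH : b * bᴴ = 1 - bᴴ * b := by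
    rw [hbH, hb]
    simp only [sub_mul, mul_sub, smul_mul_assoc, mul_smul_comm, h.xxH, h.yyH, h.xyH, hyxH,
      RCLike.star_def]
    match_scalars
    · linear_combination hsq + (q : ℂ) ^ 2 * hη'
    all_goals ring
  have hbx : b * x = -(x * b) := by
    simp only [hb, sub_mul, mul_sub, smul_mul_assoc, mul_smul_comm, h.xx, h.xy]
    module
  have hby : b * y = -(y * b) := by
    simp only [hb, sub_mul, mul_sub, smul_mul_assoc, mul_smul_comm, h.yy, h.xy]
    module
  have hbHx : bᴴ * x = (s : ℂ) • 1 - x * bᴴ := by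
    simp only [hbH, sub_mul, mul_sub, smul_mul_assoc, mul_smul_comm, h.xxH, h.xyH]
    module
  have hbHy : bᴴ * y = (-((q : ℂ) * star η)) • 1 - y * bᴴ := by
    simp only [hbH, sub_mul, mul_sub, smul_mul_assoc, mul_smul_comm, h.yyH, hyxH]
    module
  have h2 : b * (bᴴ * b) = b := by
    rw [← mul_assoc, hbbH, sub_mul, one_mul, mul_assoc, hbb0, mul_zero, sub_zero]
  refine ⟨by rw [mul_assoc, h2], ?_, ?_⟩
  · rw [reflection_conj hbb0 hbbH hbx hbHx, hb]
    match_scalars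
    · linear_combination -e1
    · linear_combination -η * e2
  · rw [reflection_conj hbb0 hbbH hby hbHy, hb]
    simp only [RCLike.star_def]
    match_scalars
    · linear_combination e3 - 2 * (q : ℂ) ^ 2 * hη'
    · linear_combination -(starRingEnd ℂ) η * e2

end Reflection

end Hubbard

namespace Hubbard

open scoped Matrix.Norms.L2Operator

/-! ### Beam splitters, pairing gates and lists of gates. -/

section Gates

variable {M : Type} [Fintype M] [LinearOrder M]

/-- The beam splitter that mixes the modes `a` and `b`. -/
def hopGate (a b : M) (hab : a ≠ b) (η : ℂ) : FLO M where
  fst := a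
  snd := b
  ne := hab
  e₁ := Real.pi * Real.sin (Real.pi / 8) ^ 2
  e₂ := Real.pi * Real.cos (Real.pi / 8) ^ 2
  hop := -((Real.pi * (Real.sin (Real.pi / 8) * Real.cos (Real.pi / 8)) : ℝ) : ℂ) * η
  pair := 0

/-- The pairing gate that mixes `a_a` and `a_b†`. -/
def pairGate (a b : M) (hab : a ≠ b) (η : ℂ) : FLO M where
  fst := a
  snd := b
  ne := hab
  e₁ := Real.pi * Real.sin (Real.pi / 8) ^ 2
  e₂ := -(Real.pi * Real.cos (Real.pi / 8) ^ 2)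
  hop := 0
  pair := -((Real.pi * (Real.sin (Real.pi / 8) * Real.cos (Real.pi / 8)) : ℝ) : ℂ) * η

/-- The trivial gate. -/
def idGate (a b : M) (hab : a ≠ b) : FLO M := ⟨a, b, hab, 0, 0, 0, 0⟩

/-- The gate that changes the sign of the mode `a` if `s` is true. -/
def phaseGate (a b : M) (hab : a ≠ b) (s : Bool) : FLO M :=
  ⟨a, b, hab, if s then Real.pi else 0, 0, 0, 0⟩

lemma idGate_unitary (a b : M) (hab : a ≠ b) : (idGate a b hab).unitary = 1 := by
  simp [FLO.unitary, FLO.gen, idGate, expI, NormedSpace.exp_zero]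

lemma hopGate_unitary (a b : M) (hab : a ≠ b) {η : ℂ} (hη : star η * η = 1) :
    (hopGate a b hab η).unitary = splitter (ann a) (ann b) η := by
  rw [splitter, ← expI_pi_idempotent (splitProj_idem (isCARPair_ann_ann hab) hη).1, FLO.unitary]
  congr 1
  rw [splitProj_eq _ _ _ hη]
  simp only [FLO.gen, hopGate, ann_conjTranspose, num]
  simp only [star_mul', star_neg, RCLike.star_def, Complex.conj_ofReal]
  push_cast
  simp only [zero_smul, map_zero, add_zero]
  module

/-- The gate is a reflection only up to the phase from normal ordering a_b a_b†. The phase drops out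
of every conjugation, so only its modulus matters. -/
lemma pairGate_unitary (a b : M) (hab : a ≠ b) {η : ℂ} (hη : star η * η = 1) :
    ∃ z : ℂ, star z * z = 1 ∧
      (pairGate a b hab η).unitary = z • splitter (ann a) (cre b) η := by
  refine ⟨Complex.exp (Complex.I * (Real.pi * Real.cos (Real.pi / 8) ^ 2 : ℝ)), ?_, ?_⟩
  rotate_left
  · rw [splitter, ← expI_pi_idempotent_sub (splitProj_idem (isCARPair_ann_cre hab) hη).1
      (Real.pi * Real.cos (Real.pi / 8) ^ 2), FLO.unitary]
    congr 1
    rw [splitProj_eq _ _ _ hη]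
    simp only [FLO.gen, pairGate, ann_conjTranspose, cre_conjTranspose, num, ann_mul_cre_self']
    simp only [star_mul', star_neg, RCLike.star_def, Complex.conj_ofReal]
    push_cast
    simp only [zero_smul, map_zero, add_zero]
    module
  · rw [RCLike.star_def, ← Complex.exp_conj, ← Complex.exp_add, map_mul, Complex.conj_I,
      Complex.conj_ofReal, neg_mul, neg_add_cancel, Complex.exp_zero]

lemma phaseGate_unitary (a b : M) (hab : a ≠ b) (s : Bool) :
    (phaseGate a b hab s).unitary =
      Matrix.diagonal fun S : Finset M => if s = true ∧ a ∈ S then (-1 : ℂ) else 1 := by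
  cases s with
  | false => simp [FLO.unitary, FLO.gen, phaseGate, expI, NormedSpace.exp_zero]
  | true =>
    have hP : num a * num a = num a := by
      rw [num_eq_diagonal, Matrix.diagonal_mul_diagonal]; congr 1; ext S; split_ifs <;> simp
    have : (phaseGate a b hab true).unitary = expI 1 ((Real.pi : ℂ) • num a) := by
      simp [FLO.unitary, FLO.gen, phaseGate]
    rw [this, expI_pi_idempotent hP, num_eq_diagonal, ← Matrix.diagonal_one, ← Matrix.diagonal_smul,
      Matrix.diagonal_sub]
    congr 1; ext S
    by_cases h : a ∈ S <;> simp [h]; norm_num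

lemma splitProj_conjTranspose (x y : Op M) (η : ℂ) : (splitProj x y η)ᴴ = splitProj x y η := by
  simp [splitProj]

lemma splitter_conjTranspose (x y : Op M) (η : ℂ) : (splitter x y η)ᴴ = splitter x y η := by
  simp [splitter, splitProj_conjTranspose]

lemma splitter_mul_self {x y : Op M} {η : ℂ} (h : IsCARPair x y) (hη : star η * η = 1) :
    splitter x y η * splitter x y η = 1 := by
  have hP := (splitProj_idem h hη).1
  simp only [splitter, sub_mul, mul_sub, one_mul, mul_one, smul_mul_assoc, mul_smul_comm, hP]
  module

/-- The unitary of a list of gates, the head being applied first. -/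
def gatesU : List (FLO M) → Op M
  | [] => 1
  | g :: l => gatesU l * g.unitary

lemma gatesU_append (l l' : List (FLO M)) : gatesU (l ++ l') = gatesU l' * gatesU l := by
  induction l with
  | nil => simp [gatesU]
  | cons g l ih => simp [gatesU, ih, mul_assoc]

lemma gatesU_mem (l : List (FLO M)) : gatesU l ∈ unitary (Op M) := by
  induction l with
  | nil => exact one_mem _
  | cons g l ih => exact mul_mem ih g.unitary_mem

/-- Hermitian unitaries are their own inverses, so a frame change is undone by the same gates in the
opposite order. -/
lemma gatesU_reverse {l : List (FLO M)} (h : ∀ g ∈ l, (g.unitary)ᴴ = g.unitary) :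
    gatesU l.reverse = (gatesU l)ᴴ := by
  induction l with
  | nil => simp [gatesU]
  | cons g l ih =>
    rw [List.reverse_cons, gatesU_append, ih fun k hk => h k (by simp [hk])]
    simp [gatesU, h g]

lemma circuitUnitary_append (H : Op M) (c c' : Circuit M) :
    circuitUnitary H (c ++ c') = circuitUnitary H c' * circuitUnitary H c := by
  induction c with
  | nil => simp [circuitUnitary]
  | cons s c ih => simp [circuitUnitary, ih, mul_assoc]

lemma circuitUnitary_gates (H : Op M) (l : List (FLO M)) :
    circuitUnitary H (l.map Step.gate) = gatesU l := by
  induction l with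
  | nil => rfl
  | cons g l ih => simp [circuitUnitary, gatesU, ih, Step.unitary]

lemma gatesU_conj_of_commute {ι : Type} {l : List ι} {f : ι → FLO M} {X : Op M}
    (h : ∀ i ∈ l, Commute (f i).unitary X) :
    (gatesU (l.map f))ᴴ * X * gatesU (l.map f) = X := by
  have hc : Commute (gatesU (l.map f)) X := by
    induction l with
    | nil => exact Commute.one_left _
    | cons i l ih => exact (ih fun k hk => h k (by simp [hk])).mul_left (h i (by simp))
  rw [mul_assoc, ← hc.eq, ← mul_assoc]
  have := (Unitary.mem_iff.mp (gatesU_mem (l.map f))).1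
  rw [Matrix.star_eq_conjTranspose] at this
  rw [this, one_mul]

/-- Conjugation by a list of gates of which only one acts on the given operator. -/
lemma gatesU_conj {ι : Type} {l : List ι} (hl : l.Nodup) {f : ι → FLO M} {X Y : Op M} {i : ι}
    (hi : i ∈ l) (hX : ∀ k ∈ l, k ≠ i → Commute (f k).unitary X)
    (hY : ∀ k ∈ l, k ≠ i → Commute (f k).unitary Y)
    (h : ((f i).unitary)ᴴ * X * (f i).unitary = Y) :
    (gatesU (l.map f))ᴴ * X * gatesU (l.map f) = Y := by
  induction l with
  | nil => simp at hi
  | cons k l ih =>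
    have e : (gatesU ((k :: l).map f))ᴴ * X * gatesU ((k :: l).map f) =
        ((f k).unitary)ᴴ * ((gatesU (l.map f))ᴴ * X * gatesU (l.map f)) * (f k).unitary := by
      simp [gatesU, mul_assoc]
    rw [e]
    rw [List.nodup_cons] at hl
    by_cases hk : k = i
    · subst hk
      rw [gatesU_conj_of_commute, h]
      intro m hm
      exact hX m (by simp [hm]) (fun h' => hl.1 (h' ▸ hm))
    · rw [ih hl.2 (by simpa [Ne.symm hk] using hi) (fun m hm => hX m (by simp [hm]))
        (fun m hm => hY m (by simp [hm]))]
      rw [mul_assoc, ← (hY k (by simp) hk).eq, ← mul_assoc]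
      have := (Unitary.mem_iff.mp (f k).unitary_mem).1
      rw [Matrix.star_eq_conjTranspose] at this
      rw [this, one_mul]

end Gates

/-! ### Random signs of the modes. -/

section Twirl

variable {M : Type} [Fintype M] [LinearOrder M]

/-- The signs that a choice of phases gives to the configurations. -/
def twirlSign (γ : M → Bool) (S : Finset M) : ℂ := ∏ m, if γ m = true ∧ m ∈ S then -1 else 1

/-- The gates that change the sign of the modes selected by `γ`; the gate that acts on the mode
`m` uses the spectator mode `w m`. -/
def twirlGates (w : M → M) (hw : ∀ m, m ≠ w m) (γ : M → Bool) : List (FLO M) :=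
  (Finset.univ : Finset M).toList.map fun m => phaseGate m (w m) (hw m) (γ m)

/-- The unitary of the phase gates. -/
def twirlU (γ : M → Bool) : Op M := Matrix.diagonal (twirlSign γ)

lemma gatesU_twirlGates (w : M → M) (hw : ∀ m, m ≠ w m) (γ : M → Bool) :
    gatesU (twirlGates w hw γ) = twirlU γ := by
  have key : ∀ l : List M, gatesU (l.map fun m => phaseGate m (w m) (hw m) (γ m)) =
      Matrix.diagonal fun S : Finset M =>
        (l.map fun m => if γ m = true ∧ m ∈ S then (-1 : ℂ) else 1).prod := by
    intro l
    induction l with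
    | nil => simp [gatesU]
    | cons m l ih =>
      simp only [List.map_cons, gatesU, ih, phaseGate_unitary, Matrix.diagonal_mul_diagonal,
        List.prod_cons]
      congr 1; ext S; ring
  rw [twirlGates, key, twirlU]
  congr 1; ext S
  rw [twirlSign, Finset.prod_map_toList]

lemma twirlGates_hermitian (w : M → M) (hw : ∀ m, m ≠ w m) (γ : M → Bool) :
    ∀ g ∈ twirlGates w hw γ, (g.unitary)ᴴ = g.unitary := by
  intro g hg
  simp only [twirlGates, List.mem_map] at hg
  obtain ⟨m, _, rfl⟩ := hg
  rw [phaseGate_unitary, Matrix.diagonal_conjTranspose]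
  congr 1; ext S; simp only [Pi.star_apply]; split_ifs <;> simp

lemma twirlSign_mul_self (γ : M → Bool) (S : Finset M) : twirlSign γ S * twirlSign γ S = 1 := by
  rw [twirlSign, ← Finset.prod_mul_distrib]
  apply Finset.prod_eq_one
  intro m _; split_ifs <;> simp

lemma twirlU_conjTranspose (γ : M → Bool) : (twirlU γ)ᴴ = twirlU γ := by
  rw [twirlU, Matrix.diagonal_conjTranspose]
  congr 1; ext S
  rw [Pi.star_apply, twirlSign, star_prod]
  apply Finset.prod_congr rfl
  intro m _; split_ifs <;> simp

lemma twirlU_mul_self (γ : M → Bool) : twirlU γ * twirlU γ = 1 := by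
  rw [twirlU, Matrix.diagonal_mul_diagonal, ← Matrix.diagonal_one]
  congr 1; ext S; exact twirlSign_mul_self γ S

lemma twirlSign_erase (γ : M → Bool) {m : M} {S : Finset M} (hm : m ∈ S) :
    twirlSign γ S = (if γ m = true then -1 else 1) * twirlSign γ (S.erase m) := by
  unfold twirlSign
  rw [← Finset.mul_prod_erase Finset.univ _ (Finset.mem_univ m),
    ← Finset.mul_prod_erase Finset.univ (fun k => if γ k = true ∧ k ∈ S.erase m then (-1 : ℂ) else 1)
      (Finset.mem_univ m)]
  simp only [hm, and_true, Finset.mem_erase, ne_eq, not_true, and_false, if_false,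
    one_mul]
  congr 1
  apply Finset.prod_congr rfl
  intro k hk
  simp [Finset.ne_of_mem_erase hk]

lemma twirlU_conj_ann (γ : M → Bool) (m : M) :
    twirlU γ * ann m * twirlU γ = (if γ m = true then (-1 : ℂ) else 1) • ann m := by
  ext S T
  rw [twirlU, Matrix.mul_diagonal, Matrix.diagonal_mul, Matrix.smul_apply]
  by_cases h : m ∈ T ∧ S = T.erase m
  · obtain ⟨hm, rfl⟩ := h
    rw [twirlSign_erase γ hm]
    have := twirlSign_mul_self γ (T.erase m)
    rw [smul_eq_mul]
    linear_combination (if γ m = true then (-1 : ℂ) else 1) * ann m (T.erase m) T * this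
  · have : ann m S T = 0 := if_neg h
    simp [this]

/-- Averaging over random signs of all modes removes the off-diagonal part of an operator. -/
lemma sum_twirlU_conj (X : Op M) :
    ∑ γ : M → Bool, twirlU γ * X * twirlU γ =
      ((Fintype.card (M → Bool) : ℕ) : ℂ) • Matrix.diagonal fun S => X S S := by
  ext S T
  rw [Matrix.sum_apply, Matrix.smul_apply]
  have h1 : ∀ γ : M → Bool, (twirlU γ * X * twirlU γ) S T =
      (twirlSign γ S * twirlSign γ T) * X S T := by
    intro γ
    rw [twirlU, Matrix.mul_diagonal, Matrix.diagonal_mul]; ring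
  simp only [h1]
  rw [← Finset.sum_mul]
  by_cases hST : S = T
  · subst hST
    simp [twirlSign_mul_self]
  · rw [Matrix.diagonal_apply_ne _ hST, smul_zero]
    -- The sum over all sign choices factorizes over the modes; a mode that belongs to exactly one
    -- of S and T contributes 1 + (-1) = 0.
    have h2 : ∑ γ : M → Bool, twirlSign γ S * twirlSign γ T =
        ∏ m : M, ∑ s : Bool, ((if s = true ∧ m ∈ S then (-1 : ℂ) else 1) *
          (if s = true ∧ m ∈ T then -1 else 1)) := by
      rw [Finset.prod_univ_sum, Fintype.piFinset_univ]
      apply Finset.sum_congr rfl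
      intro γ _
      rw [twirlSign, twirlSign, ← Finset.prod_mul_distrib]
    have h3 : ∃ m, ¬ (m ∈ S ↔ m ∈ T) := by
      by_contra h; push Not at h
      exact hST (Finset.ext h)
    obtain ⟨m, hm⟩ := h3
    rw [h2, Finset.prod_eq_zero (Finset.mem_univ m), zero_mul]
    by_cases hS : m ∈ S <;> by_cases hT : m ∈ T <;> simp_all

end Twirl

/-! ### Second order expansion of the Heisenberg evolution. -/

section Taylor

variable {M : Type} [Fintype M] [LinearOrder M]

lemma norm_conj_unitary {U : Op M} (hU : U ∈ unitary (Op M)) (X : Op M) : ‖Uᴴ * X * U‖ = ‖X‖ := by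
  rw [CStarRing.norm_mul_mem_unitary _ hU, ← Matrix.star_eq_conjTranspose,
    CStarRing.norm_mem_unitary_mul _ (Unitary.star_mem hU)]

lemma hasDerivAt_expI (t : ℝ) (H : Op M) :
    HasDerivAt (fun s : ℝ => expI s H) (expI t H * (-Complex.I • H)) t := by
  have h := hasDerivAt_exp_smul_const (𝕂 := ℝ) (-Complex.I • H) t
  have e : (fun s : ℝ => expI s H) = fun s : ℝ => NormedSpace.exp (s • (-Complex.I • H)) := by
    ext1 s
    unfold expI
    congr 1
    rw [← Complex.coe_smul, smul_smul]; congr 1; ring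
  rw [e]
  refine h.congr_deriv ?_
  rw [← congrFun e t]

lemma commute_expI (t : ℝ) (H : Op M) : Commute H (expI t H) :=
  ((Commute.refl H).smul_right _).exp_right

lemma hasDerivAt_conj (t : ℝ) (H X : Op M) :
    HasDerivAt (fun s : ℝ => expI (-s) H * X * expI s H)
      (expI (-t) H * (Complex.I • (H * X - X * H)) * expI t H) t := by
  have h1 : HasDerivAt (fun s : ℝ => expI (-s) H) (-(expI (-t) H * (-Complex.I • H))) t := by
    refine ((hasDerivAt_expI (-t) H).scomp t (hasDerivAt_neg t)).congr_deriv ?_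
    rw [neg_one_smul]
  have h2 := (h1.mul_const X).mul (hasDerivAt_expI t H)
  refine h2.congr_deriv ?_
  have hc := (commute_expI t H).eq
  simp only [mul_smul_comm, smul_mul_assoc, mul_sub, sub_mul, smul_sub, neg_smul,
    mul_neg, neg_neg, mul_assoc]
  rw [hc]
  abel

lemma norm_conj_expI (t : ℝ) {H : Op M} (hH : Hᴴ = H) (X : Op M) :
    ‖expI (-t) H * X * expI t H‖ = ‖X‖ := by
  rw [← expI_conjTranspose t hH, norm_conj_unitary (expI_mem_unitary t hH)]

/-- Second order Taylor bound for the Heisenberg evolution. -/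
lemma norm_conj_expI_sub_le {H : Op M} (hH : Hᴴ = H) (X : Op M) {τ : ℝ} (hτ : 0 ≤ τ) :
    ‖expI (-τ) H * X * expI τ H - X - (Complex.I * τ) • (H * X - X * H)‖ ≤
      τ ^ 2 * ‖H * (H * X - X * H) - (H * X - X * H) * H‖ := by
  set Y : Op M := Complex.I • (H * X - X * H) with hY
  set K : ℝ := ‖H * (H * X - X * H) - (H * X - X * H) * H‖ with hK
  have hKY : ‖Complex.I • (H * Y - Y * H)‖ = K := by
    have : Complex.I • (H * Y - Y * H) = -(H * (H * X - X * H) - (H * X - X * H) * H) := by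
      simp only [hY, mul_smul_comm, smul_mul_assoc, ← smul_sub, smul_smul, Complex.I_mul_I,
        neg_smul, one_smul]
    rw [this, norm_neg]
  -- The mean value inequality is used twice: here for the derivative, whose own derivative has
  -- constant norm K by unitary invariance, and then for the evolved operator minus its linear part.
  have h1 : ∀ s ∈ Set.Icc (0 : ℝ) τ, ‖expI (-s) H * Y * expI s H - Y‖ ≤ K * τ := by
    intro s hs
    have := norm_image_sub_le_of_norm_deriv_le_segment' (f := fun s : ℝ => expI (-s) H * Y * expI s H)
      (a := 0) (b := τ) (C := K) (fun x _ => (hasDerivAt_conj x H Y).hasDerivWithinAt)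
      (fun x _ => by rw [norm_conj_expI x hH, hKY]) s hs
    simp only [neg_zero, expI_zero, one_mul, mul_one, sub_zero] at this
    exact this.trans (mul_le_mul_of_nonneg_left hs.2 (norm_nonneg _))
  have h2 := norm_image_sub_le_of_norm_deriv_le_segment'
    (f := fun s : ℝ => expI (-s) H * X * expI s H - s • Y)
    (f' := fun s : ℝ => expI (-s) H * Y * expI s H - Y)
    (a := 0) (b := τ) (C := K * τ)
    (fun x _ => by
      have := (hasDerivAt_conj x H X).sub ((hasDerivAt_id x).smul_const Y)
      simp only [one_smul] at this
      exact this.hasDerivWithinAt)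
    (fun x hx => h1 x ⟨hx.1, hx.2.le⟩) τ ⟨hτ, le_refl _⟩
  simp only [neg_zero, expI_zero, one_mul, mul_one, zero_smul, sub_zero] at h2
  have e : expI (-τ) H * X * expI τ H - X - (Complex.I * τ) • (H * X - X * H) =
      expI (-τ) H * X * expI τ H - τ • Y - X := by
    rw [hY, ← Complex.coe_smul, smul_smul, mul_comm Complex.I]; abel
  rw [e]
  calc _ ≤ _ := h2
    _ = _ := by ring

end Taylor

end Hubbard

namespace Hubbard

/-! ### The averaged evolution of pair operators. -/

open scoped Matrix.Norms.L2Operator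

/-- The layout of an experiment in which all blocks of two modes are probed in parallel: the blocks
`{a i, b i}`, the modes `z i` that have to be empty for the block `i`, and gates `frame` that
change the frame in which the Hamiltonian is averaged. -/
structure Layout (M : Type) [LinearOrder M] (N : ℕ) where
  a : Fin N → M
  b : Fin N → M
  ne : ∀ i, a i ≠ b i
  disj : ∀ i j, i ≠ j → Disjoint ({a i, b i} : Finset M) {a j, b j}
  z : Fin N → Finset M
  zdisj : ∀ i j, Disjoint (z i) {a j, b j}
  zcard : ∀ i, (z i).card ≤ 2
  frame : List (FLO M)
  w : M → M
  hw : ∀ m, m ≠ w m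

section Channel

variable {M : Type} [Fintype M] [LinearOrder M]

/-- The operator `a_b a_a ∏ (1 - n_m)`, with the product over the modes `m` of `z`. -/
def pairOp (a b : M) (z : Finset M) : Op M := ann b * ann a * emptyProj z

lemma norm_emptyProj_le (z : Finset M) : ‖emptyProj z‖ ≤ 1 := by
  rw [emptyProj, Matrix.l2_opNorm_diagonal, pi_norm_le_iff_of_nonneg zero_le_one]
  intro S; split_ifs <;> simp

lemma norm_pairOp_le (a b : M) (z : Finset M) : ‖pairOp a b z‖ ≤ 1 := by
  unfold pairOp
  calc _ ≤ ‖ann b‖ * ‖ann a‖ * ‖emptyProj z‖ :=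
        (norm_mul_le _ _).trans (mul_le_mul_of_nonneg_right (norm_mul_le _ _) (norm_nonneg _))
    _ ≤ 1 * 1 * 1 := by
        gcongr
        · exact norm_ann_le b
        · exact norm_ann_le a
        · exact norm_emptyProj_le z
    _ = 1 := by norm_num

/-- An entry (S, T) of the pair operator is nonzero only if T is S with both `a` and `b` added and
`z` is empty, so only energy differences across such pairs enter. -/
lemma diagonal_commutator_pairOp {a b : M} {z : Finset M} {E : Finset M → ℂ} {lam : ℝ}
    (hE : ∀ S, a ∉ S → b ∉ S → Disjoint z S → E (insert a (insert b S)) - E S = lam) :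
    Matrix.diagonal E * pairOp a b z - pairOp a b z * Matrix.diagonal E =
      -(lam : ℂ) • pairOp a b z := by
  ext S T
  rw [Matrix.sub_apply, Matrix.diagonal_mul, Matrix.mul_diagonal, Matrix.smul_apply, smul_eq_mul]
  have hQ : pairOp a b z S T ≠ 0 → E T - E S = lam := by
    intro h
    rw [pairOp, emptyProj, Matrix.mul_diagonal, ann_mul_ann_apply] at h
    split_ifs at h with h1 h2 h2 <;> try simp at h
    obtain ⟨ha, hb, hab, hS⟩ := h1
    have hT : T = insert a (insert b S) := by
      rw [hS, Finset.insert_erase, Finset.insert_erase ha]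
      exact Finset.mem_erase.mpr ⟨hab, hb⟩
    have h3 := hE S (by simp [hS]) (by simp [hS]) (h2.mono_right (by rw [hT]; intro x; simp; tauto))
    rwa [← hT] at h3
  by_cases h : pairOp a b z S T = 0
  · simp [h]
  · linear_combination -(pairOp a b z S T) * hQ h

/-- Because the twirl changes the pair operator only by a sign, one commutator bound serves for all
sign choices. -/
lemma twirlU_conj_pairOp (γ : M → Bool) (a b : M) (z : Finset M) :
    ∃ s : ℂ, (s = 1 ∨ s = -1) ∧ twirlU γ * pairOp a b z * twirlU γ = s • pairOp a b z := by
  have h1 := twirlU_conj_ann γ a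
  have h2 := twirlU_conj_ann γ b
  have hD := twirlU_mul_self γ
  have hZ : twirlU γ * emptyProj z * twirlU γ = emptyProj z := by
    have : twirlU γ * emptyProj z = emptyProj z * twirlU γ := by
      simp only [twirlU, emptyProj, Matrix.diagonal_mul_diagonal, mul_comm]
    rw [this, mul_assoc, hD, mul_one]
  have e : twirlU γ * pairOp a b z * twirlU γ =
      (twirlU γ * ann b * twirlU γ) * (twirlU γ * ann a * twirlU γ) *
        (twirlU γ * emptyProj z * twirlU γ) := by
    simp only [mul_assoc]
    rw [← mul_assoc (twirlU γ) (twirlU γ) (ann a * _), hD, one_mul,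
      ← mul_assoc (twirlU γ) (twirlU γ) (emptyProj z * _), hD, one_mul, pairOp]
    simp only [mul_assoc]
  rw [e, h1, h2, hZ, smul_mul_smul_comm, smul_mul_assoc]
  refine ⟨_, ?_, rfl⟩
  split_ifs <;> simp

/-- The evolution for a time `τ`, conjugated by the frame change `U`. -/
def cycleU (H U : Op M) (τ : ℝ) : Op M := Uᴴ * expI τ H * U

lemma cycleU_mem {H U : Op M} (hH : Hᴴ = H) (hU : U ∈ unitary (Op M)) (τ : ℝ) :
    cycleU H U τ ∈ unitary (Op M) := by
  unfold cycleU
  rw [← Matrix.star_eq_conjTranspose]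
  exact mul_mem (mul_mem (Unitary.star_mem hU) (expI_mem_unitary τ hH)) hU

/-- The averaged Heisenberg evolution during one cycle. -/
def channel (H F : Op M) (τ : ℝ) (X : Op M) : Op M :=
  ((Fintype.card (M → Bool) : ℕ) : ℂ)⁻¹ • ∑ γ : M → Bool,
    (cycleU H (F * twirlU γ) τ)ᴴ * X * cycleU H (F * twirlU γ) τ

lemma channel_sub (H F : Op M) (τ : ℝ) (X Y : Op M) :
    channel H F τ (X - Y) = channel H F τ X - channel H F τ Y := by
  simp only [channel, mul_sub, sub_mul, Finset.sum_sub_distrib, smul_sub]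

lemma channel_add (H F : Op M) (τ : ℝ) (X Y : Op M) :
    channel H F τ (X + Y) = channel H F τ X + channel H F τ Y := by
  simp only [channel, mul_add, add_mul, Finset.sum_add_distrib, smul_add]

lemma channel_smul (H F : Op M) (τ : ℝ) (z : ℂ) (X : Op M) :
    channel H F τ (z • X) = z • channel H F τ X := by
  simp only [channel, mul_smul_comm, smul_mul_assoc, ← Finset.smul_sum]
  rw [smul_comm]

lemma channel_conjTranspose (H F : Op M) (τ : ℝ) (X : Op M) :
    channel H F τ Xᴴ = (channel H F τ X)ᴴ := by
  simp only [channel, Matrix.conjTranspose_smul, Matrix.conjTranspose_sum, Matrix.conjTranspose_mul,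
    Matrix.conjTranspose_conjTranspose, mul_assoc]
  simp

lemma twirlU_mem (γ : M → Bool) : twirlU γ ∈ unitary (Op M) := by
  rw [Unitary.mem_iff, Matrix.star_eq_conjTranspose, twirlU_conjTranspose, twirlU_mul_self]
  exact ⟨rfl, rfl⟩

lemma norm_average_le {ι : Type*} [Fintype ι] [Nonempty ι] {f : ι → Op M} {c : ℝ}
    (h : ∀ i, ‖f i‖ ≤ c) : ‖((Fintype.card ι : ℕ) : ℂ)⁻¹ • ∑ i, f i‖ ≤ c := by
  rw [norm_smul, norm_inv, Complex.norm_natCast]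
  have hc : (0 : ℝ) < Fintype.card ι := by exact_mod_cast Fintype.card_pos
  rw [inv_mul_le_iff₀ hc]
  calc _ ≤ ∑ i, ‖f i‖ := norm_sum_le _ _
    _ ≤ ∑ _i : ι, c := Finset.sum_le_sum fun i _ => h i
    _ = _ := by simp

/-- An average of unitary conjugations is a contraction; this keeps the error of one cycle from
being amplified by the later ones. -/
lemma norm_channel_le {H F : Op M} (hH : Hᴴ = H) (hF : F ∈ unitary (Op M)) (τ : ℝ) (X : Op M) :
    ‖channel H F τ X‖ ≤ ‖X‖ :=
  norm_average_le fun γ =>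
    (norm_conj_unitary (cycleU_mem hH (mul_mem hF (twirlU_mem γ)) τ) X).le

/-- If the diagonal part of the Hamiltonian in the frame `F` gives the pair of modes `a`, `b` the
energy `lam`, then one short cycle multiplies the pair operator by a phase. -/
lemma norm_channel_pairOp_sub_le {H F : Op M} (hH : Hᴴ = H) (hF : F ∈ unitary (Op M))
    {a b : M} {z : Finset M} {lam K τ : ℝ} (hτ : 0 ≤ τ) (hlam : |lam| * τ ≤ 1)
    (hE : ∀ S, a ∉ S → b ∉ S → Disjoint z S →
      (Fᴴ * H * F) (insert a (insert b S)) (insert a (insert b S)) - (Fᴴ * H * F) S S = lam)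
    (hK : ∀ X, X = F * pairOp a b z * Fᴴ →
      ‖H * (H * X - X * H) - (H * X - X * H) * H‖ ≤ K) :
    ‖channel H F τ (pairOp a b z) - Complex.exp (-(Complex.I * lam * τ)) • pairOp a b z‖ ≤
      (K + lam ^ 2) * τ ^ 2 := by
  set Q := pairOp a b z with hQ
  have hF1 : Fᴴ * F = 1 := by
    rw [← Matrix.star_eq_conjTranspose]; exact (Unitary.mem_iff.mp hF).1
  have hF2 : F * Fᴴ = 1 := by
    rw [← Matrix.star_eq_conjTranspose]; exact (Unitary.mem_iff.mp hF).2
  -- the conjugation by one cycle, to first order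
  have h1 : ∀ γ : M → Bool, ‖(cycleU H (F * twirlU γ) τ)ᴴ * Q * cycleU H (F * twirlU γ) τ -
      (Q + (Complex.I * τ) • (twirlU γ * (Fᴴ * H * F) * twirlU γ * Q -
        Q * (twirlU γ * (Fᴴ * H * F) * twirlU γ)))‖ ≤ K * τ ^ 2 := by
    intro γ
    set D := twirlU γ with hD
    have hDD : D * D = 1 := twirlU_mul_self γ
    have hDH : Dᴴ = D := twirlU_conjTranspose γ
    set U := F * D with hU
    have hUm : U ∈ unitary (Op M) := mul_mem hF (twirlU_mem γ)
    have hU1 : Uᴴ * U = 1 := by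
      rw [← Matrix.star_eq_conjTranspose]; exact (Unitary.mem_iff.mp hUm).1
    set X := U * Q * Uᴴ with hX
    obtain ⟨s, hs, hsQ⟩ := twirlU_conj_pairOp γ a b z
    have hX' : X = s • (F * Q * Fᴴ) := by
      have : X = F * (D * Q * D) * Fᴴ := by
        rw [hX, hU, Matrix.conjTranspose_mul, hDH]; simp only [mul_assoc]
      rw [this, hsQ, mul_smul_comm, smul_mul_assoc]
    -- X differs from F Q F† only by the sign s, so the bound K does not depend on γ.
    have hKX : ‖H * (H * X - X * H) - (H * X - X * H) * H‖ ≤ K := by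
      have := hK _ rfl
      have e : H * (H * X - X * H) - (H * X - X * H) * H = s •
          (H * (H * (F * Q * Fᴴ) - (F * Q * Fᴴ) * H) -
            (H * (F * Q * Fᴴ) - (F * Q * Fᴴ) * H) * H) := by
        rw [hX']
        simp only [mul_smul_comm, smul_mul_assoc, ← smul_sub]
      rw [e, norm_smul]
      rcases hs with rfl | rfl <;> simpa using this
    have hT := norm_conj_expI_sub_le hH X hτ
    have e1 : (cycleU H U τ)ᴴ * Q * cycleU H U τ = Uᴴ * (expI (-τ) H * X * expI τ H) * U := by
      simp only [cycleU, Matrix.conjTranspose_mul, Matrix.conjTranspose_conjTranspose,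
        expI_conjTranspose τ hH, hX, mul_assoc]
    have e2 : Uᴴ * X * U = Q := by
      rw [hX]
      calc Uᴴ * (U * Q * Uᴴ) * U = (Uᴴ * U) * Q * (Uᴴ * U) := by simp only [mul_assoc]
        _ = Q := by rw [hU1, one_mul, mul_one]
    have e3 : D * (Fᴴ * H * F) * D = Uᴴ * H * U := by
      rw [hU, Matrix.conjTranspose_mul, hDH]; simp only [mul_assoc]
    have e4 : Uᴴ * (H * X - X * H) * U = (Uᴴ * H * U) * Q - Q * (Uᴴ * H * U) := by
      have a1 : Uᴴ * (H * X) * U = (Uᴴ * H * U) * Q := by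
        rw [hX]
        calc Uᴴ * (H * (U * Q * Uᴴ)) * U = (Uᴴ * H * U) * Q * (Uᴴ * U) := by simp only [mul_assoc]
          _ = _ := by rw [hU1, mul_one]
      have a2 : Uᴴ * (X * H) * U = Q * (Uᴴ * H * U) := by
        rw [hX]
        calc Uᴴ * (U * Q * Uᴴ * H) * U = (Uᴴ * U) * Q * (Uᴴ * H * U) := by simp only [mul_assoc]
          _ = _ := by rw [hU1, one_mul]
      rw [mul_sub, sub_mul, a1, a2]
    have e5 : (cycleU H U τ)ᴴ * Q * cycleU H U τ - (Q + (Complex.I * τ) •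
        (D * (Fᴴ * H * F) * D * Q - Q * (D * (Fᴴ * H * F) * D))) =
        Uᴴ * (expI (-τ) H * X * expI τ H - X - (Complex.I * τ) • (H * X - X * H)) * U := by
      rw [e1, e3, ← e4]
      conv_lhs => rw [← e2]
      simp only [mul_sub, sub_mul, mul_smul_comm, smul_mul_assoc]
      abel
    rw [e5, norm_conj_unitary hUm]
    calc _ ≤ _ := hT
      _ ≤ τ ^ 2 * K := by gcongr
      _ = _ := mul_comm _ _
  have hcard : ((Fintype.card (M → Bool) : ℕ) : ℂ) ≠ 0 := by
    exact_mod_cast Fintype.card_ne_zero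
  -- the average of the first order terms
  have h2 : ((Fintype.card (M → Bool) : ℕ) : ℂ)⁻¹ • ∑ γ : M → Bool,
      (Q + (Complex.I * τ) • (twirlU γ * (Fᴴ * H * F) * twirlU γ * Q -
        Q * (twirlU γ * (Fᴴ * H * F) * twirlU γ))) = (1 - Complex.I * lam * τ) • Q := by
    rw [Finset.sum_add_distrib, ← Finset.smul_sum, Finset.sum_sub_distrib, ← Finset.sum_mul,
      ← Finset.mul_sum, sum_twirlU_conj, smul_mul_assoc, mul_smul_comm, ← smul_sub,
      diagonal_commutator_pairOp hE, Finset.sum_const, Finset.card_univ, ← Nat.cast_smul_eq_nsmul ℂ,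
      smul_add, smul_smul, inv_mul_cancel₀ hcard, one_smul]
    rw [smul_comm (Complex.I * τ), smul_smul (_⁻¹), inv_mul_cancel₀ hcard, one_smul]
    module
  have h3 : ‖channel H F τ Q - (1 - Complex.I * lam * τ) • Q‖ ≤ K * τ ^ 2 := by
    rw [← h2, channel, ← smul_sub, ← Finset.sum_sub_distrib]
    exact norm_average_le h1
  -- The linearized phase is replaced by the exact one, at second order cost, so that the phases of
  -- successive cycles multiply exactly.
  have h4 : ‖(1 - Complex.I * lam * τ) • Q - Complex.exp (-(Complex.I * lam * τ)) • Q‖ ≤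
      lam ^ 2 * τ ^ 2 := by
    rw [← sub_smul, norm_smul]
    have hn : ‖-(Complex.I * lam * τ)‖ = |lam| * τ := by
      rw [norm_neg, norm_mul, norm_mul, Complex.norm_I, one_mul, Complex.norm_real,
        Complex.norm_real, Real.norm_eq_abs, Real.norm_eq_abs, abs_of_nonneg hτ]
    have := Complex.norm_exp_sub_one_sub_id_le (x := -(Complex.I * lam * τ)) (by rw [hn]; exact hlam)
    rw [hn, mul_pow, sq_abs] at this
    have e : ‖(1 - Complex.I * lam * τ) - Complex.exp (-(Complex.I * lam * τ))‖ ≤ lam ^ 2 * τ ^ 2 := by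
      rw [← norm_neg]
      refine le_trans (le_of_eq ?_) this
      congr 1; ring
    calc _ ≤ lam ^ 2 * τ ^ 2 * 1 := by
          gcongr
          exact norm_pairOp_le a b z
      _ = _ := mul_one _
  calc _ = ‖(channel H F τ Q - (1 - Complex.I * lam * τ) • Q) +
        ((1 - Complex.I * lam * τ) • Q - Complex.exp (-(Complex.I * lam * τ)) • Q)‖ := by
          congr 1; abel
    _ ≤ K * τ ^ 2 + lam ^ 2 * τ ^ 2 := (norm_add_le _ _).trans (add_le_add h3 h4)
    _ = _ := by ring

/-- Telescoping: the accumulated error passes through a contraction, and the error of the new cycle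
is multiplied by a number of modulus 1. -/
lemma norm_channel_iterate_pairOp_sub_le {H F : Op M} (hH : Hᴴ = H) (hF : F ∈ unitary (Op M))
    {a b : M} {z : Finset M} {lam τ c : ℝ}
    (h : ‖channel H F τ (pairOp a b z) - Complex.exp (-(Complex.I * lam * τ)) • pairOp a b z‖ ≤ c)
    (r : ℕ) :
    ‖(channel H F τ)^[r] (pairOp a b z) -
      Complex.exp (-(Complex.I * lam * (r * τ))) • pairOp a b z‖ ≤ r * c := by
  induction r with
  | zero => simp
  | succ r ih =>
    rw [Function.iterate_succ_apply']
    set Q := pairOp a b z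
    have e : channel H F τ ((channel H F τ)^[r] Q) -
        Complex.exp (-(Complex.I * lam * ((r + 1 : ℕ) * τ))) • Q =
        channel H F τ ((channel H F τ)^[r] Q - Complex.exp (-(Complex.I * lam * (r * τ))) • Q) +
        Complex.exp (-(Complex.I * lam * (r * τ))) •
          (channel H F τ Q - Complex.exp (-(Complex.I * lam * τ)) • Q) := by
      rw [channel_sub, channel_smul, smul_sub, smul_smul, ← Complex.exp_add]
      have : -(Complex.I * lam * ((r + 1 : ℕ) * τ)) =
          -(Complex.I * lam * (r * τ)) + -(Complex.I * lam * τ) := by push_cast; ring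
      rw [this]; abel
    have hn : ‖Complex.exp (-(Complex.I * lam * (r * τ)))‖ = 1 := by
      have : -(Complex.I * lam * (r * τ)) = ((-(lam * (r * τ)) : ℝ) : ℂ) * Complex.I := by
        push_cast; ring
      rw [this, Complex.norm_exp_ofReal_mul_I]
    rw [e]
    calc _ ≤ r * c + c := by
          refine (norm_add_le _ _).trans (add_le_add ((norm_channel_le hH hF τ _).trans ih) ?_)
          rw [norm_smul, hn, one_mul]; exact h
      _ = _ := by push_cast; ring

end Channel

end Hubbard

namespace Hubbard

open scoped Matrix.Norms.L2Operator

/-! ### Expectation values in imperfectly prepared states. -/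

section States

variable {M : Type} [Fintype M] [LinearOrder M]

lemma trace_mul_posSemidef_nonneg {ρ B : Op M} (hρ : ρ.PosSemidef) (hB : B.PosSemidef) :
    0 ≤ ((ρ * B).trace).re := by
  obtain ⟨C, rfl⟩ : ∃ C : Op M, B = Cᴴ * C := by
    open scoped MatrixOrder in
    exact CStarAlgebra.nonneg_iff_eq_star_mul_self.mp (Matrix.nonneg_iff_posSemidef.mpr hB)
  rw [← mul_assoc, Matrix.trace_mul_comm, ← mul_assoc]
  have := (hρ.mul_mul_conjTranspose_same C).trace_nonneg
  exact (Complex.le_def.mp this).1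

lemma trace_mul_conjTranspose_mul_self_nonneg {ρ : Op M} (hρ : ρ.PosSemidef) (C : Op M) :
    0 ≤ ((ρ * (Cᴴ * C)).trace).re :=
  trace_mul_posSemidef_nonneg hρ (Matrix.posSemidef_conjTranspose_mul_self C)

lemma trace_mul_conjTranspose {ρ : Op M} (hρ : ρ.PosSemidef) (X : Op M) :
    (ρ * Xᴴ).trace = star ((ρ * X).trace) := by
  rw [← Matrix.trace_conjTranspose, Matrix.conjTranspose_mul, hρ.isHermitian.eq,
    Matrix.trace_mul_comm]

/-- The real part of the expectation sees only the Hermitian part of X, which is at most ‖X‖ times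
the identity; ρ is positive with trace 1. -/
lemma re_trace_mul_le_norm {ρ : Op M} (hρ : IsDensity ρ) (X : Op M) :
    ((ρ * X).trace).re ≤ ‖X‖ := by
  open scoped MatrixOrder in
  have hY : IsSelfAdjoint ((1 / 2 : ℂ) • (X + Xᴴ)) := by
    rw [IsSelfAdjoint, Matrix.star_eq_conjTranspose, Matrix.conjTranspose_smul,
      Matrix.conjTranspose_add, Matrix.conjTranspose_conjTranspose, add_comm]
    simp
  have hn : ‖(1 / 2 : ℂ) • (X + Xᴴ)‖ ≤ ‖X‖ := by
    rw [norm_smul]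
    have := norm_add_le X Xᴴ
    rw [Matrix.l2_opNorm_conjTranspose] at this
    norm_num
    linarith
  have h1 := hY.le_algebraMap_norm_self
  rw [← sub_nonneg, Matrix.nonneg_iff_posSemidef] at h1
  have h2 := trace_mul_posSemidef_nonneg hρ.1 h1
  rw [mul_sub, Matrix.trace_sub, mul_smul_comm, mul_add, Matrix.trace_smul, Matrix.trace_add,
    trace_mul_conjTranspose hρ.1, Algebra.algebraMap_eq_smul_one, mul_smul_comm, mul_one,
    Matrix.trace_smul, hρ.2] at h2
  simp only [Complex.sub_re, smul_eq_mul, one_div, Complex.mul_re, Complex.add_re] at h2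
  rw [one_div] at hn
  simp at h2
  rw [← smul_add] at h2
  linarith

lemma norm_trace_mul_le {ρ : Op M} (hρ : IsDensity ρ) (X : Op M) : ‖(ρ * X).trace‖ ≤ ‖X‖ := by
  obtain ⟨u, hu, hu2⟩ : ∃ u : ℂ, ‖u‖ = 1 ∧ u * (ρ * X).trace = ‖(ρ * X).trace‖ := by
    by_cases h : (ρ * X).trace = 0
    · exact ⟨1, by simp, by simp [h]⟩
    · have hn : (‖(ρ * X).trace‖ : ℂ) ≠ 0 := by simpa using h
      refine ⟨star (ρ * X).trace / ‖(ρ * X).trace‖, ?_, ?_⟩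
      · rw [norm_div, norm_star, Complex.norm_real, norm_norm, div_self]
        simpa using h
      · rw [div_mul_eq_mul_div, RCLike.star_def, Complex.conj_mul', sq, mul_div_assoc, div_self hn, mul_one]
  have h := re_trace_mul_le_norm hρ (u • X)
  rw [mul_smul_comm, Matrix.trace_smul, smul_eq_mul, hu2, norm_smul, hu, one_mul,
    Complex.ofReal_re] at h
  exact h

/-- Cauchy-Schwarz for the form tr(ρ A†B), with the geometric mean replaced by a weighted arithmetic
mean. The free weight s makes square roots unnecessary. The real part is bounded by expanding (sA -
B)†(sA - B) ≥ 0, the modulus by rotating the phase of B. -/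
lemma norm_trace_mul_mul_le {ρ : Op M} (hρ : IsDensity ρ) (A B : Op M) {s : ℝ} (hs : 0 < s) :
    ‖(ρ * (Aᴴ * B)).trace‖ ≤
      (s * ((ρ * (Aᴴ * A)).trace).re + s⁻¹ * ((ρ * (Bᴴ * B)).trace).re) / 2 := by
  have key : ∀ B : Op M, ((ρ * (Aᴴ * B)).trace).re ≤
      (s * ((ρ * (Aᴴ * A)).trace).re + s⁻¹ * ((ρ * (Bᴴ * B)).trace).re) / 2 := by
    intro B
    have h := trace_mul_conjTranspose_mul_self_nonneg hρ.1 ((s : ℂ) • A - B)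
    have hBA : (ρ * (Bᴴ * A)).trace = star ((ρ * (Aᴴ * B)).trace) := by
      rw [← trace_mul_conjTranspose hρ.1]; simp
    have e : ρ * (((s : ℂ) • A - B)ᴴ * ((s : ℂ) • A - B)) = ((s : ℂ) * s) • (ρ * (Aᴴ * A))
        - (s : ℂ) • (ρ * (Aᴴ * B)) - (s : ℂ) • (ρ * (Bᴴ * A)) + ρ * (Bᴴ * B) := by
      simp only [Matrix.conjTranspose_sub, Matrix.conjTranspose_smul, sub_mul, mul_sub,
        smul_mul_assoc, mul_smul_comm, RCLike.star_def, Complex.conj_ofReal]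
      module
    rw [e] at h
    simp only [Matrix.trace_add, Matrix.trace_sub, Matrix.trace_smul, hBA] at h
    simp at h
    have h2 : s⁻¹ * (s * s * ((ρ * (Aᴴ * A)).trace).re - s * ((ρ * (Aᴴ * B)).trace).re
      - s * ((ρ * (Aᴴ * B)).trace).re + ((ρ * (Bᴴ * B)).trace).re) ≥ 0 :=
      mul_nonneg (inv_nonneg.mpr hs.le) h
    field_simp at h2 ⊢
    nlinarith
  obtain ⟨u, hu, hu2⟩ : ∃ u : ℂ, star u * u = 1 ∧
      u * (ρ * (Aᴴ * B)).trace = ‖(ρ * (Aᴴ * B)).trace‖ := by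
    by_cases h : (ρ * (Aᴴ * B)).trace = 0
    · exact ⟨1, by simp, by simp [h]⟩
    · have hn : (‖(ρ * (Aᴴ * B)).trace‖ : ℂ) ≠ 0 := by simpa using h
      refine ⟨star (ρ * (Aᴴ * B)).trace / ‖(ρ * (Aᴴ * B)).trace‖, ?_, ?_⟩
      · rw [show ∀ v : ℂ, star v * v = (‖v‖ : ℂ) ^ 2 from fun v => Complex.conj_mul' v, norm_div, norm_star, Complex.norm_real, norm_norm,
          div_self (by simpa using h)]
        simp
      · rw [div_mul_eq_mul_div, RCLike.star_def, Complex.conj_mul', sq, mul_div_assoc, div_self hn, mul_one]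
  have h := key (u • B)
  have e : (u • B)ᴴ * (u • B) = Bᴴ * B := by
    rw [Matrix.conjTranspose_smul, smul_mul_smul_comm, hu, one_smul]
  rw [e, mul_smul_comm, mul_smul_comm, Matrix.trace_smul, smul_eq_mul, hu2, Complex.ofReal_re] at h
  exact h

/-- A state that almost lies in the range of a projection `P` has almost the expectation value `c`
of an operator `X` with `P X P = c P`. -/
lemma norm_trace_mul_sub_le {ρ : Op M} (hρ : IsDensity ρ) {P X : Op M} {c : ℂ} {κ s : ℝ}
    (hP : Pᴴ = P) (hPP : P * P = P) (hX : ‖X‖ ≤ 1) (hPX : P * X * P = c • P)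
    (hc : ‖c‖ ≤ 1) (hκ : ((ρ * (1 - P)).trace).re ≤ κ) (hs : 0 < s) :
    ‖(ρ * X).trace - c‖ ≤ s * κ + s⁻¹ + κ := by
  set A : Op M := 1 - P with hA
  have hAH : Aᴴ = A := by simp [hA, hP]
  have hAA : A * A = A := by simp only [hA, mul_sub, sub_mul, one_mul, mul_one, hPP]; abel
  have hκ' : ((ρ * (Aᴴ * A)).trace).re ≤ κ := by rw [hAH, hAA]; exact hκ
  have hA0 : 0 ≤ ((ρ * (Aᴴ * A)).trace).re := trace_mul_conjTranspose_mul_self_nonneg hρ.1 A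
  have hPn : ‖P‖ ≤ 1 := by
    have := Matrix.l2_opNorm_conjTranspose_mul_self P
    rw [hP, hPP] at this
    nlinarith [norm_nonneg P]
  have h1 : ‖(ρ * (A * X)).trace‖ ≤ (s * κ + s⁻¹) / 2 := by
    have h := norm_trace_mul_mul_le hρ A X hs
    rw [hAH] at h hκ'
    have h2 := re_trace_mul_le_norm hρ (Xᴴ * X)
    rw [Matrix.l2_opNorm_conjTranspose_mul_self] at h2
    have h3 : ((ρ * (Xᴴ * X)).trace).re ≤ 1 := by nlinarith [norm_nonneg X]
    have h4 := mul_le_mul_of_nonneg_left h3 (inv_nonneg.mpr hs.le)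
    have h5 := mul_le_mul_of_nonneg_left hκ' hs.le
    linarith
  have h2 : ‖(ρ * (P * X * A)).trace‖ ≤ (s * κ + s⁻¹) / 2 := by
    have h := norm_trace_mul_mul_le hρ (P * X)ᴴ A (inv_pos.mpr hs)
    rw [Matrix.conjTranspose_conjTranspose, inv_inv] at h
    have h2 := re_trace_mul_le_norm hρ (P * X * (P * X)ᴴ)
    have h3 : ‖P * X * (P * X)ᴴ‖ ≤ 1 := by
      refine (norm_mul_le _ _).trans ?_
      rw [Matrix.l2_opNorm_conjTranspose]
      have : ‖P * X‖ ≤ 1 := (norm_mul_le _ _).trans (by nlinarith [norm_nonneg X, norm_nonneg P])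
      nlinarith [norm_nonneg (P * X)]
    have h4 := mul_le_mul_of_nonneg_left (h2.trans h3) (inv_nonneg.mpr hs.le)
    have h5 := mul_le_mul_of_nonneg_left hκ' hs.le
    linarith
  have h3 : ‖c * (ρ * A).trace‖ ≤ κ := by
    have hre : (ρ * A).trace = (((ρ * A).trace).re : ℂ) := by
      have := trace_mul_conjTranspose hρ.1 A
      rw [hAH] at this
      exact (Complex.conj_eq_iff_re.mp this.symm).symm
    have hA0' : 0 ≤ ((ρ * A).trace).re := by rwa [hAH, hAA] at hA0
    rw [norm_mul, hre, Complex.norm_real, Real.norm_eq_abs, abs_of_nonneg hA0']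
    calc _ ≤ 1 * ((ρ * A).trace).re := by gcongr
      _ ≤ κ := by rw [one_mul]; exact hκ
  -- X = (1-P)X + PX(1-P) + cP. The first two terms contain the factor 1-P of small expectation and
  -- are small by Cauchy-Schwarz.
  have e : (ρ * X).trace - c = (ρ * (A * X)).trace + (ρ * (P * X * A)).trace - c * (ρ * A).trace := by
    have e1 : X = A * X + P * X * A + c • P := by
      rw [← hPX, hA]; simp only [sub_mul, mul_sub, one_mul, mul_one]; abel
    have e2 : (ρ * P).trace = 1 - (ρ * A).trace := by
      rw [hA, mul_sub, mul_one, Matrix.trace_sub, hρ.2]; ring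
    conv_lhs => rw [e1]
    rw [mul_add, mul_add, Matrix.trace_add, Matrix.trace_add, mul_smul_comm, Matrix.trace_smul, e2,
      smul_eq_mul]
    ring
  rw [e]
  have := norm_sub_le ((ρ * (A * X)).trace + (ρ * (P * X * A)).trace) (c * (ρ * A).trace)
  have := norm_add_le ((ρ * (A * X)).trace) ((ρ * (P * X * A)).trace)
  linarith

/-- The union bound for commuting projections. -/
lemma trace_mul_one_sub_mul_le {ρ : Op M} (hρ : IsDensity ρ) {A B : Op M} (hA : Aᴴ = A)
    (hAA : A * A = A) (hB : Bᴴ = B) (hBB : B * B = B) (hAB : Commute A B) :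
    ((ρ * (1 - A * B)).trace).re ≤ ((ρ * (1 - A)).trace).re + ((ρ * (1 - B)).trace).re := by
  -- For commuting projections (1-A)(1-B) is a projection, and it equals (1-A) + (1-B) - (1-AB).
  have h := trace_mul_conjTranspose_mul_self_nonneg hρ.1 ((1 - A) * (1 - B))
  have e : ((1 - A) * (1 - B))ᴴ * ((1 - A) * (1 - B)) = (1 - A) + (1 - B) - (1 - A * B) := by
    have e1 : (1 - A) * (1 - A) = 1 - A := by
      simp only [mul_sub, sub_mul, one_mul, mul_one, hAA]; abel
    have e2 : (1 - B) * (1 - B) = 1 - B := by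
      simp only [mul_sub, sub_mul, one_mul, mul_one, hBB]; abel
    have hc : Commute (1 - A) (1 - B) :=
      ((Commute.one_left _).sub_left ((Commute.one_right _).sub_right hAB))
    rw [Matrix.conjTranspose_mul]
    simp only [Matrix.conjTranspose_sub, Matrix.conjTranspose_one, hA, hB]
    calc (1 - B) * (1 - A) * ((1 - A) * (1 - B)) = (1 - B) * ((1 - A) * (1 - A)) * (1 - B) := by
          simp only [mul_assoc]
      _ = (1 - A) * (1 - B) := by rw [e1, ← hc.eq, mul_assoc, e2]
      _ = _ := by simp only [mul_sub, sub_mul, one_mul, mul_one]; abel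
  rw [e, mul_sub, mul_add, Matrix.trace_sub, Matrix.trace_add, Complex.sub_re, Complex.add_re] at h
  linarith

lemma trace_mul_one_sub_emptyProj_le {ρ : Op M} (hρ : IsDensity ρ) {δ : ℝ} {z : Finset M}
    (h : ∀ m ∈ z, 1 - δ ≤ ((ρ * (1 - num m)).trace).re) :
    ((ρ * (1 - emptyProj z)).trace).re ≤ z.card * δ := by
  induction z using Finset.induction_on with
  | empty => simp [emptyProj_empty]
  | insert m z hm ih =>
    have h1 := ih fun k hk => h k (by simp [hk])
    have h2 := trace_mul_one_sub_mul_le hρ (emptyProj_conjTranspose {m}) (emptyProj_mul_self {m})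
      (emptyProj_conjTranspose z) (emptyProj_mul_self z)
      (by unfold emptyProj; exact Matrix.commute_diagonal _ _)
    rw [emptyProj_insert, ← emptyProj_singleton, Finset.card_insert_of_notMem hm]
    have h3 := h m (by simp)
    have h4 : ((ρ * (1 - emptyProj {m})).trace).re ≤ δ := by
      rw [emptyProj_singleton] at *
      rw [mul_sub, mul_one, Matrix.trace_sub, hρ.2]
      simp only [Complex.sub_re, Complex.one_re]
      linarith
    push_cast
    linarith

end States

/-! ### The error-free preparation obeys the error bounds. -/

section Ideal

variable {M : Type} [Fintype M] [LinearOrder M]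

lemma num_mulVec_vac (m : M) : num m *ᵥ vac = 0 := by
  ext S
  rw [num_eq_diagonal, Matrix.mulVec_diagonal]
  by_cases h : S = ∅ <;> simp [vac, h]

lemma one_sub_num_mulVec_vac (m : M) : (1 - num m) *ᵥ (vac : Finset M → ℂ) = vac := by
  rw [Matrix.sub_mulVec, num_mulVec_vac, Matrix.one_mulVec, sub_zero]

lemma mulVec_prod_unitary_vac {l : List (FLO M)} {X : Op M}
    (hX : ∀ g ∈ l, Commute X g.unitary) (hv : X *ᵥ vac = vac) :
    X *ᵥ ((l.map FLO.unitary).prod *ᵥ vac) = (l.map FLO.unitary).prod *ᵥ vac := by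
  have hc : Commute X (l.map FLO.unitary).prod := by
    apply Commute.list_prod_right
    intro Y hY
    obtain ⟨g, hg, rfl⟩ := List.mem_map.mp hY
    exact hX g hg
  rw [Matrix.mulVec_mulVec, hc.eq, ← Matrix.mulVec_mulVec, hv]

lemma avoids_stateProj {g : FLO M} {m : M} (hm : m ∉ g.modes) : Avoids g.stateProj m := by
  have h1 : g.fst ≠ m := by rintro rfl; simp [FLO.modes] at hm
  have h2 : g.snd ≠ m := by rintro rfl; simp [FLO.modes] at hm
  exact ((Avoids.unitary hm).mul ((Avoids.one.sub (Avoids.num h1)).mul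
    (Avoids.one.sub (Avoids.num h2)))).mul (Avoids.unitary hm).conjTranspose

lemma FLO.unitary_conjTranspose_mul_self (g : FLO M) : (g.unitary)ᴴ * g.unitary = 1 := by
  rw [← Matrix.star_eq_conjTranspose]; exact (Unitary.mem_iff.mp g.unitary_mem).1

/-- The projection commutes with the gates of other blocks until it meets its own gate. There U†
cancels U, and what remains asserts that two modes are empty, which the remaining gates do not
affect. -/
lemma stateProj_mulVec_prod {l : List (FLO M)}
    (hl : l.Pairwise (fun g g' => Disjoint g.modes g'.modes)) {g : FLO M} (hg : g ∈ l) :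
    g.stateProj *ᵥ ((l.map FLO.unitary).prod *ᵥ vac) = (l.map FLO.unitary).prod *ᵥ vac := by
  induction l with
  | nil => simp at hg
  | cons k l ih =>
    rw [List.pairwise_cons] at hl
    rw [List.map_cons, List.prod_cons, ← Matrix.mulVec_mulVec]
    rcases List.mem_cons.mp hg with rfl | hg'
    · have h1 : ((1 - num g.fst) * (1 - num g.snd)) *ᵥ ((l.map FLO.unitary).prod *ᵥ vac) =
          (l.map FLO.unitary).prod *ᵥ vac := by
        apply mulVec_prod_unitary_vac
        · intro k hk
          have hd := Finset.disjoint_left.mp (hl.1 k hk)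
          have ha : ∀ m ∈ k.modes, Avoids ((1 - num g.fst) * (1 - num g.snd)) m := by
            intro m hm
            refine (Avoids.one.sub (Avoids.num ?_)).mul (Avoids.one.sub (Avoids.num ?_))
            · rintro rfl; exact hd (by simp [FLO.modes]) hm
            · rintro rfl; exact hd (by simp [FLO.modes]) hm
          exact Avoids.commute_unitary (ha _ (by simp [FLO.modes])) (ha _ (by simp [FLO.modes]))
        · rw [← Matrix.mulVec_mulVec, one_sub_num_mulVec_vac, one_sub_num_mulVec_vac]
      rw [FLO.stateProj, Matrix.mulVec_mulVec, mul_assoc, g.unitary_conjTranspose_mul_self, mul_one,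
        ← Matrix.mulVec_mulVec, h1]
    · have hd := Finset.disjoint_left.mp (hl.1 g hg')
      have hc : Commute g.stateProj k.unitary :=
        Avoids.commute_unitary (avoids_stateProj (hd (by simp [FLO.modes])))
          (avoids_stateProj (hd (by simp [FLO.modes])))
      rw [Matrix.mulVec_mulVec, hc.eq, ← Matrix.mulVec_mulVec, ih hl.2 hg']

lemma star_dotProduct_ideal (p : Preparation M) : star p.ideal ⬝ᵥ p.ideal = 1 := by
  have hU : (p.blocks.map FLO.unitary).prod ∈ unitary (Op M) := by
    apply list_prod_mem
    intro Y hY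
    obtain ⟨g, hg, rfl⟩ := List.mem_map.mp hY
    exact g.unitary_mem
  have h1 := (Unitary.mem_iff.mp hU).1
  rw [Matrix.star_eq_conjTranspose] at h1
  rw [Preparation.ideal, Matrix.star_mulVec, Matrix.dotProduct_mulVec, Matrix.vecMul_vecMul, h1,
    Matrix.vecMul_one]
  simp [dotProduct, vac]

lemma trace_ketbra_mul (ψ : Finset M → ℂ) (X : Op M) :
    (ketbra ψ * X).trace = star ψ ⬝ᵥ (X *ᵥ ψ) := by
  rw [ketbra, Matrix.trace_mul_comm, Matrix.mul_vecMulVec, Matrix.trace_vecMulVec, dotProduct_comm]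

lemma isDensity_ideal (p : Preparation M) : IsDensity (ketbra p.ideal) := by
  refine ⟨Matrix.posSemidef_vecMulVec_self_star _, ?_⟩
  have := trace_ketbra_mul p.ideal 1
  rw [mul_one, Matrix.one_mulVec, star_dotProduct_ideal] at this
  exact this

/-- Perfect preparation and measurement is a special case of imperfect preparation and
measurement. -/
lemma idealSpam_isBounded (p : Preparation M) {δ : ℝ} (hδ : 0 ≤ δ) :
    (idealSpam p).IsBounded p δ where
  density := isDensity_ideal p
  block := by
    intro g hg
    change _ ≤ ((ketbra p.ideal * _).trace).re
    have : g.stateProj *ᵥ p.ideal = p.ideal := stateProj_mulVec_prod p.disjoint hg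
    rw [trace_ketbra_mul, this, star_dotProduct_ideal]
    simpa using hδ
  empty := by
    intro m hm
    change _ ≤ ((ketbra p.ideal * _).trace).re
    have : (1 - num m) *ᵥ p.ideal = p.ideal := by
      apply mulVec_prod_unitary_vac _ (one_sub_num_mulVec_vac m)
      intro g hg
      refine ((Commute.one_left _).sub_left ?_)
      have hh := Avoids.unitary (hm g hg)
      exact hh.commute_num.symm
    rw [trace_ketbra_mul, this, star_dotProduct_ideal]
    simpa using hδ
  readout_nonneg := by
    intro x y; simp only [idealSpam]; split_ifs <;> simp
  readout_sum := by
    intro x; simp [idealSpam]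
  readout_flip := by
    intro x m
    rw [Finset.sum_eq_zero]
    · exact hδ
    · intro y _
      by_cases h : x = y
      · simp [h]
      · simp [idealSpam, h]

end Ideal

end Hubbard

namespace Hubbard

open scoped Matrix.Norms.L2Operator

/-! ### Means of measured functions and readout errors. -/

section Expectation

variable {M : Type} [Fintype M] [LinearOrder M]

/-- The expectation of a function of the reported outcome of an experiment. -/
def Experiment.mean (e : Experiment M) (H : Op M) (n : Spam M) (f : Finset M → ℝ) : ℝ :=
  ∑ y, e.prob H n y * f y

/-- The averaged Heisenberg picture observable of an experiment. -/
def Experiment.heis (e : Experiment M) (H : Op M) (X : Op M) : Op M :=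
  ∑ s, (e.weight s : ℂ) • ((circuitUnitary H (e.circuit s))ᴴ * X * circuitUnitary H (e.circuit s))

lemma circuitUnitary_mem {H : Op M} (hH : Hᴴ = H) (c : Circuit M) :
    circuitUnitary H c ∈ unitary (Op M) := by
  induction c with
  | nil => exact one_mem _
  | cons s c ih =>
    refine mul_mem ih ?_
    cases s with
    | evolve t => exact expI_mem_unitary _ hH
    | gate g => exact g.unitary_mem

lemma sum_diag_mul_eq_trace (U ρ : Op M) (f : Finset M → ℝ) :
    ∑ x, ((U * ρ * Uᴴ) x x).re * f x =
      ((ρ * (Uᴴ * Matrix.diagonal (fun x => (f x : ℂ)) * U)).trace).re := by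
  have : (ρ * (Uᴴ * Matrix.diagonal (fun x => (f x : ℂ)) * U)).trace =
      ((U * ρ * Uᴴ) * Matrix.diagonal (fun x => (f x : ℂ))).trace := by
    rw [← mul_assoc, Matrix.trace_mul_comm]; simp only [mul_assoc]
  rw [this, Matrix.trace, Complex.re_sum]
  apply Finset.sum_congr rfl
  intro x _
  rw [Matrix.diag_apply, Matrix.mul_diagonal, Complex.re_mul_ofReal]

lemma diag_re_nonneg {ρ : Op M} (hρ : ρ.PosSemidef) (U : Op M) (x : Finset M) :
    0 ≤ ((U * ρ * Uᴴ) x x).re := by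
  have h := (hρ.mul_mul_conjTranspose_same U).diag_nonneg (i := x)
  exact (Complex.le_def.mp h).1

lemma sum_diag_re {ρ : Op M} (hρ : IsDensity ρ) {U : Op M} (hU : U ∈ unitary (Op M)) :
    ∑ x, ((U * ρ * Uᴴ) x x).re = 1 := by
  have h := sum_diag_mul_eq_trace U ρ (fun _ => 1)
  have h2 := (Unitary.mem_iff.mp hU).1
  rw [Matrix.star_eq_conjTranspose] at h2
  simpa [hρ.2, h2] using h

lemma Experiment.prob_nonneg (e : Experiment M) (H : Op M) {n : Spam M} {p : Preparation M} {δ : ℝ}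
    (hn : n.IsBounded p δ) (y : Finset M) : 0 ≤ e.prob H n y := by
  unfold Experiment.prob
  refine Finset.sum_nonneg fun s _ => mul_nonneg (e.weight_nonneg s) (Finset.sum_nonneg fun x _ =>
    mul_nonneg (diag_re_nonneg hn.density.1 _ x) (hn.readout_nonneg x y))

lemma Experiment.mean_eq (e : Experiment M) (H : Op M) (n : Spam M) (f : Finset M → ℝ) :
    e.mean H n f = ∑ s, e.weight s * ∑ x, ((circuitUnitary H (e.circuit s) * n.state *
      (circuitUnitary H (e.circuit s))ᴴ) x x).re * ∑ y, n.readout x y * f y := by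
  unfold Experiment.mean Experiment.prob
  simp only [Finset.sum_mul, Finset.mul_sum]
  rw [Finset.sum_comm]
  apply Finset.sum_congr rfl
  intro s _
  rw [Finset.sum_comm]
  apply Finset.sum_congr rfl
  intro x _
  apply Finset.sum_congr rfl
  intro y _
  ring

lemma Experiment.sum_prob (e : Experiment M) {H : Op M} (hH : Hᴴ = H) {n : Spam M}
    {p : Preparation M} {δ : ℝ} (hn : n.IsBounded p δ) : ∑ y, e.prob H n y = 1 := by
  have h := e.mean_eq H n (fun _ => 1)
  simp only [Experiment.mean, mul_one, hn.readout_sum,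
    sum_diag_re hn.density (circuitUnitary_mem hH _), e.weight_sum] at h
  exact h

/-- Readout errors change the expectation of a local function only slightly. -/
lemma Experiment.abs_mean_sub_le (e : Experiment M) {H : Op M} (hH : Hᴴ = H) {n : Spam M}
    {p : Preparation M} {δ : ℝ} (hn : n.IsBounded p δ) {f : Finset M → ℝ} (hf : ∀ y, |f y| ≤ 1)
    {W : Finset M} (hW : ∀ x y, (∀ m ∈ W, m ∈ x ↔ m ∈ y) → f x = f y) :
    |e.mean H n f - ((n.state * e.heis H (Matrix.diagonal fun x => (f x : ℂ))).trace).re| ≤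
      2 * W.card * δ := by
  have h1 : ((n.state * e.heis H (Matrix.diagonal fun x => (f x : ℂ))).trace).re =
      ∑ s, e.weight s * ∑ x, ((circuitUnitary H (e.circuit s) * n.state *
      (circuitUnitary H (e.circuit s))ᴴ) x x).re * f x := by
    rw [Experiment.heis, Finset.mul_sum, Matrix.trace_sum, Complex.re_sum]
    apply Finset.sum_congr rfl
    intro s _
    rw [mul_smul_comm, Matrix.trace_smul, smul_eq_mul, Complex.re_ofReal_mul, sum_diag_mul_eq_trace]
  have h2 : ∀ x, |∑ y, n.readout x y * f y - f x| ≤ 2 * W.card * δ := by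
    intro x
    have e1 : ∑ y, n.readout x y * f y - f x = ∑ y, n.readout x y * (f y - f x) := by
      simp only [mul_sub, Finset.sum_sub_distrib, ← Finset.sum_mul, hn.readout_sum, one_mul]
    rw [e1]
    -- If x and y agree on W the term vanishes; otherwise the values differ by at most 2 and some
    -- mode of W is misreported. This union bound allows arbitrarily correlated readout errors.
    have e2 : ∀ y, |n.readout x y * (f y - f x)| ≤
        ∑ m ∈ W, 2 * (if (m ∈ x ↔ m ∈ y) then 0 else n.readout x y) := by
      intro y
      by_cases h : ∀ m ∈ W, (m ∈ x ↔ m ∈ y)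
      · rw [hW x y h, sub_self, mul_zero, abs_zero]
        refine Finset.sum_nonneg fun m _ => ?_
        split_ifs
        · simp
        · linarith [hn.readout_nonneg x y]
      · push Not at h
        obtain ⟨m, hm, hxy⟩ := h
        have hxy' : ¬ (m ∈ x ↔ m ∈ y) := by tauto
        have h3 : 2 * (if (m ∈ x ↔ m ∈ y) then 0 else n.readout x y) ≤
            ∑ m ∈ W, 2 * (if (m ∈ x ↔ m ∈ y) then 0 else n.readout x y) := by
          refine Finset.single_le_sum (f := fun m => 2 * (if (m ∈ x ↔ m ∈ y) then 0 else n.readout x y))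
            (fun k _ => ?_) hm
          split_ifs
          · simp
          · linarith [hn.readout_nonneg x y]
        rw [if_neg hxy'] at h3
        refine le_trans ?_ h3
        rw [abs_mul, abs_of_nonneg (hn.readout_nonneg x y), mul_comm]
        refine mul_le_mul_of_nonneg_right ?_ (hn.readout_nonneg x y)
        have := abs_le.mp (hf x)
        have := abs_le.mp (hf y)
        rw [abs_le]; constructor <;> linarith
    calc _ ≤ ∑ y, |n.readout x y * (f y - f x)| := Finset.abs_sum_le_sum_abs _ _
      _ ≤ ∑ y, ∑ m ∈ W, 2 * (if (m ∈ x ↔ m ∈ y) then 0 else n.readout x y) :=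
          Finset.sum_le_sum fun y _ => e2 y
      _ = ∑ m ∈ W, 2 * ∑ y, (if (m ∈ x ↔ m ∈ y) then 0 else n.readout x y) := by
          rw [Finset.sum_comm]; simp only [Finset.mul_sum]
      _ ≤ ∑ _m ∈ W, 2 * δ := Finset.sum_le_sum fun m _ =>
          mul_le_mul_of_nonneg_left (hn.readout_flip x m) (by norm_num)
      _ = _ := by rw [Finset.sum_const, nsmul_eq_mul]; ring
  rw [e.mean_eq, h1, ← Finset.sum_sub_distrib]
  calc _ ≤ ∑ s, e.weight s * (2 * W.card * δ) := by
        refine (Finset.abs_sum_le_sum_abs _ _).trans (Finset.sum_le_sum fun s _ => ?_)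
        rw [← mul_sub, abs_mul, abs_of_nonneg (e.weight_nonneg s), ← Finset.sum_sub_distrib]
        refine mul_le_mul_of_nonneg_left ?_ (e.weight_nonneg s)
        refine (Finset.abs_sum_le_sum_abs _ _).trans ?_
        calc _ ≤ ∑ x, ((circuitUnitary H (e.circuit s) * n.state *
              (circuitUnitary H (e.circuit s))ᴴ) x x).re * (2 * W.card * δ) := by
              refine Finset.sum_le_sum fun x _ => ?_
              rw [← mul_sub, abs_mul, abs_of_nonneg (diag_re_nonneg hn.density.1 _ x)]
              exact mul_le_mul_of_nonneg_left (h2 x) (diag_re_nonneg hn.density.1 _ x)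
          _ = _ := by
              rw [← Finset.sum_mul, sum_diag_re hn.density (circuitUnitary_mem hH _), one_mul]
    _ = _ := by rw [← Finset.sum_mul, e.weight_sum, one_mul]

end Expectation

/-! ### Preparing and measuring pair coherence. -/

section PairGate

variable {M : Type} [Fintype M] [LinearOrder M]

lemma splitter_conj_mul {x y u v : Op M} {η : ℂ} (h : IsCARPair x y) (hη : star η * η = 1) :
    splitter x y η * (u * v) * splitter x y η =
      (splitter x y η * u * splitter x y η) * (splitter x y η * v * splitter x y η) := by
  have := splitter_mul_self h hη
  simp only [mul_assoc]
  rw [← mul_assoc (splitter x y η) (splitter x y η) (v * _), this, one_mul]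

lemma splitter_conj_conjTranspose (x y u : Op M) (η : ℂ) :
    splitter x y η * uᴴ * splitter x y η = (splitter x y η * u * splitter x y η)ᴴ := by
  simp only [Matrix.conjTranspose_mul, splitter_conjTranspose, mul_assoc]

/-- The unimodular factor of `pairGate_unitary` cancels, and since the splitter is Hermitian the
gate and its adjoint act alike by conjugation. -/
lemma pairGate_conj {a b : M} (hab : a ≠ b) {η : ℂ} (hη : star η * η = 1) (X : Op M) :
    ((pairGate a b hab η).unitary)ᴴ * X * (pairGate a b hab η).unitary =
      splitter (ann a) (cre b) η * X * splitter (ann a) (cre b) η ∧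
    (pairGate a b hab η).unitary * X * ((pairGate a b hab η).unitary)ᴴ =
      splitter (ann a) (cre b) η * X * splitter (ann a) (cre b) η := by
  obtain ⟨u, hu, h⟩ := pairGate_unitary a b hab hη
  rw [h, Matrix.conjTranspose_smul, splitter_conjTranspose]
  constructor
  · rw [smul_mul_assoc, smul_mul_assoc, mul_smul_comm, smul_smul, hu, one_smul]
  · rw [smul_mul_assoc, smul_mul_assoc, mul_smul_comm, smul_smul, mul_comm, hu, one_smul]

lemma ofReal_sqrt_two_sq : ((√2 : ℝ) : ℂ) ^ 2 = 2 := by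
  exact_mod_cast Real.sq_sqrt (show (0 : ℝ) ≤ 2 by norm_num)

/-- With y = a_b† the left side is the conjugate of n_a + n_b - 1, so counting particles after the
gate measures the quadrature of the pair coherence selected by η. -/
lemma splitter_conj_diff {x y : Op M} {η : ℂ} (h : IsCARPair x y) (hη : star η * η = 1) :
    splitter x y η * (xᴴ * x - yᴴ * y) * splitter x y η =
      η • (xᴴ * y) + star η • (yᴴ * x) := by
  obtain ⟨-, h1, h2⟩ := splitProj_idem h hη
  have hη' : (starRingEnd ℂ) η * η = 1 := hη
  rw [mul_sub, sub_mul, splitter_conj_mul h hη, splitter_conj_mul h hη, splitter_conj_conjTranspose,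
    splitter_conj_conjTranspose, h1, h2]
  simp only [Matrix.conjTranspose_smul, RCLike.star_def, Complex.conj_ofReal,
    Matrix.conjTranspose_add, Matrix.conjTranspose_sub, mul_add, add_mul, mul_sub,
    sub_mul, smul_mul_assoc, mul_smul_comm, smul_smul, Complex.conj_conj]
  match_scalars
  · linear_combination -((√2 : ℝ) : ℂ) ^ 2 / 4 * hη'
  · linear_combination (1 / 2) * (starRingEnd ℂ) η * ofReal_sqrt_two_sq
  · linear_combination (1 / 2) * η * ofReal_sqrt_two_sq
  · linear_combination ((√2 : ℝ) : ℂ) ^ 2 / 4 * hη'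

/-- With y = a_b† this is the pair operator seen from the vacuum of the preparation gate. Only y†y =
a_b a_b† has a vacuum expectation, whence the value 1/2. -/
lemma splitter_conj_pair {x y : Op M} (h : IsCARPair x y) :
    splitter x y (-1) * (yᴴ * x) * splitter x y (-1) =
      (1 / 2 : ℂ) • (-(xᴴ * x) + xᴴ * y - yᴴ * x + yᴴ * y) := by
  have hη : star (-1 : ℂ) * (-1) = 1 := by simp
  obtain ⟨-, h1, h2⟩ := splitProj_idem h hη
  rw [splitter_conj_mul h hη, splitter_conj_conjTranspose, h1, h2]
  simp only [Matrix.conjTranspose_smul, RCLike.star_def, Complex.conj_ofReal,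
    Matrix.conjTranspose_sub, mul_add,
    sub_mul, smul_mul_assoc, mul_smul_comm, map_neg, map_one]
  match_scalars
  · linear_combination -(1 / 4) * ofReal_sqrt_two_sq
  · linear_combination -(1 / 4) * ofReal_sqrt_two_sq
  · linear_combination (1 / 4) * ofReal_sqrt_two_sq
  · linear_combination (1 / 4) * ofReal_sqrt_two_sq

/-- The prepared two-mode state gives the pair operator the expectation value `1 / 2`. -/
lemma stateProj_pairGate_conj {a b : M} (hab : a ≠ b) :
    (pairGate a b hab (-1)).stateProj * (ann b * ann a) * (pairGate a b hab (-1)).stateProj =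
      (1 / 2 : ℂ) • (pairGate a b hab (-1)).stateProj := by
  have hη : star (-1 : ℂ) * (-1) = 1 := by simp
  set g := pairGate a b hab (-1) with hg
  set U := g.unitary with hU
  set p : Op M := (1 - num a) * (1 - num b) with hp
  have hs : g.stateProj = U * p * Uᴴ := rfl
  clear_value p
  have h1 : Uᴴ * (ann b * ann a) * U = (1 / 2 : ℂ) •
      (-(cre a * ann a) + cre a * cre b - ann b * ann a + ann b * cre b) := by
    rw [hU, hg, (pairGate_conj hab hη _).1]
    have := splitter_conj_pair (isCARPair_ann_cre hab)
    rw [cre_conjTranspose, ann_conjTranspose] at this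
    exact this
  have ha0 : ann a * p = 0 := by
    have : ann a * num a = ann a := by
      rw [num, ← mul_assoc, ann_mul_cre_self', sub_mul, one_mul, mul_assoc, ann_sq, mul_zero,
        sub_zero]
    rw [hp, ← mul_assoc, mul_sub (ann a), mul_one, this, sub_self, zero_mul]
  have hcomm : Commute (num a) (num b) := by
    rw [num_eq_diagonal, num_eq_diagonal]; exact Matrix.commute_diagonal _ _
  have hb1 : ann b * cre b * p = p := by
    have : ann b * cre b = 1 - num b := ann_mul_cre_self' b
    have h2 : (1 - num b : Op M) * (1 - num b) = 1 - num b := by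
      rw [← emptyProj_singleton, emptyProj_mul_self]
    have h3 : Commute (1 - num a : Op M) (1 - num b) :=
      (Commute.one_left _).sub_left ((Commute.one_right _).sub_right hcomm)
    rw [this, hp, h3.eq, ← mul_assoc, h2]
  have hpH : pᴴ = p := by
    have h3 : Commute (1 - num a : Op M) (1 - num b) :=
      (Commute.one_left _).sub_left ((Commute.one_right _).sub_right hcomm)
    rw [hp, Matrix.conjTranspose_mul]
    simp only [Matrix.conjTranspose_sub, Matrix.conjTranspose_one, num_conjTranspose]
    rw [h3.eq]
  have hca : p * cre a = 0 := by
    have := congrArg Matrix.conjTranspose ha0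
    simpa [hpH, ann_conjTranspose] using this
  have hpp : p * p = p := by
    have h3 : Commute (1 - num b : Op M) (1 - num a) :=
      (Commute.one_left _).sub_left ((Commute.one_right _).sub_right hcomm.symm)
    have h2 : ∀ m : M, (1 - num m : Op M) * (1 - num m) = 1 - num m := fun m => by
      rw [← emptyProj_singleton, emptyProj_mul_self]
    calc p * p = (1 - num a) * ((1 - num b) * (1 - num a)) * (1 - num b) := by
          simp only [hp, mul_assoc]
      _ = (1 - num a) * (1 - num a) * ((1 - num b) * (1 - num b)) := by
          rw [h3.eq]; simp only [mul_assoc]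
      _ = p := by rw [h2, h2, hp]
  -- The vacuum projection p is killed by a_a on its left and by a_a† on its right, so that only a_b
  -- a_b† survives.
  have h4 : p * (Uᴴ * (ann b * ann a) * U) * p = (1 / 2 : ℂ) • p := by
    rw [h1, mul_smul_comm, smul_mul_assoc]
    congr 1
    rw [mul_add, mul_sub, mul_add, add_mul, sub_mul, add_mul]
    have t1 : p * -(cre a * ann a) * p = 0 := by rw [mul_neg, ← mul_assoc p, hca]; simp
    have t2 : p * (cre a * cre b) * p = 0 := by rw [← mul_assoc p, hca]; simp
    have t3 : p * (ann b * ann a) * p = 0 := by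
      rw [mul_assoc, mul_assoc, ha0, mul_zero, mul_zero]
    have t4 : p * (ann b * cre b) * p = p := by rw [mul_assoc, hb1, hpp]
    rw [t1, t2, t3, t4]; abel
  rw [hs]
  calc U * p * Uᴴ * (ann b * ann a) * (U * p * Uᴴ) =
      U * (p * (Uᴴ * (ann b * ann a) * U) * p) * Uᴴ := by simp only [mul_assoc]
    _ = _ := by rw [h4, mul_smul_comm, smul_mul_assoc]

lemma stateProj_isProj (g : FLO M) :
    g.stateProjᴴ = g.stateProj ∧ g.stateProj * g.stateProj = g.stateProj := by
  have hcomm : Commute (1 - num g.fst : Op M) (1 - num g.snd) := by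
    rw [← emptyProj_singleton, ← emptyProj_singleton, emptyProj, emptyProj]
    exact Matrix.commute_diagonal _ _
  have h2 : ∀ m : M, (1 - num m : Op M) * (1 - num m) = 1 - num m := fun m => by
    rw [← emptyProj_singleton, emptyProj_mul_self]
  constructor
  · rw [FLO.stateProj, Matrix.conjTranspose_mul, Matrix.conjTranspose_conjTranspose,
      Matrix.conjTranspose_mul, Matrix.conjTranspose_mul]
    simp only [Matrix.conjTranspose_sub, Matrix.conjTranspose_one, num_conjTranspose]
    rw [← hcomm.eq]
    simp only [mul_assoc]
  · have hpp : (1 - num g.fst : Op M) * (1 - num g.snd) * ((1 - num g.fst) * (1 - num g.snd)) =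
        (1 - num g.fst) * (1 - num g.snd) := by
      calc _ = (1 - num g.fst : Op M) * ((1 - num g.snd) * (1 - num g.fst)) * (1 - num g.snd) := by
            simp only [mul_assoc]
        _ = (1 - num g.fst) * (1 - num g.fst) * ((1 - num g.snd) * (1 - num g.snd)) := by
            rw [← hcomm.eq]; simp only [mul_assoc]
        _ = _ := by rw [h2, h2]
    have hU := g.unitary_conjTranspose_mul_self
    unfold FLO.stateProj
    set p : Op M := (1 - num g.fst) * (1 - num g.snd)
    calc _ = g.unitary * (p * (g.unitaryᴴ * g.unitary) * p) * g.unitaryᴴ := by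
          simp only [mul_assoc]
      _ = _ := by rw [hU, mul_one, hpp]

end PairGate

end Hubbard

namespace Hubbard

open scoped Matrix.Norms.L2Operator

/-! ### The experiments of a layout and what they measure. -/

namespace Layout

variable {M : Type} [Fintype M] [LinearOrder M] {N : ℕ} (L : Layout M N)

/-- The gates that pair the two modes of each block. -/
def pairGates (η : ℂ) : List (FLO M) :=
  (List.finRange N).map fun i => pairGate (L.a i) (L.b i) (L.ne i) η

/-- The state preparation: a two-mode Gaussian state on each block. -/
def prep : Preparation M where
  blocks := L.pairGates (-1)
  disjoint := by
    rw [pairGates, List.pairwise_map]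
    exact (List.nodup_finRange N).imp fun {i j} hij => L.disj i j hij

/-- The gates that change the frame. -/
def frameGates (γ : M → Bool) : List (FLO M) := twirlGates L.w L.hw γ ++ L.frame

/-- A short evolution in a changed frame. -/
def cycle (τ : NNReal) (γ : M → Bool) : Circuit M :=
  (L.frameGates γ).map Step.gate ++ (Step.evolve τ :: (L.frameGates γ).reverse.map Step.gate)

/-- The circuit for the given choices of signs. -/
def circ (η : ℂ) (τ : NNReal) : List (M → Bool) → Circuit M
  | [] => (L.pairGates η).map Step.gate
  | γ :: l => L.cycle τ γ ++ circ η τ l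

/-- The experiment: `r` cycles of length `τ` with random signs. -/
def experiment (η : ℂ) (τ : NNReal) (r : ℕ) : Experiment M where
  prep := L.prep
  Seed := Fin r → (M → Bool)
  weight := fun _ => ((Fintype.card (Fin r → (M → Bool)) : ℕ) : ℝ)⁻¹
  weight_nonneg := fun _ => by positivity
  weight_sum := by
    rw [Finset.sum_const, Finset.card_univ, nsmul_eq_mul, mul_inv_cancel₀]
    exact_mod_cast Fintype.card_ne_zero
  circuit := fun s => L.circ η τ (List.ofFn s)

lemma circuitTime_append (c c' : Circuit M) :
    circuitTime (c ++ c') = circuitTime c + circuitTime c' := by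
  simp [circuitTime]

lemma circuitGates_append (c c' : Circuit M) :
    circuitGates (c ++ c') = circuitGates c + circuitGates c' := by
  simp [circuitGates]

lemma circuitTime_gates (l : List (FLO M)) : circuitTime (l.map Step.gate) = 0 := by
  induction l with
  | nil => rfl
  | cons g l ih => simpa [circuitTime, Step.time] using ih

lemma circuitGates_gates (l : List (FLO M)) : circuitGates (l.map Step.gate) = l.length := by
  induction l with
  | nil => rfl
  | cons g l ih =>
    have : circuitGates ((g :: l).map Step.gate) = 1 + circuitGates (l.map Step.gate) := by
      simp [circuitGates, Step.gates]
    rw [this, ih, List.length_cons, add_comm]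

lemma circuitTime_circ (η : ℂ) (τ : NNReal) (l : List (M → Bool)) :
    circuitTime (L.circ η τ l) = l.length * τ := by
  induction l with
  | nil => simp [circ, circuitTime_gates]
  | cons γ l ih =>
    have : circuitTime (L.cycle τ γ) = τ := by
      rw [cycle, circuitTime_append, circuitTime_gates]
      have := circuitTime_gates (L.frameGates γ).reverse
      simp only [circuitTime, List.map_cons, List.sum_cons] at this ⊢
      rw [this]; simp [Step.time]
    rw [circ, circuitTime_append, ih, this, List.length_cons]
    push_cast; ring

/-- Each cycle applies the sign gates and the frame gates and then undoes them, hence the factor 2;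
the N final gates prepare the readout of the blocks. -/
lemma circuitGates_circ (η : ℂ) (τ : NNReal) (l : List (M → Bool)) :
    circuitGates (L.circ η τ l) = l.length * (2 * (Fintype.card M + L.frame.length)) + N := by
  induction l with
  | nil => rw [circ, circuitGates_gates]; simp [pairGates]
  | cons γ l ih =>
    have : circuitGates (L.cycle τ γ) = 2 * (Fintype.card M + L.frame.length) := by
      rw [cycle, circuitGates_append, circuitGates_gates]
      have := circuitGates_gates (L.frameGates γ).reverse
      simp only [circuitGates, List.map_cons, List.sum_cons] at this ⊢
      rw [this]; simp [Step.gates, frameGates, twirlGates]; ring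
    rw [circ, circuitGates_append, ih, this, List.length_cons]
    ring

variable {L}

lemma circuitUnitary_cycle (hF : ∀ g ∈ L.frame, (g.unitary)ᴴ = g.unitary) (H : Op M) (τ : NNReal)
    (γ : M → Bool) :
    circuitUnitary H (L.cycle τ γ) = cycleU H (gatesU L.frame * twirlU γ) τ := by
  have h1 : gatesU (L.frameGates γ) = gatesU L.frame * twirlU γ := by
    rw [frameGates, gatesU_append, gatesU_twirlGates]
  have h2 : gatesU (L.frameGates γ).reverse = (gatesU (L.frameGates γ))ᴴ := by
    apply gatesU_reverse
    intro g hg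
    rcases List.mem_append.mp hg with h | h
    · exact twirlGates_hermitian L.w L.hw γ g h
    · exact hF g h
  rw [cycle, circuitUnitary_append, circuitUnitary, circuitUnitary_gates, circuitUnitary_gates, h2,
    h1, cycleU, Step.unitary]

/-- Signs of different cycles are independent, so the average over seeds is a composition of
identical averages. The cycle applied first is the outermost channel in the Heisenberg picture. -/
lemma heis_experiment (hF : ∀ g ∈ L.frame, (g.unitary)ᴴ = g.unitary) (H : Op M) (η : ℂ) (τ : NNReal)
    (r : ℕ) (X : Op M) :
    (L.experiment η τ r).heis H X = (channel H (gatesU L.frame) τ)^[r]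
      ((gatesU (L.pairGates η))ᴴ * X * gatesU (L.pairGates η)) := by
  have hw : ∀ r : ℕ, (((((Fintype.card (Fin r → (M → Bool)) : ℕ) : ℝ)⁻¹ : ℝ)) : ℂ) =
      (((Fintype.card (M → Bool) : ℕ) : ℂ)⁻¹) ^ r := by
    intro r
    rw [Fintype.card_fun, Fintype.card_fin]; push_cast; rw [inv_pow]
  have key : ∀ r : ℕ, (L.experiment η τ r).heis H X =
      (((Fintype.card (M → Bool) : ℕ) : ℂ)⁻¹) ^ r • ∑ s : Fin r → (M → Bool),
        (circuitUnitary H (L.circ η τ (List.ofFn s)))ᴴ * X *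
          circuitUnitary H (L.circ η τ (List.ofFn s)) := by
    intro r
    rw [Finset.smul_sum, ← hw]
    rfl
  induction r with
  | zero =>
    rw [key]
    simp [circ, circuitUnitary_gates]
  | succ r ih =>
    rw [Function.iterate_succ_apply', ← ih, key, key, channel_smul, pow_succ, mul_smul]
    congr 1
    rw [channel]
    congr 1
    rw [Fintype.sum_equiv (Fin.consEquiv (fun _ : Fin (r + 1) => (M → Bool))).symm
      (fun s : Fin (r + 1) → (M → Bool) => (circuitUnitary H (L.circ η τ (List.ofFn s)))ᴴ * X *
          circuitUnitary H (L.circ η τ (List.ofFn s)))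
      (fun x : (M → Bool) × (Fin r → (M → Bool)) =>
        (circuitUnitary H (L.circ η τ (List.ofFn (Fin.cons x.1 x.2 : Fin (r + 1) → (M → Bool)))))ᴴ * X *
          circuitUnitary H (L.circ η τ (List.ofFn (Fin.cons x.1 x.2 : Fin (r + 1) → (M → Bool)))))
      (fun s => by simp [Fin.consEquiv]), Fintype.sum_prod_type]
    apply Finset.sum_congr rfl
    intro γ _
    rw [Finset.mul_sum, Finset.sum_mul]
    apply Finset.sum_congr rfl
    intro s _
    rw [List.ofFn_cons, circ, circuitUnitary_append, circuitUnitary_cycle hF,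
      Matrix.conjTranspose_mul]
    simp only [mul_assoc]

variable (L)

/-- The measured function of the outcome for the block `i`. -/
def obs (i : Fin N) (y : Finset M) : ℝ :=
  ((if L.a i ∈ y then 1 else 0) + (if L.b i ∈ y then 1 else 0) - 1) *
    (if Disjoint (L.z i) y then 1 else 0)

lemma abs_obs_le (i : Fin N) (y : Finset M) : |L.obs i y| ≤ 1 := by
  unfold obs; split_ifs <;> norm_num

/-- The measured function depends on at most four modes, which keeps the effect of readout errors
independent of N. -/
lemma obs_congr (i : Fin N) {x y : Finset M}
    (h : ∀ m ∈ insert (L.a i) (insert (L.b i) (L.z i)), m ∈ x ↔ m ∈ y) : L.obs i x = L.obs i y := by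
  have h1 := h (L.a i) (by simp)
  have h2 := h (L.b i) (by simp)
  have h3 : Disjoint (L.z i) x ↔ Disjoint (L.z i) y := by
    rw [Finset.disjoint_left, Finset.disjoint_left]
    constructor
    · intro hd m hm hy; exact hd hm ((h m (by simp [hm])).mpr hy)
    · intro hd m hm hy; exact hd hm ((h m (by simp [hm])).mp hy)
  simp only [obs, h1, h2, h3]

lemma diagonal_obs (i : Fin N) : Matrix.diagonal (fun y => (L.obs i y : ℂ)) =
    (num (L.a i) + num (L.b i) - 1) * emptyProj (L.z i) := by
  rw [num_eq_diagonal, num_eq_diagonal, emptyProj, ← Matrix.diagonal_one, Matrix.diagonal_add,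
    Matrix.diagonal_sub, Matrix.diagonal_mul_diagonal]
  congr 1; ext S
  simp only [obs]
  split_ifs <;> simp

lemma avoids_of_block {X : Op M} {i : Fin N} (h : ∀ m, m ∉ ({L.a i, L.b i} : Finset M) → m ∉ L.z i → Avoids X m)
    {k : Fin N} (hk : k ≠ i) (η : ℂ) :
    Commute (pairGate (L.a k) (L.b k) (L.ne k) η).unitary X := by
  have hd := Finset.disjoint_left.mp (L.disj k i hk)
  have hz := Finset.disjoint_right.mp (L.zdisj i k)
  exact (Avoids.commute_unitary (h _ (hd (by simp [pairGate])) (hz (by simp [pairGate])))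
    (h _ (hd (by simp [pairGate])) (hz (by simp [pairGate])))).symm

lemma commute_emptyProj_pairGate (i k : Fin N) (η : ℂ) :
    Commute (emptyProj (L.z i)) (pairGate (L.a k) (L.b k) (L.ne k) η).unitary := by
  have hz := Finset.disjoint_right.mp (L.zdisj i k)
  exact Avoids.commute_unitary (Avoids.emptyProj (hz (by simp [pairGate])))
    (Avoids.emptyProj (hz (by simp [pairGate])))

lemma pairOp_conjTranspose (i : Fin N) : (pairOp (L.a i) (L.b i) (L.z i))ᴴ =
    cre (L.a i) * cre (L.b i) * emptyProj (L.z i) := by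
  have hz := Finset.disjoint_right.mp (L.zdisj i i)
  have ha : Avoids (emptyProj (L.z i)) (L.a i) := Avoids.emptyProj (hz (by simp))
  have hb : Avoids (emptyProj (L.z i)) (L.b i) := Avoids.emptyProj (hz (by simp))
  rw [pairOp, Matrix.conjTranspose_mul, Matrix.conjTranspose_mul, emptyProj_conjTranspose,
    ann_conjTranspose, ann_conjTranspose]
  exact (ha.2.mul_right hb.2).eq

/-- The observable that is measured by the final gates. -/
lemma pairGates_conj_obs (i : Fin N) {η : ℂ} (hη : star η * η = 1) :
    (gatesU (L.pairGates η))ᴴ * Matrix.diagonal (fun y => (L.obs i y : ℂ)) *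
      gatesU (L.pairGates η) =
    η • (pairOp (L.a i) (L.b i) (L.z i))ᴴ + star η • pairOp (L.a i) (L.b i) (L.z i) := by
  rw [diagonal_obs, pairGates, pairOp_conjTranspose]
  apply gatesU_conj (List.nodup_finRange N) (i := i) (List.mem_finRange i)
  · intro k _ hk
    apply L.avoids_of_block (i := i) _ hk
    intro m hm hmz
    simp only [Finset.mem_insert, Finset.mem_singleton, not_or] at hm
    exact (((Avoids.num (Ne.symm hm.1)).add (Avoids.num (Ne.symm hm.2))).sub Avoids.one).mul
      (Avoids.emptyProj hmz)
  · intro k _ hk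
    apply L.avoids_of_block (i := i) _ hk
    intro m hm hmz
    simp only [Finset.mem_insert, Finset.mem_singleton, not_or] at hm
    have h1 := Ne.symm hm.1
    have h2 := Ne.symm hm.2
    exact (((Avoids.cre_cre h1 h2).mul (Avoids.emptyProj hmz)).smul _).add
      (((Avoids.ann_ann h2 h1).mul (Avoids.emptyProj hmz)).smul _)
  · have hc := L.commute_emptyProj_pairGate i i η
    rw [mul_assoc, mul_assoc (num (L.a i) + num (L.b i) - 1), hc.eq, ← mul_assoc, ← mul_assoc,
      (pairGate_conj (L.ne i) hη _).1]
    have h1 := splitter_conj_diff (isCARPair_ann_cre (L.ne i)) hη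
    rw [cre_conjTranspose, ann_conjTranspose] at h1
    have h2 : num (L.a i) + num (L.b i) - 1 = cre (L.a i) * ann (L.a i) - ann (L.b i) * cre (L.b i) := by
      rw [ann_mul_cre_self', num, num]; abel
    rw [h2, h1, add_mul, smul_mul_assoc, smul_mul_assoc, pairOp]

/-- The prepared state gives the pair operator of each block the expectation value `1 / 2`, up to
the preparation error. -/
lemma norm_trace_pairOp_sub_le (i : Fin N) {n : Spam M} {δ : ℝ} (hδ : 0 ≤ δ)
    (hn : n.IsBounded L.prep δ) {s : ℝ} (hs : 0 < s) :
    ‖(n.state * pairOp (L.a i) (L.b i) (L.z i)).trace - 1 / 2‖ ≤ s * (3 * δ) + s⁻¹ + 3 * δ := by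
  set g := pairGate (L.a i) (L.b i) (L.ne i) (-1) with hg
  have hgm : g ∈ L.prep.blocks := by
    change g ∈ L.pairGates (-1)
    exact List.mem_map.mpr ⟨i, List.mem_finRange i, rfl⟩
  set Z := emptyProj (L.z i) with hZ
  obtain ⟨hPH, hPP⟩ := stateProj_isProj g
  have hz := Finset.disjoint_right.mp (L.zdisj i i)
  have ha : Avoids Z (L.a i) := Avoids.emptyProj (hz (by simp))
  have hb : Avoids Z (L.b i) := Avoids.emptyProj (hz (by simp))
  have hZU : Commute Z g.unitary := L.commute_emptyProj_pairGate i i (-1)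
  have hZU' : Commute Z g.unitaryᴴ := by
    have := congrArg Matrix.conjTranspose hZU.eq
    rw [Matrix.conjTranspose_mul, Matrix.conjTranspose_mul, hZ, emptyProj_conjTranspose] at this
    exact this.symm
  have hPZ : Commute g.stateProj Z := by
    refine (Commute.mul_right (Commute.mul_right hZU ?_) hZU').symm
    exact ((Commute.one_right _).sub_right ha.commute_num).mul_right
      ((Commute.one_right _).sub_right hb.commute_num)
  have hZZ : Z * Z = Z := emptyProj_mul_self _
  have hZH : Zᴴ = Z := emptyProj_conjTranspose _
  apply norm_trace_mul_sub_le hn.density (P := g.stateProj * Z)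
  · rw [Matrix.conjTranspose_mul, hPH, hZH, hPZ.eq]
  · calc g.stateProj * Z * (g.stateProj * Z) = g.stateProj * (Z * g.stateProj) * Z := by
          simp only [mul_assoc]
      _ = (g.stateProj * g.stateProj) * (Z * Z) := by rw [← hPZ.eq]; simp only [mul_assoc]
      _ = _ := by rw [hPP, hZZ]
  · exact norm_pairOp_le _ _ _
  · set q := ann (L.b i) * ann (L.a i) with hq'
    have hq : Commute Z q := hb.1.mul_right ha.1
    have e1 : Z * (q * Z) = q * Z := by rw [← mul_assoc, hq.eq, mul_assoc, hZZ]
    have e2 : Z * (g.stateProj * Z) = g.stateProj * Z := by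
      rw [← mul_assoc, ← hPZ.eq, mul_assoc, hZZ]
    calc g.stateProj * Z * (q * Z) * (g.stateProj * Z) =
        g.stateProj * (Z * (q * Z)) * (g.stateProj * Z) := by simp only [mul_assoc]
      _ = g.stateProj * q * (Z * (g.stateProj * Z)) := by rw [e1]; simp only [mul_assoc]
      _ = g.stateProj * q * g.stateProj * Z := by rw [e2]; simp only [mul_assoc]
      _ = _ := by rw [hq', hg, stateProj_pairGate_conj, smul_mul_assoc]
  · norm_num
  -- One prepared block and at most two empty modes each fail with probability at most δ: together
  -- 3δ.
  · refine (trace_mul_one_sub_mul_le hn.density hPH hPP hZH hZZ hPZ).trans ?_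
    have h1 := hn.block g hgm
    have h2 : ((n.state * (1 - g.stateProj)).trace).re ≤ δ := by
      rw [mul_sub, mul_one, Matrix.trace_sub, hn.density.2, Complex.sub_re, Complex.one_re]
      linarith
    have h3 : ((n.state * (1 - Z)).trace).re ≤ (L.z i).card * δ := by
      apply trace_mul_one_sub_emptyProj_le hn.density
      intro m hm
      apply hn.empty
      intro k hk
      obtain ⟨j, _, rfl⟩ := List.mem_map.mp hk
      exact Finset.disjoint_left.mp (L.zdisj i j) hm
    have h4 : ((L.z i).card : ℝ) ≤ 2 := by exact_mod_cast L.zcard i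
    nlinarith
  · exact hs

/-- The properties of a Hamiltonian under which an experiment with the layout `L` measures the
frequencies `lam i`. -/
structure Probes (H : Op M) (lam : Fin N → ℝ) (K : ℝ) : Prop where
  hermitian : Hᴴ = H
  frame : ∀ g ∈ L.frame, (g.unitary)ᴴ = g.unitary
  energy : ∀ i S, L.a i ∉ S → L.b i ∉ S → Disjoint (L.z i) S →
    ((gatesU L.frame)ᴴ * H * gatesU L.frame) (insert (L.a i) (insert (L.b i) S))
      (insert (L.a i) (insert (L.b i) S)) - ((gatesU L.frame)ᴴ * H * gatesU L.frame) S S = lam i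
  local_bound : ∀ i X, X = gatesU L.frame * pairOp (L.a i) (L.b i) (L.z i) * (gatesU L.frame)ᴴ →
    ‖H * (H * X - X * H) - (H * X - X * H) * H‖ ≤ K

variable {L}

lemma channel_iterate_conjTranspose (H F : Op M) (τ : ℝ) (r : ℕ) (X : Op M) :
    (channel H F τ)^[r] Xᴴ = ((channel H F τ)^[r] X)ᴴ := by
  induction r with
  | zero => rfl
  | succ r ih => rw [Function.iterate_succ_apply', Function.iterate_succ_apply', ih,
      channel_conjTranspose]

lemma channel_iterate_linear (H F : Op M) (τ : ℝ) (r : ℕ) (u v : ℂ) (X Y : Op M) :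
    (channel H F τ)^[r] (u • X + v • Y) =
      u • (channel H F τ)^[r] X + v • (channel H F τ)^[r] Y := by
  induction r with
  | zero => rfl
  | succ r ih => simp only [Function.iterate_succ_apply', ih, channel_add, channel_smul]

/-- The mean of the measured function is a quadrature of the phase `exp (- i λ t)`, up to the
errors of the averaging and of preparation and measurement. -/
lemma Probes.abs_mean_sub_le {H : Op M} {lam : Fin N → ℝ} {K : ℝ} (h : L.Probes H lam K) (i : Fin N)
    {η : ℂ} (hη : star η * η = 1) (τ : NNReal) (r : ℕ) (hlam : |lam i| * τ ≤ 1)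
    {n : Spam M} {δ : ℝ} (hδ : 0 ≤ δ) (hn : n.IsBounded L.prep δ) {s : ℝ} (hs : 0 < s) :
    |(L.experiment η τ r).mean H n (L.obs i) -
      (star η * Complex.exp (-(Complex.I * lam i * (r * τ)))).re| ≤
      2 * (r * ((K + lam i ^ 2) * τ ^ 2)) + 2 * (s * (3 * δ) + s⁻¹ + 3 * δ) + 8 * δ := by
  set Q := pairOp (L.a i) (L.b i) (L.z i) with hQ
  set F := gatesU L.frame with hF
  set ph := Complex.exp (-(Complex.I * lam i * (r * τ))) with hph
  have hηn : ‖star η‖ = 1 := by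
    have : ‖star η * η‖ = 1 := by rw [hη]; simp
    rw [norm_mul, norm_star] at this
    rw [norm_star]; nlinarith [norm_nonneg η]
  have hphn : ‖ph‖ = 1 := by
    have : -(Complex.I * lam i * (r * τ)) = ((-(lam i * (r * τ)) : ℝ) : ℂ) * Complex.I := by
      push_cast; ring
    rw [hph, this, Complex.norm_exp_ofReal_mul_I]
  have h1 := (L.experiment η τ r).abs_mean_sub_le h.hermitian hn (L.abs_obs_le i)
    (W := insert (L.a i) (insert (L.b i) (L.z i))) (fun x y hxy => L.obs_congr i hxy)
  have hW : ((insert (L.a i) (insert (L.b i) (L.z i))).card : ℝ) ≤ 4 := by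
    have e1 := Finset.card_insert_le (L.a i) (insert (L.b i) (L.z i))
    have e2 := Finset.card_insert_le (L.b i) (L.z i)
    have e3 := L.zcard i
    have : (insert (L.a i) (insert (L.b i) (L.z i))).card ≤ 4 := by omega
    exact_mod_cast this
  have h1' : 2 * ((insert (L.a i) (insert (L.b i) (L.z i))).card : ℝ) * δ ≤ 8 * δ := by nlinarith
  have h2 := norm_channel_iterate_pairOp_sub_le h.hermitian (gatesU_mem L.frame)
    (norm_channel_pairOp_sub_le h.hermitian (gatesU_mem L.frame) τ.coe_nonneg hlam
      (h.energy i) (h.local_bound i)) r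
  have h3 := L.norm_trace_pairOp_sub_le i hδ hn hs
  rw [heis_experiment h.frame, L.pairGates_conj_obs i hη, channel_iterate_linear,
    channel_iterate_conjTranspose] at h1
  set Y := (channel H F τ)^[r] Q with hY
  -- The observable is Hermitian, so its mean is twice a real part; this factor compensates the
  -- initial coherence 1/2 and the phase is seen with unit amplitude.
  have e1 : ((n.state * (η • Yᴴ + star η • Y)).trace).re = 2 * (star η * (n.state * Y).trace).re := by
    rw [mul_add, mul_smul_comm, mul_smul_comm, Matrix.trace_add, Matrix.trace_smul,
      Matrix.trace_smul, trace_mul_conjTranspose hn.density.1, smul_eq_mul, smul_eq_mul]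
    simp only [Complex.add_re, Complex.mul_re, RCLike.star_def, Complex.conj_re, Complex.conj_im]
    ring
  have e2 : ‖(n.state * Y).trace - ph * (n.state * Q).trace‖ ≤ r * ((K + lam i ^ 2) * τ ^ 2) := by
    have : (n.state * Y).trace - ph * (n.state * Q).trace = (n.state * (Y - ph • Q)).trace := by
      rw [mul_sub, Matrix.trace_sub, mul_smul_comm, Matrix.trace_smul, smul_eq_mul]
    rw [this]
    exact (norm_trace_mul_le hn.density _).trans h2
  have e3 : |2 * (star η * (n.state * Y).trace).re - (star η * ph).re| ≤
      2 * (r * ((K + lam i ^ 2) * τ ^ 2)) + 2 * (s * (3 * δ) + s⁻¹ + 3 * δ) := by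
    -- The deviation is split into the averaging error of the evolution and the error of the initial
    -- coherence.
    have : 2 * (star η * (n.state * Y).trace).re - (star η * ph).re =
        (2 * (star η * ((n.state * Y).trace - ph * (n.state * Q).trace) +
          star η * ph * ((n.state * Q).trace - 1 / 2))).re := by
      have : (2 * (star η * ((n.state * Y).trace - ph * (n.state * Q).trace) +
          star η * ph * ((n.state * Q).trace - 1 / 2))) =
          2 * (star η * (n.state * Y).trace) - star η * ph := by ring
      rw [this, Complex.sub_re]
      simp
    rw [this]
    refine (Complex.abs_re_le_norm _).trans ?_
    rw [norm_mul]
    have h4 := norm_add_le (star η * ((n.state * Y).trace - ph * (n.state * Q).trace))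
      (star η * ph * ((n.state * Q).trace - 1 / 2))
    rw [norm_mul, norm_mul, norm_mul, hηn, hphn, one_mul, one_mul, one_mul] at h4
    have : ‖(2 : ℂ)‖ = 2 := by simp
    rw [this]
    linarith
  rw [e1] at h1
  have := abs_sub_le ((L.experiment η τ r).mean H n (L.obs i))
    (2 * (star η * (n.state * Y).trace).re) ((star η * ph).re)
  linarith

end Layout

end Hubbard

namespace Hubbard

/-! ### Concentration of empirical means. -/

section Chernoff

variable {E α : Type} [Fintype E] [DecidableEq E] [Fintype α]

/-- The expectation with respect to a product of finitely supported distributions. -/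
def prodExpect (p : E → α → ℝ) (f : (E → α) → ℝ) : ℝ := ∑ r : E → α, (∏ e, p e (r e)) * f r

/-- Every member of the family is a probability distribution. -/
structure IsProbFamily (p : E → α → ℝ) : Prop where
  nonneg : ∀ e y, 0 ≤ p e y
  sum_eq : ∀ e, ∑ y, p e y = 1

variable {p : E → α → ℝ}

lemma prodExpect_prod (g : E → α → ℝ) :
    prodExpect p (fun r => ∏ e, g e (r e)) = ∏ e, ∑ y, p e y * g e y := by
  rw [Finset.prod_univ_sum, Fintype.piFinset_univ, prodExpect]
  simp only [Finset.prod_mul_distrib]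

lemma prodExpect_one (hp : IsProbFamily p) : prodExpect p (fun _ => 1) = 1 := by
  have := prodExpect_prod (p := p) (fun _ _ => 1)
  simpa [hp.sum_eq] using this

lemma prodExpect_mono (hp : IsProbFamily p) {f g : (E → α) → ℝ} (h : ∀ r, f r ≤ g r) :
    prodExpect p f ≤ prodExpect p g :=
  Finset.sum_le_sum fun r _ =>
    mul_le_mul_of_nonneg_left (h r) (Finset.prod_nonneg fun e _ => hp.nonneg e (r e))

lemma prodExpect_add (f g : (E → α) → ℝ) :
    prodExpect p (fun r => f r + g r) = prodExpect p f + prodExpect p g := by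
  simp only [prodExpect, mul_add, Finset.sum_add_distrib]

lemma prodExpect_const_mul (c : ℝ) (f : (E → α) → ℝ) :
    prodExpect p (fun r => c * f r) = c * prodExpect p f := by
  simp only [prodExpect, Finset.mul_sum]
  exact Finset.sum_congr rfl fun r _ => by ring

lemma prodExpect_sum {ι : Type*} (s : Finset ι) (f : ι → (E → α) → ℝ) :
    prodExpect p (fun r => ∑ i ∈ s, f i r) = ∑ i ∈ s, prodExpect p (f i) := by
  simp only [prodExpect, Finset.mul_sum]
  exact Finset.sum_comm

lemma prodExpect_const (hp : IsProbFamily p) (c : ℝ) : prodExpect p (fun _ => c) = c := by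
  have := prodExpect_const_mul (p := p) c (fun _ => 1)
  simpa [prodExpect_one hp] using this

lemma exp_le_one_add_add_sq {x : ℝ} (hx : |x| ≤ 1) : Real.exp x ≤ 1 + x + x ^ 2 := by
  have := (abs_le.mp (Real.abs_exp_sub_one_sub_id_le hx)).2
  linarith

/-- By exp x ≤ 1 + x + x² for |x| ≤ 1: the linear term is centred, and deviations from the mean are
at most 2, which gives 4s². -/
lemma sum_mul_exp_le {q g : α → ℝ} (hq : ∀ y, 0 ≤ q y) (hs : ∑ y, q y = 1)
    (hg : ∀ y, |g y| ≤ 1) {s : ℝ} (h0 : 0 ≤ s) (h1 : 2 * s ≤ 1) :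
    ∑ y, q y * Real.exp (s * (g y - ∑ x, q x * g x)) ≤ Real.exp (4 * s ^ 2) := by
  set μ := ∑ x, q x * g x with hμ
  have hμ1 : |μ| ≤ 1 := by
    calc |μ| ≤ ∑ x, |q x * g x| := Finset.abs_sum_le_sum_abs _ _
      _ ≤ ∑ x, q x := Finset.sum_le_sum fun x _ => by
          rw [abs_mul, abs_of_nonneg (hq x)]
          exact mul_le_of_le_one_right (hq x) (hg x)
      _ = 1 := hs
  clear_value μ
  have hd : ∀ y, |g y - μ| ≤ 2 := fun y => by
    have := abs_sub (g y) μ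
    linarith [hg y]
  have h2 : ∀ y, q y * Real.exp (s * (g y - μ)) ≤ q y * (1 + s * (g y - μ) + 4 * s ^ 2) := by
    intro y
    refine mul_le_mul_of_nonneg_left ?_ (hq y)
    have hx : |s * (g y - μ)| ≤ 1 := by
      rw [abs_mul, abs_of_nonneg h0]; nlinarith [hd y]
    refine (exp_le_one_add_add_sq hx).trans ?_
    have h3 : (g y - μ) ^ 2 ≤ 4 := by
      have := sq_le_sq' (abs_le.mp (hd y)).1 (abs_le.mp (hd y)).2
      linarith
    nlinarith [sq_nonneg s]
  calc _ ≤ ∑ y, q y * (1 + s * (g y - μ) + 4 * s ^ 2) := Finset.sum_le_sum fun y _ => h2 y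
    _ = (1 + 4 * s ^ 2 - s * μ) * ∑ y, q y + s * ∑ y, q y * g y := by
        rw [Finset.mul_sum, Finset.mul_sum, ← Finset.sum_add_distrib]
        exact Finset.sum_congr rfl fun y _ => by ring
    _ = 4 * s ^ 2 + 1 := by rw [hs, ← hμ]; ring
    _ ≤ _ := Real.add_one_le_exp _

/-- One-sided Chernoff bound for independent bounded variables. -/
lemma prodExpect_indicator_le (hp : IsProbFamily p) {g : E → α → ℝ} (hg : ∀ e y, |g e y| ≤ 1)
    (T : Finset E) {a : ℝ} (ha : 0 ≤ a) (ha4 : a ≤ 4) :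
    prodExpect p (fun r => if T.card * a ≤ ∑ e ∈ T, (g e (r e) - ∑ y, p e y * g e y) then 1 else 0) ≤
      Real.exp (-(T.card * (a ^ 2 / 16))) := by
  -- This value minimizes -s a + 4 s², with minimum -a²/16; a ≤ 4 ensures 2s ≤ 1.
  set s := a / 8 with hs
  have h1 : ∀ r : E → α, (if T.card * a ≤ ∑ e ∈ T, (g e (r e) - ∑ y, p e y * g e y) then (1 : ℝ) else 0)
      ≤ Real.exp (-(s * (T.card * a))) *
        ∏ e, (if e ∈ T then Real.exp (s * (g e (r e) - ∑ y, p e y * g e y)) else 1) := by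
    intro r
    rw [Finset.prod_ite_mem, Finset.univ_inter, ← Real.exp_sum, ← Real.exp_add, ← Finset.mul_sum]
    split_ifs with h
    · rw [← Real.exp_zero, Real.exp_le_exp]
      nlinarith [mul_le_mul_of_nonneg_left h (by positivity : 0 ≤ s)]
    · positivity
  refine (prodExpect_mono hp h1).trans ?_
  rw [prodExpect_const_mul, prodExpect_prod (p := p)
    (fun e y => if e ∈ T then Real.exp (s * (g e y - ∑ y, p e y * g e y)) else 1)]
  have h2 : ∏ e, ∑ y, p e y * (if e ∈ T then Real.exp (s * (g e y - ∑ y, p e y * g e y)) else 1) ≤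
      ∏ e, (if e ∈ T then Real.exp (4 * s ^ 2) else 1) := by
    refine Finset.prod_le_prod (fun e _ => Finset.sum_nonneg fun y _ => ?_) (fun e _ => ?_)
    · refine mul_nonneg (hp.nonneg e y) ?_
      split_ifs <;> positivity
    · split_ifs with h
      · exact sum_mul_exp_le (hp.nonneg e) (hp.sum_eq e) (hg e) (by positivity) (by rw [hs]; linarith)
      · simp [hp.sum_eq]
  rw [Finset.prod_ite_mem, Finset.univ_inter, Finset.prod_const, ← Real.exp_nat_mul] at h2
  calc _ ≤ Real.exp (-(s * (T.card * a))) * Real.exp (T.card * (4 * s ^ 2)) :=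
        mul_le_mul_of_nonneg_left h2 (Real.exp_pos _).le
    _ = _ := by
        rw [← Real.exp_add]; congr 1; rw [hs]; ring

/-- The empirical mean of independent bounded variables with mean values close to `c` is close
to `c`, except with exponentially small probability. -/
lemma prodExpect_deviation_le (hp : IsProbFamily p) {g : E → α → ℝ} (hg : ∀ e y, |g e y| ≤ 1)
    {T : Finset E} (hT : 0 < T.card) {c b a : ℝ} (ha : 0 < a) (ha4 : a ≤ 4)
    (hc : ∀ e ∈ T, |∑ y, p e y * g e y - c| ≤ b) :
    prodExpect p (fun r => if |(∑ e ∈ T, g e (r e)) / T.card - c| ≤ a + b then 0 else 1) ≤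
      2 * Real.exp (-(T.card * (a ^ 2 / 16))) := by
  have hT' : (0 : ℝ) < T.card := by exact_mod_cast hT
  have h1 := prodExpect_indicator_le hp hg T ha.le ha4
  have h2 := prodExpect_indicator_le hp (g := fun e y => -g e y) (fun e y => by rw [abs_neg]; exact hg e y)
    T ha.le ha4
  -- A deviation beyond a + b forces an upward or a downward deviation of at least a from the true
  -- means, as these average to within b of c.
  have h3 : ∀ r : E → α, (if |(∑ e ∈ T, g e (r e)) / T.card - c| ≤ a + b then (0 : ℝ) else 1) ≤
      (if T.card * a ≤ ∑ e ∈ T, (g e (r e) - ∑ y, p e y * g e y) then 1 else 0) +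
      (if T.card * a ≤ ∑ e ∈ T, (-g e (r e) - ∑ y, p e y * (-g e y)) then 1 else 0) := by
    intro r
    have hμ : |∑ e ∈ T, ∑ y, p e y * g e y - T.card * c| ≤ T.card * b := by
      have : ∑ e ∈ T, ∑ y, p e y * g e y - T.card * c = ∑ e ∈ T, (∑ y, p e y * g e y - c) := by
        rw [Finset.sum_sub_distrib]; simp
      rw [this]
      refine (Finset.abs_sum_le_sum_abs _ _).trans ((Finset.sum_le_sum hc).trans ?_)
      simp
    have e2 : ∑ e ∈ T, (-g e (r e) - ∑ y, p e y * (-g e y)) =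
        ∑ e ∈ T, ∑ y, p e y * g e y - ∑ e ∈ T, g e (r e) := by
      rw [← Finset.sum_sub_distrib]
      exact Finset.sum_congr rfl fun e _ => by
        simp only [mul_neg, Finset.sum_neg_distrib]; ring
    rw [e2, Finset.sum_sub_distrib]
    by_cases hA : T.card * a ≤ ∑ e ∈ T, g e (r e) - ∑ e ∈ T, ∑ y, p e y * g e y
    · rw [if_pos hA]; split_ifs <;> norm_num
    · by_cases hB : T.card * a ≤ ∑ e ∈ T, ∑ y, p e y * g e y - ∑ e ∈ T, g e (r e)
      · rw [if_pos hB]; split_ifs <;> norm_num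
      · rw [if_neg hA, if_neg hB, if_pos]; · simp
        push Not at hA hB
        have hμ' := abs_le.mp hμ
        have : (∑ e ∈ T, g e (r e)) / T.card - c = (∑ e ∈ T, g e (r e) - T.card * c) / T.card := by
          field_simp
        rw [this, abs_div, abs_of_pos hT', div_le_iff₀ hT', abs_le]
        constructor <;> nlinarith
  refine (prodExpect_mono hp h3).trans ?_
  rw [prodExpect_add]
  linarith

end Chernoff

/-! ### Frequencies from phases at doubling times. -/

section PhaseEstimation

/-- The restriction of a real number to the interval `[-1, 1]`. -/
def clip (x : ℝ) : ℝ := max (-1) (min 1 x)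

lemma abs_clip_le (x : ℝ) : |clip x| ≤ 1 := by
  rw [abs_le]; unfold clip
  constructor
  · exact le_max_left _ _
  · exact max_le (by norm_num) (min_le_left _ _)

lemma abs_clip_sub_le {x y : ℝ} (hy : |y| ≤ 1) : |clip x - y| ≤ |x - y| := by
  have hy' := abs_le.mp hy
  unfold clip
  rcases le_total 1 x with h | h
  · rw [min_eq_left h, max_eq_right (by norm_num), abs_of_nonneg (by linarith),
      abs_of_nonneg (by linarith)]
    linarith
  · rw [min_eq_right h]
    rcases le_total (-1) x with h' | h'
    · rw [max_eq_right h']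
    · rw [max_eq_left h', abs_of_nonpos (by linarith), abs_of_nonpos (by linarith)]
      linarith

/-- The frequency estimate after `j` rounds, the phase in round `j` being measured after the time
`2 ^ j / B`. -/
def freqEst (B : ℝ) (z : ℕ → ℂ) : ℕ → ℝ
  | 0 => 0
  | j + 1 => freqEst B z j +
      clip (z j * Complex.exp (-(Complex.I * (freqEst B z j * (2 ^ j / B) : ℝ)))).im * (B / 2 ^ j)

/-- Together with the tolerated phase error 1/4 this stays below 1/2, which is what halving the
error in each round requires. -/
lemma abs_sin_sub_le {x : ℝ} (hx : |x| ≤ 1) : |Real.sin x - x| ≤ 7 / 32 := by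
  have h := Real.sin_bound hx
  have h1 : |x| ^ 3 ≤ 1 := pow_le_one₀ (abs_nonneg x) hx
  have h2 : |x| ^ 5 ≤ 1 := pow_le_one₀ (abs_nonneg x) hx
  have h3 : |x ^ 3| ≤ 1 := by rwa [abs_pow]
  have h4 := abs_le.mp h
  have h5 := abs_le.mp h3
  rw [abs_le]; constructor <;> linarith

/-- One round of the frequency estimation halves the error if the phase is measured well. -/
lemma abs_freqEst_succ_sub_le {B lam : ℝ} (hB : 0 < B) {z : ℕ → ℂ} {j : ℕ}
    (h : |freqEst B z j - lam| ≤ B / 2 ^ j)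
    (hz : ‖z j - Complex.exp (Complex.I * (lam * (2 ^ j / B) : ℝ))‖ ≤ 1 / 4) :
    |freqEst B z (j + 1) - lam| ≤ B / 2 ^ (j + 1) := by
  set θ := freqEst B z j with hθ
  set t : ℝ := 2 ^ j / B with ht
  have ht0 : 0 < t := by positivity
  have hBt : B / 2 ^ j = t⁻¹ := by rw [ht, inv_div]
  set x := (lam - θ) * t with hx
  have hx1 : |x| ≤ 1 := by
    rw [hx, abs_mul, abs_of_pos ht0, abs_sub_comm]
    rw [hBt] at h
    calc _ ≤ t⁻¹ * t := by gcongr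
      _ = 1 := inv_mul_cancel₀ ht0.ne'
  have hE : ‖Complex.exp (-(Complex.I * (θ * t : ℝ)))‖ = 1 := by
    rw [show -(Complex.I * ((θ * t : ℝ) : ℂ)) = ((-(θ * t) : ℝ) : ℂ) * Complex.I by push_cast; ring,
      Complex.norm_exp_ofReal_mul_I]
  have h1 : |(z j * Complex.exp (-(Complex.I * (θ * t : ℝ)))).im - Real.sin x| ≤ 1 / 4 := by
    have e : Real.sin x = (Complex.exp (Complex.I * (lam * t : ℝ)) *
        Complex.exp (-(Complex.I * (θ * t : ℝ)))).im := by
      rw [← Complex.exp_add, show Complex.I * ((lam * t : ℝ) : ℂ) + -(Complex.I * ((θ * t : ℝ) : ℂ)) =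
        (x : ℂ) * Complex.I by rw [hx]; push_cast; ring, Complex.exp_ofReal_mul_I_im]
    rw [e, ← Complex.sub_im, ← sub_mul]
    refine (Complex.abs_im_le_norm _).trans ?_
    rw [norm_mul, hE, mul_one]; exact hz
  have h2 := abs_sin_sub_le hx1
  have h3 : |clip (z j * Complex.exp (-(Complex.I * (θ * t : ℝ)))).im - x| ≤ 1 / 2 := by
    refine (abs_clip_sub_le hx1).trans ?_
    have := abs_sub_le (z j * Complex.exp (-(Complex.I * (θ * t : ℝ)))).im (Real.sin x) x
    linarith
  have e : freqEst B z (j + 1) - lam =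
      (clip (z j * Complex.exp (-(Complex.I * (θ * t : ℝ)))).im - x) * t⁻¹ := by
    rw [freqEst, ← hθ, ← ht, hBt, hx]
    field_simp
    ring
  rw [e, abs_mul, abs_of_pos (inv_pos.mpr ht0), pow_succ, ← div_div, hBt]
  have := inv_pos.mpr ht0
  nlinarith

/-- Clipping limits the step even in a round with a wrong phase, so the damage done from round j on
is bounded by a geometric series. -/
lemma abs_freqEst_succ_sub_self_le {B : ℝ} (hB : 0 < B) (z : ℕ → ℂ) (j : ℕ) :
    |freqEst B z (j + 1) - freqEst B z j| ≤ B / 2 ^ j := by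
  rw [freqEst, add_sub_cancel_left, abs_mul, abs_of_pos (by positivity : 0 < B / 2 ^ j)]
  exact mul_le_of_le_one_left (by positivity) (abs_clip_le _)

/-- The first round that fails determines the error of the estimate. -/
lemma freqEst_error {B lam : ℝ} (hB : 0 < B) (hlam : |lam| ≤ B) (z : ℕ → ℂ) (J : ℕ) :
    |freqEst B z J - lam| ≤ B / 2 ^ J ∨
      ∃ j < J, ¬ ‖z j - Complex.exp (Complex.I * (lam * (2 ^ j / B) : ℝ))‖ ≤ 1 / 4 ∧
        |freqEst B z J - lam| ≤ 3 * (B / 2 ^ j) - 2 * (B / 2 ^ J) := by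
  -- If j is the first failing round, the error before it is at most B/2^j, and the steps from round
  -- j on add at most 2B/2^j - 2B/2^J.
  induction J with
  | zero => left; simpa [freqEst] using hlam
  | succ J ih =>
    have hstep := abs_freqEst_succ_sub_self_le hB z J
    have htri := abs_sub_le (freqEst B z (J + 1)) (freqEst B z J) lam
    have hpow : B / 2 ^ (J + 1) = B / 2 ^ J / 2 := by rw [pow_succ, div_div]
    rcases ih with h | ⟨j, hj, hbad, h⟩
    · by_cases hz : ‖z J - Complex.exp (Complex.I * (lam * (2 ^ J / B) : ℝ))‖ ≤ 1 / 4
      · left; exact abs_freqEst_succ_sub_le hB h hz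
      · right; refine ⟨J, Nat.lt_succ_self J, hz, ?_⟩
        rw [hpow]; linarith
    · right; refine ⟨j, hj.trans (Nat.lt_succ_self J), hbad, ?_⟩
      rw [hpow]; linarith

/-- The alternative of `freqEst_error` is relaxed to a sum over all failing rounds, so that
expectations can be taken term by term without conditioning on earlier rounds. -/
lemma sq_freqEst_error_le {B lam : ℝ} (hB : 0 < B) (hlam : |lam| ≤ B) (z : ℕ → ℂ) (J : ℕ) :
    (freqEst B z J - lam) ^ 2 ≤ (B / 2 ^ J) ^ 2 + ∑ j ∈ Finset.range J, 9 * (B / 2 ^ j) ^ 2 *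
      (if ‖z j - Complex.exp (Complex.I * (lam * (2 ^ j / B) : ℝ))‖ ≤ 1 / 4 then 0 else 1) := by
  have hnn : ∀ j ∈ Finset.range J, 0 ≤ 9 * (B / 2 ^ j) ^ 2 *
      (if ‖z j - Complex.exp (Complex.I * (lam * (2 ^ j / B) : ℝ))‖ ≤ 1 / 4 then (0 : ℝ) else 1) := by
    intro j _; split_ifs <;> positivity
  rw [← sq_abs]
  rcases freqEst_error hB hlam z J with h | ⟨j, hj, hbad, h⟩
  · have := Finset.sum_nonneg hnn
    have := pow_le_pow_left₀ (abs_nonneg _) h 2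
    linarith
  · have h1 := Finset.single_le_sum hnn (Finset.mem_range.mpr hj)
    rw [if_neg hbad, mul_one] at h1
    have h2 : |freqEst B z J - lam| ≤ 3 * (B / 2 ^ j) := by
      have : 0 < B / 2 ^ J := by positivity
      linarith
    have := pow_le_pow_left₀ (abs_nonneg _) h2 2
    have : 0 ≤ (B / 2 ^ J) ^ 2 := by positivity
    nlinarith

lemma sum_quarter_pow_le (J : ℕ) : ∑ j ∈ Finset.range J, (1 / 4 : ℝ) ^ (J - j) ≤ 1 / 3 := by
  induction J with
  | zero => simp
  | succ J ih =>
    rw [Finset.sum_range_succ]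
    have : ∑ j ∈ Finset.range J, (1 / 4 : ℝ) ^ (J + 1 - j) =
        (1 / 4) * ∑ j ∈ Finset.range J, (1 / 4 : ℝ) ^ (J - j) := by
      rw [Finset.mul_sum]
      refine Finset.sum_congr rfl fun j hj => ?_
      rw [Nat.succ_sub (Finset.mem_range.mp hj).le, pow_succ]; ring
    rw [this, Nat.add_sub_cancel_left, pow_one]
    linarith

/-- The mean square error of the frequency estimate, if the probability of failure decreases
geometrically with the distance to the last round. -/
lemma prodExpect_sq_freqEst_le {E α : Type} [Fintype E] [DecidableEq E] [Fintype α] {p : E → α → ℝ}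
    (hp : IsProbFamily p) {B lam : ℝ} (hB : 0 < B) (hlam : |lam| ≤ B) (z : (E → α) → ℕ → ℂ) (J : ℕ)
    (hz : ∀ j < J, prodExpect p (fun r =>
      if ‖z r j - Complex.exp (Complex.I * (lam * (2 ^ j / B) : ℝ))‖ ≤ 1 / 4 then 0 else 1) ≤
        4 * (1 / 16) ^ (J - j)) :
    prodExpect p (fun r => (freqEst B (z r) J - lam) ^ 2) ≤ 13 * (B / 2 ^ J) ^ 2 := by
  refine (prodExpect_mono hp fun r => sq_freqEst_error_le hB hlam (z r) J).trans ?_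
  rw [prodExpect_add, prodExpect_const hp, prodExpect_sum]
  -- In units of (B/2^J)², a failure in round j costs 9·4^(J-j) and has probability at most
  -- 4·16^-(J-j). The geometric series sums to at most 1/3, and 1 + 36/3 = 13.
  have h1 : ∀ j ∈ Finset.range J, prodExpect p (fun r => 9 * (B / 2 ^ j) ^ 2 *
      (if ‖z r j - Complex.exp (Complex.I * (lam * (2 ^ j / B) : ℝ))‖ ≤ 1 / 4 then 0 else 1)) ≤
      36 * (B / 2 ^ J) ^ 2 * (1 / 4) ^ (J - j) := by
    intro j hj
    have hj' := Finset.mem_range.mp hj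
    rw [prodExpect_const_mul]
    refine (mul_le_mul_of_nonneg_left (hz j hj') (by positivity)).trans (le_of_eq ?_)
    obtain ⟨k, rfl⟩ := Nat.exists_eq_add_of_le hj'.le
    rw [Nat.add_sub_cancel_left, show (1 / 16 : ℝ) = (1 / 4) * (1 / 4) by norm_num, mul_pow, pow_add]
    have : (1 / 4 : ℝ) ^ k = 1 / (2 ^ k) ^ 2 := by
      rw [← pow_mul, mul_comm, pow_mul, div_pow, one_pow]; norm_num
    rw [this]
    field_simp
    ring
  have h2 := Finset.sum_le_sum h1
  rw [← Finset.mul_sum] at h2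
  have h3 := mul_le_mul_of_nonneg_left (sum_quarter_pow_le J) (by positivity : 0 ≤ 36 * (B / 2 ^ J) ^ 2)
  linarith

lemma exp_neg_three_mul_le (k : ℕ) : Real.exp (-(3 * k)) ≤ (1 / 16) ^ k := by
  have h : Real.exp (-3) ≤ 1 / 16 := by
    have h1 : (16 : ℝ) ≤ Real.exp 3 := by
      have := Real.exp_one_gt_d9
      have e : Real.exp 3 = Real.exp 1 ^ 3 := by rw [← Real.exp_nat_mul]; norm_num
      rw [e]
      calc (16 : ℝ) ≤ 2.7 ^ 3 := by norm_num
        _ ≤ _ := by gcongr; linarith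
    rw [Real.exp_neg, one_div]
    exact inv_anti₀ (by norm_num) h1
  calc Real.exp (-(3 * k)) = Real.exp (-3) ^ k := by rw [← Real.exp_nat_mul]; congr 1; ring
    _ ≤ _ := by gcongr

end PhaseEstimation

end Hubbard

namespace Hubbard

/-! ### The frequency estimation protocol, its resources and its error. -/

section FrequencyProtocol

variable {N A q : ℕ}

/-- The experiments of the frequency estimation protocol: a layout, a round, a quadrature and a
repetition. -/
abbrev FreqIdx (q J : ℕ) : Type := Σ _ : Fin q, Σ j : Fin J, Bool × Fin (12288 * (J - j))

/-- The duration of a cycle in round `j`, if there are `R` cycles. -/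
def freqStep (B : ℝ) (R j : ℕ) : NNReal := Real.toNNReal (2 ^ j / B / R)

lemma mul_freqStep {B : ℝ} (hB : 0 < B) {R : ℕ} (hR : 0 < R) (j : ℕ) :
    (R : ℝ) * freqStep B R j = 2 ^ j / B := by
  have hR' : (0 : ℝ) < R := by exact_mod_cast hR
  rw [freqStep, Real.coe_toNNReal _ (by positivity)]
  field_simp

/-- The parameter of the final gates that measure the cosine or the sine of the phase. -/
def quadrature (b : Bool) : ℂ := if b then 1 else -Complex.I

lemma star_quadrature_mul (b : Bool) : star (quadrature b) * quadrature b = 1 := by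
  cases b <;> simp [quadrature]

/-- The experiments of the frequency estimation protocol. -/
def freqExp (L : Fin q → Layout (Mode N A) N) (B : ℝ) (J R : ℕ) (x : FreqIdx q J) :
    Experiment (Mode N A) :=
  (L x.1).experiment (quadrature x.2.2.1) (freqStep B R x.2.1) R

/-- The position of an experiment in the list of all experiments. -/
def freqPos (q J : ℕ) : FreqIdx q J ≃ Fin (Fintype.card (FreqIdx q J)) :=
  Fintype.equivFin (FreqIdx q J)

/-- The average outcome of the repetitions of a measurement. -/
def freqAvg (L : Fin q → Layout (Mode N A) N) (J : ℕ)
    (r : Fin (Fintype.card (FreqIdx q J)) → Finset (Mode N A)) (s : Fin q) (i : Fin N) (j : Fin J)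
    (b : Bool) : ℝ :=
  (∑ k, (L s).obs i (r (freqPos q J ⟨s, j, b, k⟩))) / ((12288 * (J - j) : ℕ) : ℝ)

/-- The measured value of the phase in round `j`. -/
def freqPhase (L : Fin q → Layout (Mode N A) N) (J : ℕ)
    (r : Fin (Fintype.card (FreqIdx q J)) → Finset (Mode N A)) (s : Fin q) (i : Fin N) (j : ℕ) : ℂ :=
  if h : j < J then
    (freqAvg L J r s i ⟨j, h⟩ true : ℂ) + Complex.I * (freqAvg L J r s i ⟨j, h⟩ false : ℂ)
  else 0

/-- The estimate of the frequency of the block `i` in the layout `s`. -/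
def freqValue (L : Fin q → Layout (Mode N A) N) (B : ℝ) (J : ℕ)
    (r : Fin (Fintype.card (FreqIdx q J)) → Finset (Mode N A)) (s : Fin q) (i : Fin N) : ℝ :=
  freqEst B (freqPhase L J r s i) J

/-- The protocol that estimates the frequencies of all blocks in all layouts, and computes
estimates of the coefficients from them. -/
def freqProtocol (L : Fin q → Layout (Mode N A) N) (B : ℝ) (J R : ℕ)
    (hE : (Fin q → Fin N → ℝ) → Fin N → Fin N → Spin → ℂ)
    (ωE : (Fin q → Fin N → ℝ) → Fin N → Spin → ℝ)
    (ξE : (Fin q → Fin N → ℝ) → Fin N → ℝ) : Protocol N A where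
  numExp := Fintype.card (FreqIdx q J)
  exp := fun e => freqExp L B J R ((freqPos q J).symm e)
  hEst := fun r => hE (freqValue L B J r)
  ωEst := fun r => ωE (freqValue L B J r)
  ξEst := fun r => ξE (freqValue L B J r)

lemma card_freqIdx (q J : ℕ) :
    Fintype.card (FreqIdx q J) = q * ∑ j ∈ Finset.range J, 2 * (12288 * (J - j)) := by
  rw [← Fin.sum_univ_eq_sum_range (fun j => 2 * (12288 * (J - j)))]
  simp [Fintype.card_sigma]

lemma card_freqIdx_le (q J : ℕ) : (Fintype.card (FreqIdx q J) : ℝ) ≤ 24576 * q * J ^ 2 := by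
  have : Fintype.card (FreqIdx q J) ≤ q * (J * (24576 * J)) := by
    rw [card_freqIdx]
    gcongr
    calc _ ≤ ∑ _j ∈ Finset.range J, 24576 * J := Finset.sum_le_sum fun j _ => by
          have := Nat.sub_le J j; omega
      _ = _ := by simp
  calc (Fintype.card (FreqIdx q J) : ℝ) ≤ ((q * (J * (24576 * J)) : ℕ) : ℝ) := by exact_mod_cast this
    _ = _ := by push_cast; ring

/-- The long rounds are repeated least often, so the total time is proportional to that of the
longest round, without a factor J. -/
lemma sum_sub_mul_two_pow_le (J : ℕ) :
    ∑ j ∈ Finset.range J, ((J - j : ℕ) : ℝ) * 2 ^ j ≤ 2 * 2 ^ J := by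
  induction J with
  | zero => simp
  | succ J ih =>
    have h1 : ∑ j ∈ Finset.range (J + 1), ((J + 1 - j : ℕ) : ℝ) * 2 ^ j =
        ∑ j ∈ Finset.range J, ((J - j : ℕ) : ℝ) * 2 ^ j + ∑ j ∈ Finset.range (J + 1), (2 : ℝ) ^ j := by
      rw [Finset.sum_range_succ, Finset.sum_range_succ _ J, ← add_assoc, ← Finset.sum_add_distrib]
      congr 1
      · refine Finset.sum_congr rfl fun j hj => ?_
        rw [Nat.succ_sub (Finset.mem_range.mp hj).le]; push_cast; ring
      · simp
    rw [h1, geom_sum_eq (by norm_num) (J + 1), pow_succ]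
    linarith

lemma circuitTime_freqExp (L : Fin q → Layout (Mode N A) N) (B : ℝ) (J R : ℕ) (x : FreqIdx q J)
    (s : Fin R → (Mode N A → Bool)) :
    circuitTime ((freqExp L B J R x).circuit s) = R * freqStep B R x.2.1 := by
  change circuitTime ((L x.1).circ _ _ (List.ofFn s)) = _
  rw [Layout.circuitTime_circ, List.length_ofFn]

lemma circuitGates_freqExp (L : Fin q → Layout (Mode N A) N) (B : ℝ) (J R : ℕ) (x : FreqIdx q J)
    (s : Fin R → (Mode N A → Bool)) :
    circuitGates ((freqExp L B J R x).circuit s) =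
      R * (2 * (Fintype.card (Mode N A) + (L x.1).frame.length)) + N := by
  change circuitGates ((L x.1).circ _ _ (List.ofFn s)) = _
  rw [Layout.circuitGates_circ, List.length_ofFn]

section Resources

variable (L : Fin q → Layout (Mode N A) N) {B : ℝ} (J R : ℕ)
  (hE : (Fin q → Fin N → ℝ) → Fin N → Fin N → Spin → ℂ)
  (ωE : (Fin q → Fin N → ℝ) → Fin N → Spin → ℝ)
  (ξE : (Fin q → Fin N → ℝ) → Fin N → ℝ)

lemma freqProtocol_timeLE (hB : 0 < B) (hR : 0 < R) :
    (freqProtocol L B J R hE ωE ξE).TimeLE (49152 * q * (2 ^ J / B)) := by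
  intro s
  have h1 : ∀ e, circuitTime (((freqProtocol L B J R hE ωE ξE).exp e).circuit (s e)) =
      2 ^ (((freqPos q J).symm e).2.1 : ℕ) / B := by
    intro e
    exact (circuitTime_freqExp L B J R _ (s e)).trans (mul_freqStep hB hR _)
  rw [Finset.sum_congr rfl fun e _ => h1 e]
  change ∑ e : Fin (Fintype.card (FreqIdx q J)), _ ≤ _
  rw [Fintype.sum_equiv (freqPos q J).symm _ (fun x : FreqIdx q J => (2 : ℝ) ^ (x.2.1 : ℕ) / B)
    (fun _ => rfl), Fintype.sum_sigma]
  simp only [Fintype.sum_sigma, Finset.sum_const, Finset.card_univ, Fintype.card_prod,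
    Fintype.card_bool, Fintype.card_fin, nsmul_eq_mul]
  rw [Fin.sum_univ_eq_sum_range (fun j => ((2 * (12288 * (J - j)) : ℕ) : ℝ) * (2 ^ j / B)) J]
  have h2 : ∑ j ∈ Finset.range J, ((2 * (12288 * (J - j)) : ℕ) : ℝ) * (2 ^ j / B) =
      24576 / B * ∑ j ∈ Finset.range J, ((J - j : ℕ) : ℝ) * 2 ^ j := by
    rw [Finset.mul_sum]
    refine Finset.sum_congr rfl fun j _ => ?_
    push_cast; ring
  rw [h2]
  calc _ ≤ (q : ℝ) * (24576 / B * (2 * 2 ^ J)) := by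
        have := sum_sub_mul_two_pow_le J
        gcongr
    _ = _ := by ring

lemma card_mode (N A : ℕ) : Fintype.card (Mode N A) = 2 * N + A := by
  have : Fintype.card (Mode N A) = Fintype.card ((Fin N × Fin 2) ⊕ Fin A) := rfl
  rw [this]; simp [mul_comm]

lemma freqProtocol_gatesLE (hA : A = N) (hR : 0 < R) (hf : ∀ s, (L s).frame.length ≤ N) :
    (freqProtocol L B J R hE ωE ξE).GatesLE (9 * N * R * (24576 * q * J ^ 2)) := by
  intro s
  have h1 : ∀ e, circuitGates (((freqProtocol L B J R hE ωE ξE).exp e).circuit (s e)) ≤ 9 * N * R := by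
    intro e
    refine (circuitGates_freqExp L B J R _ (s e)).le.trans ?_
    rw [card_mode]
    subst hA
    have := hf ((freqPos q J).symm e).1
    -- 3N sign gates and at most N frame gates, applied and undone in each of the R cycles, make
    -- 8NR; the final N gates are at most another NR.
    calc _ ≤ R * (2 * (2 * A + A + A)) + A * R := by
          gcongr
          exact Nat.le_mul_of_pos_right _ hR
      _ = _ := by ring
  have h2 : ∑ e, circuitGates (((freqProtocol L B J R hE ωE ξE).exp e).circuit (s e)) ≤
      Fintype.card (FreqIdx q J) * (9 * N * R) := by
    refine (Finset.sum_le_sum fun e _ => h1 e).trans (le_of_eq ?_)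
    rw [Finset.sum_const, Finset.card_univ, smul_eq_mul]
    congr 1
    exact Fintype.card_fin _
  calc (((∑ e, circuitGates (((freqProtocol L B J R hE ωE ξE).exp e).circuit (s e)) : ℕ) : ℝ)) ≤
        ((Fintype.card (FreqIdx q J) * (9 * N * R) : ℕ) : ℝ) := by exact_mod_cast h2
    _ = (Fintype.card (FreqIdx q J) : ℝ) * (9 * N * R) := by push_cast; ring
    _ ≤ (24576 * q * J ^ 2) * (9 * N * R) := by
        have := card_freqIdx_le q J
        gcongr
    _ = _ := by ring

end Resources

lemma re_quadrature (b : Bool) (x : ℝ) :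
    (star (quadrature b) * Complex.exp (-(Complex.I * x))).re =
      if b then Real.cos x else Real.sin x := by
  rw [show -(Complex.I * (x : ℂ)) = ((-x : ℝ) : ℂ) * Complex.I by push_cast; ring]
  cases b
  · simp [quadrature, Complex.exp_ofReal_mul_I_im, Complex.exp_ofReal_mul_I_re, -Complex.ofReal_neg]
  · simp [quadrature, Complex.exp_ofReal_mul_I_re, -Complex.ofReal_neg]

/-- The frequency estimation protocol reaches the Heisenberg limit for every frequency. -/
lemma freqExp_error {L : Fin q → Layout (Mode N A) N} {B K : ℝ} (hB : 0 < B) (hK : 0 ≤ K)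
    {J R : ℕ} (hR : 64 * (K + B ^ 2) * (2 ^ J / B) ^ 2 ≤ R)
    {H : Op (Mode N A)} {lam : Fin q → Fin N → ℝ} (hL : ∀ s, (L s).Probes H (lam s) K)
    (hlam : ∀ s i, |lam s i| ≤ B)
    {n : Fin (Fintype.card (FreqIdx q J)) → Spam (Mode N A)}
    (hH : Hᴴ = H)
    (hn : ∀ e, (n e).IsBounded (freqExp L B J R ((freqPos q J).symm e)).prep (1 / 10 ^ 6)) :
    IsProbFamily (fun e y => (freqExp L B J R ((freqPos q J).symm e)).prob H (n e) y) ∧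
    ∀ s i, prodExpect (fun e y => (freqExp L B J R ((freqPos q J).symm e)).prob H (n e) y)
      (fun r => (freqValue L B J r s i - lam s i) ^ 2) ≤ 13 * (B / 2 ^ J) ^ 2 := by
  have hprob : IsProbFamily (fun e y => (freqExp L B J R ((freqPos q J).symm e)).prob H (n e) y) :=
    ⟨fun e y => (freqExp L B J R ((freqPos q J).symm e)).prob_nonneg H (hn e) y, fun e => (freqExp L B J R ((freqPos q J).symm e)).sum_prob hH (hn e)⟩
  refine ⟨hprob, fun s i => ?_⟩
  -- The B² part of the lower bound on R; it guarantees `lam` · τ ≤ 1.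
  have hR1 : 64 * 4 ^ J ≤ (R : ℝ) := by
    refine le_trans ?_ hR
    have e : 64 * (K + B ^ 2) * (2 ^ J / B) ^ 2 = 64 * K * (2 ^ J / B) ^ 2 + 64 * 4 ^ J := by
      have : (4 : ℝ) ^ J = (2 ^ J) ^ 2 := by rw [← pow_mul, mul_comm, pow_mul]; norm_num
      rw [this]; field_simp
    rw [e]
    have : 0 ≤ 64 * K * (2 ^ J / B) ^ 2 := by positivity
    linarith
  have hRpos' : (0 : ℝ) < R := lt_of_lt_of_le (by positivity) hR1
  have hRpos : 0 < R := by exact_mod_cast hRpos'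
  apply prodExpect_sq_freqEst_le hprob hB (hlam s i) (fun r => freqPhase L J r s i) J
  intro j hj
  set m : ℕ := 12288 * (J - j) with hm
  have hmpos : 0 < m := by omega
  set t : ℝ := 2 ^ j / B with ht
  have htt : t ≤ 2 ^ J / B := by
    rw [ht]; gcongr; norm_num
  have htpos : 0 < t := by positivity
  have hτ := mul_freqStep hB hRpos j
  rw [← ht] at hτ
  -- the repetitions of one measurement
  let emb : Bool → Fin m ↪ Fin (Fintype.card (FreqIdx q J)) := fun b =>
    ⟨fun k => freqPos q J ⟨s, ⟨j, hj⟩, b, k⟩, fun k k' h => by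
      have := (freqPos q J).injective h
      simpa using this⟩
  let T : Bool → Finset (Fin (Fintype.card (FreqIdx q J))) := fun b => Finset.univ.map (emb b)
  have hTc : ∀ b, (T b).card = m := fun b => by simp [T]
  have hmean : ∀ b, ∀ e ∈ T b,
      |∑ y, (freqExp L B J R ((freqPos q J).symm e)).prob H (n e) y * (L s).obs i y -
        (if b then Real.cos (lam s i * t) else Real.sin (lam s i * t))| ≤ 1 / 16 := by
    intro b e he
    obtain ⟨k, -, rfl⟩ := Finset.mem_map.mp he
    set x : FreqIdx q J := ⟨s, ⟨j, hj⟩, b, k⟩ with hx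
    have hexp : freqExp L B J R ((freqPos q J).symm (emb b k)) = (L s).experiment (quadrature b) (freqStep B R j) R := by
      change freqExp L B J R ((freqPos q J).symm (freqPos q J x)) = _
      rw [Equiv.symm_apply_apply]; rfl
    have hb := hn (emb b k)
    rw [hexp] at hb ⊢
    have hlamτ : |lam s i| * freqStep B R j ≤ 1 := by
      have h1 : (freqStep B R j : ℝ) = t / R := by
        rw [eq_div_iff hRpos'.ne', mul_comm]; exact hτ
      rw [h1, ← mul_div_assoc, div_le_one hRpos']
      calc |lam s i| * t ≤ B * (2 ^ J / B) := by
            have := hlam s i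
            gcongr
        _ = 2 ^ J := by field_simp
        _ ≤ 64 * 4 ^ J := by
            have : (2 : ℝ) ^ J ≤ 4 ^ J := by gcongr; norm_num
            have : (0 : ℝ) < 4 ^ J := by positivity
            linarith
        _ ≤ R := hR1
    -- With δ = 10⁻⁶ and weight s = 200, preparation and readout errors contribute less than 0.012;
    -- the averaging error below is at most 1/32, and the sum stays under 1/16.
    have h2 := (hL s).abs_mean_sub_le i (star_quadrature_mul b) (freqStep B R j) R hlamτ
      (by norm_num) hb (s := 200) (by norm_num)
    have e1 : Complex.exp (-(Complex.I * (lam s i : ℂ) * ((R : ℂ) * ((freqStep B R j : ℝ) : ℂ)))) =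
        Complex.exp (-(Complex.I * ((lam s i * t : ℝ) : ℂ))) := by
      congr 1
      rw [← hτ]; push_cast; ring
    rw [e1, re_quadrature] at h2
    refine h2.trans ?_
    -- R cycles of length t/R have total second order error proportional to t²/R, and R was chosen
    -- for the longest time t.
    have h3 : 2 * ((R : ℝ) * ((K + lam s i ^ 2) * (freqStep B R j : ℝ) ^ 2)) ≤ 1 / 32 := by
      have h1 : (freqStep B R j : ℝ) = t / R := by
        rw [eq_div_iff hRpos'.ne', mul_comm]; exact hτ
      rw [h1]
      have e2 : 2 * ((R : ℝ) * ((K + lam s i ^ 2) * (t / R) ^ 2)) =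
          2 * ((K + lam s i ^ 2) * t ^ 2) / R := by
        field_simp
      rw [e2, div_le_iff₀ hRpos']
      have h4 : lam s i ^ 2 ≤ B ^ 2 := by
        rw [← sq_abs]; exact pow_le_pow_left₀ (abs_nonneg _) (hlam s i) 2
      have h5 : (K + lam s i ^ 2) * t ^ 2 ≤ (K + B ^ 2) * (2 ^ J / B) ^ 2 := by
        gcongr
      linarith
    norm_num at h3 ⊢
    linarith
  have hdev : ∀ b : Bool, prodExpect (fun e y => (freqExp L B J R ((freqPos q J).symm e)).prob H (n e) y) (fun r =>
      if |(∑ e ∈ T b, (L s).obs i (r e)) / (T b).card -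
        (if b then Real.cos (lam s i * t) else Real.sin (lam s i * t))| ≤ 1 / 16 + 1 / 16 then 0 else 1) ≤
      2 * (1 / 16) ^ (J - j) := by
    intro b
    refine (prodExpect_deviation_le hprob (g := fun _ y => (L s).obs i y)
      (fun _ y => (L s).abs_obs_le i y) (by rw [hTc]; exact hmpos) (by norm_num) (by norm_num)
      (hmean b)).trans ?_
    refine mul_le_mul_of_nonneg_left ?_ (by norm_num)
    -- Here a = 1/16, so a²/16 = 1/4096, and 12288 = 3·4096 repetitions per unit of J - j give the
    -- exponent -3(J - j).
    refine le_trans (le_of_eq ?_) (exp_neg_three_mul_le (J - j))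
    rw [hTc, hm]; congr 1; push_cast; ring
  -- Each quadrature is accurate to 1/16 + 1/16 = 1/8 unless it fails, so the complex phase is
  -- accurate to 1/4 unless one of the two fails.
  have hcomb : ∀ r : Fin (Fintype.card (FreqIdx q J)) → Finset (Mode N A),
      (if ‖freqPhase L J r s i j - Complex.exp (Complex.I * (lam s i * (2 ^ j / B) : ℝ))‖ ≤ 1 / 4
        then (0 : ℝ) else 1) ≤
      (if |(∑ e ∈ T true, (L s).obs i (r e)) / (T true).card - Real.cos (lam s i * t)| ≤ 1 / 16 + 1 / 16
        then 0 else 1) +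
      (if |(∑ e ∈ T false, (L s).obs i (r e)) / (T false).card - Real.sin (lam s i * t)| ≤ 1 / 16 + 1 / 16
        then 0 else 1) := by
    intro r
    have havg : ∀ b, freqAvg L J r s i ⟨j, hj⟩ b = (∑ e ∈ T b, (L s).obs i (r e)) / (T b).card := by
      intro b
      rw [hTc, Finset.sum_map]
      rfl
    by_cases h1 : |(∑ e ∈ T true, (L s).obs i (r e)) / (T true).card - Real.cos (lam s i * t)| ≤
        1 / 16 + 1 / 16
    · by_cases h2 : |(∑ e ∈ T false, (L s).obs i (r e)) / (T false).card - Real.sin (lam s i * t)| ≤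
        1 / 16 + 1 / 16
      · rw [if_pos]
        · rw [if_pos h1, if_pos h2]; norm_num
        · rw [← havg] at h1 h2
          rw [freqPhase, dif_pos hj, ← ht]
          refine (Complex.norm_le_abs_re_add_abs_im _).trans ?_
          rw [mul_comm Complex.I ((lam s i * t : ℝ) : ℂ)]
          simp only [Complex.sub_re, Complex.sub_im, Complex.add_re, Complex.add_im,
            Complex.exp_ofReal_mul_I_re, Complex.exp_ofReal_mul_I_im, Complex.ofReal_re,
            Complex.ofReal_im, Complex.I_mul_re, Complex.I_mul_im, neg_zero, add_zero, zero_add]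
          linarith
      · rw [if_neg h2]
        split_ifs <;> norm_num
    · rw [if_neg h1]
      split_ifs <;> norm_num
  refine (prodExpect_mono hprob hcomb).trans ?_
  rw [prodExpect_add]
  have := hdev true
  have := hdev false
  simp only [if_true, Bool.false_eq_true, if_false] at *
  linarith

end FrequencyProtocol

end Hubbard

namespace Hubbard

open scoped Matrix.Norms.L2Operator

/-! ### Double commutators of sums of local terms. -/

section DoubleCommutator

variable {M : Type} [Fintype M] [LinearOrder M]

lemma norm_commutator_le (X Y : Op M) : ‖X * Y - Y * X‖ ≤ 2 * ‖X‖ * ‖Y‖ :=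
  calc _ ≤ ‖X * Y‖ + ‖Y * X‖ := norm_sub_le _ _
    _ ≤ ‖X‖ * ‖Y‖ + ‖Y‖ * ‖X‖ := add_le_add (norm_mul_le _ _) (norm_mul_le _ _)
    _ = _ := by ring

lemma sum_commutator {ι : Type*} [Fintype ι] {f : ι → Op M} {X : Op M} {s : Finset ι}
    (h : ∀ k, k ∉ s → Commute (f k) X) :
    (∑ k, f k) * X - X * ∑ k, f k = ∑ k ∈ s, (f k * X - X * f k) := by
  rw [Finset.sum_mul, Finset.mul_sum, ← Finset.sum_sub_distrib]
  symm
  apply Finset.sum_subset (Finset.subset_univ s)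
  intro k _ hk
  rw [(h k hk).eq, sub_self]

/-- The double commutator of a sum of local terms with a local operator is bounded in terms of the
number of terms that do not commute. -/
lemma norm_double_commutator_le {ι : Type*} [Fintype ι] {f : ι → Op M} {X : Op M} {s : Finset ι}
    {t : ι → Finset ι} {c : ℝ} {p q : ℕ} (hc : 0 ≤ c) (hf : ∀ k, ‖f k‖ ≤ c) (hX : ‖X‖ ≤ 1)
    (hs : s.card ≤ p) (ht : ∀ k, (t k).card ≤ q)
    (h1 : ∀ k, k ∉ s → Commute (f k) X)
    (h2 : ∀ k l, l ∉ t k → Commute (f l) (f k * X - X * f k)) :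
    ‖(∑ k, f k) * ((∑ k, f k) * X - X * ∑ k, f k) -
      ((∑ k, f k) * X - X * ∑ k, f k) * ∑ k, f k‖ ≤ p * q * (2 * c) ^ 2 := by
  rw [sum_commutator h1, Finset.mul_sum, Finset.sum_mul, ← Finset.sum_sub_distrib]
  calc _ ≤ ∑ k ∈ s, ‖(∑ l, f l) * (f k * X - X * f k) - (f k * X - X * f k) * ∑ l, f l‖ :=
        norm_sum_le _ _
    _ ≤ ∑ _k ∈ s, q * (2 * c) ^ 2 := by
        refine Finset.sum_le_sum fun k _ => ?_
        rw [sum_commutator (h2 k)]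
        calc _ ≤ ∑ l ∈ t k, ‖f l * (f k * X - X * f k) - (f k * X - X * f k) * f l‖ :=
              norm_sum_le _ _
          _ ≤ ∑ _l ∈ t k, (2 * c) ^ 2 := by
              refine Finset.sum_le_sum fun l _ => ?_
              calc _ ≤ 2 * ‖f l‖ * ‖f k * X - X * f k‖ := norm_commutator_le _ _
                _ ≤ 2 * c * (2 * c * 1) := by
                    have h3 : ‖f k * X - X * f k‖ ≤ 2 * c * 1 :=
                      (norm_commutator_le _ _).trans (by gcongr; exact hf k)
                    gcongr
                    exact hf l
                _ = _ := by ring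
          _ = (t k).card * (2 * c) ^ 2 := by rw [Finset.sum_const, nsmul_eq_mul]
          _ ≤ _ := by
              gcongr; exact_mod_cast ht k
    _ = s.card * (q * (2 * c) ^ 2) := by rw [Finset.sum_const, nsmul_eq_mul]
    _ ≤ p * (q * (2 * c) ^ 2) := by
        gcongr
    _ = _ := by ring

end DoubleCommutator

/-! ### Locality of the Hubbard Hamiltonian. -/

section Terms

variable {N : ℕ} {G : SimpleGraph (Fin N)} (c : Coeffs G) (A : ℕ)

lemma sysMode_injective {i j : Fin N} {σ τ : Spin} (h : sysMode A i σ = sysMode A j τ) :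
    i = j ∧ σ = τ := by
  have h1 := Sum.inl.inj (toLex.injective h)
  have h2 := Prod.ext_iff.mp (toLex.injective h1)
  exact ⟨h2.1, h2.2⟩

lemma sysMode_inj {i j : Fin N} {σ τ : Spin} : sysMode A i σ = sysMode A j τ ↔ i = j ∧ σ = τ :=
  ⟨sysMode_injective A, by rintro ⟨rfl, rfl⟩; rfl⟩

/-- The terms of the Hamiltonian that belong to a site. -/
def Coeffs.siteTerm (k : Fin N) : Op (Mode N A) :=
  (∑ j, ∑ σ, c.h k j σ • (cre (sysMode A k σ) * ann (sysMode A j σ)))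
    + (∑ σ, (c.ω k σ : ℂ) • num (sysMode A k σ))
    + (c.ξ k : ℂ) • (num (sysMode A k 0) * num (sysMode A k 1))

lemma Coeffs.hamiltonian_eq_sum : c.hamiltonian A = ∑ k, c.siteTerm A k := by
  simp only [hamiltonian, siteTerm, Finset.sum_add_distrib]

lemma num_mul_num_comm {M : Type} [Fintype M] [LinearOrder M] (a b : M) :
    num a * num b = num b * num a := by
  rw [num_eq_diagonal, num_eq_diagonal, Matrix.diagonal_mul_diagonal, Matrix.diagonal_mul_diagonal]
  congr 1; ext S; exact mul_comm _ _

lemma Coeffs.hamiltonian_conjTranspose : (c.hamiltonian A)ᴴ = c.hamiltonian A := by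
  have h1 : (∑ i, ∑ j, ∑ σ, c.h i j σ • (cre (sysMode A i σ) * ann (sysMode A j σ)))ᴴ =
      ∑ i, ∑ j, ∑ σ, c.h i j σ • (cre (sysMode A i σ) * ann (sysMode A j σ)) := by
    rw [Matrix.conjTranspose_sum, Finset.sum_comm]
    refine Finset.sum_congr rfl fun i _ => ?_
    rw [Matrix.conjTranspose_sum]
    refine Finset.sum_congr rfl fun j _ => ?_
    rw [Matrix.conjTranspose_sum]
    refine Finset.sum_congr rfl fun σ _ => ?_
    rw [Matrix.conjTranspose_smul, Matrix.conjTranspose_mul, cre_conjTranspose, ann_conjTranspose,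
      c.h_conj]
  have h2 : (∑ i, ∑ σ, (c.ω i σ : ℂ) • num (sysMode A i σ))ᴴ =
      ∑ i, ∑ σ, (c.ω i σ : ℂ) • num (sysMode A i σ) := by
    rw [Matrix.conjTranspose_sum]
    refine Finset.sum_congr rfl fun i _ => ?_
    rw [Matrix.conjTranspose_sum]
    refine Finset.sum_congr rfl fun σ _ => ?_
    rw [Matrix.conjTranspose_smul, num_conjTranspose, RCLike.star_def, Complex.conj_ofReal]
  have h3 : (∑ i, (c.ξ i : ℂ) • (num (sysMode A i 0) * num (sysMode A i 1)))ᴴ =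
      ∑ i, (c.ξ i : ℂ) • (num (sysMode A i 0) * num (sysMode A i 1)) := by
    rw [Matrix.conjTranspose_sum]
    refine Finset.sum_congr rfl fun i _ => ?_
    rw [Matrix.conjTranspose_smul, Matrix.conjTranspose_mul, num_conjTranspose, num_conjTranspose,
      num_mul_num_comm, RCLike.star_def, Complex.conj_ofReal]
  rw [hamiltonian, Matrix.conjTranspose_add, Matrix.conjTranspose_add, h1, h2, h3]

open Classical in
/-- A site and its neighbours. -/
def nbhd (G : SimpleGraph (Fin N)) (k : Fin N) : Finset (Fin N) :=
  insert k (Finset.univ.filter fun j => G.Adj k j)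

lemma mem_nbhd {k j : Fin N} : j ∈ nbhd G k ↔ j = k ∨ G.Adj k j := by
  classical
  simp [nbhd]

lemma mem_nbhd_comm {k j : Fin N} : j ∈ nbhd G k ↔ k ∈ nbhd G j := by
  rw [mem_nbhd, mem_nbhd, G.adj_comm, eq_comm]

open Classical in
lemma card_filter_adj {D : ℕ} (hD : ∀ v, (G.neighborSet v).ncard ≤ D) (k : Fin N) :
    (Finset.univ.filter fun j => G.Adj k j).card ≤ D := by
  rw [← Set.ncard_coe_finset]
  refine le_trans (le_of_eq ?_) (hD k)
  congr 1
  ext j; simp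

lemma card_nbhd {D : ℕ} (hD : ∀ v, (G.neighborSet v).ncard ≤ D) (k : Fin N) :
    (nbhd G k).card ≤ D + 1 := by
  classical
  exact (Finset.card_insert_le _ _).trans (Nat.succ_le_succ (card_filter_adj hD k))

lemma card_biUnion_nbhd {D : ℕ} (hD : ∀ v, (G.neighborSet v).ncard ≤ D) (T : Finset (Fin N)) :
    (T.biUnion (nbhd G)).card ≤ T.card * (D + 1) :=
  Finset.card_biUnion_le_card_mul _ _ _ fun k _ => card_nbhd hD k

variable {c A}

lemma Coeffs.siteTerm_avoids {k j : Fin N} (hj : j ∉ nbhd G k) (τ : Spin) :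
    Avoids (c.siteTerm A k) (sysMode A j τ) := by
  rw [mem_nbhd, not_or] at hj
  have hne : ∀ {i : Fin N} (σ : Spin), j ≠ i → sysMode A i σ ≠ sysMode A j τ :=
    fun σ h h' => h (sysMode_injective A h').1.symm
  refine ((Avoids.sum fun i _ => Avoids.sum fun σ _ => ?_).add (Avoids.sum fun σ _ =>
    (Avoids.num (hne σ hj.1)).smul _)).add
    (((Avoids.num (hne 0 hj.1)).mul (Avoids.num (hne 1 hj.1))).smul _)
  by_cases h : G.Adj k i
  · exact (Avoids.cre_ann (hne σ hj.1) (hne σ fun h' => hj.2 (h' ▸ h))).smul _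
  · rw [c.h_supp k i σ h, zero_smul]; exact Avoids.zero

lemma Coeffs.siteTerm_commute {k : Fin N} {X : Op (Mode N A)}
    (h : ∀ j ∈ nbhd G k, ∀ τ, Avoids X (sysMode A j τ)) : Commute (c.siteTerm A k) X := by
  have hk := h k (mem_nbhd.mpr (Or.inl rfl))
  refine Commute.symm (((Commute.sum_right _ _ _ fun i _ => Commute.sum_right _ _ _ fun σ _ =>
    ?_).add_right (Commute.sum_right _ _ _ fun σ _ => (hk σ).commute_num.smul_right _)).add_right
    (((hk 0).commute_num.mul_right (hk 1).commute_num).smul_right _))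
  by_cases hi : G.Adj k i
  · exact (((hk σ).2.mul_right (h i (mem_nbhd.mpr (Or.inr hi)) σ).1)).smul_right _
  · rw [c.h_supp k i σ hi, zero_smul]; exact Commute.zero_right _

lemma Coeffs.norm_siteTerm_le {D : ℕ} (hD : ∀ v, (G.neighborSet v).ncard ≤ D) {Λ : ℝ}
    (hc : c.BoundedBy Λ) (k : Fin N) : ‖c.siteTerm A k‖ ≤ (2 * D + 3) * Λ := by
  classical
  have hΛ : 0 ≤ Λ := (abs_nonneg _).trans (hc.ξ k)
  have h1 : ‖∑ j, ∑ σ, c.h k j σ • (cre (sysMode A k σ) * ann (sysMode A j σ))‖ ≤ D * (2 * Λ) := by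
    rw [← Finset.sum_subset (Finset.subset_univ (Finset.univ.filter fun j => G.Adj k j))]
    · calc _ ≤ ∑ j ∈ Finset.univ.filter (fun j => G.Adj k j),
            ‖∑ σ, c.h k j σ • (cre (sysMode A k σ) * ann (sysMode A j σ))‖ := norm_sum_le _ _
        _ ≤ ∑ _j ∈ Finset.univ.filter (fun j => G.Adj k j), 2 * Λ := by
            refine Finset.sum_le_sum fun j _ => ?_
            calc _ ≤ ∑ σ : Spin, ‖c.h k j σ • (cre (sysMode A k σ) * ann (sysMode A j σ))‖ :=
                  norm_sum_le _ _
              _ ≤ ∑ _σ : Spin, Λ := by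
                  refine Finset.sum_le_sum fun σ _ => ?_
                  rw [norm_smul]
                  calc _ ≤ Λ * (1 * 1) := by
                        gcongr
                        · exact hc.h k j σ
                        · refine (norm_mul_le _ _).trans ?_
                          gcongr
                          · exact norm_cre_le _
                          · exact norm_ann_le _
                    _ = Λ := by ring
              _ = 2 * Λ := by simp
        _ ≤ _ := by
            rw [Finset.sum_const, nsmul_eq_mul]
            have : ((Finset.univ.filter fun j => G.Adj k j).card : ℝ) ≤ D := by
              exact_mod_cast card_filter_adj hD k
            gcongr
    · intro j _ hj
      apply Finset.sum_eq_zero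
      intro σ _
      rw [c.h_supp k j σ (by simpa using hj), zero_smul]
  have h2 : ‖∑ σ : Spin, (c.ω k σ : ℂ) • num (sysMode A k σ)‖ ≤ 2 * Λ := by
    calc _ ≤ ∑ σ : Spin, ‖(c.ω k σ : ℂ) • num (sysMode A k σ)‖ := norm_sum_le _ _
      _ ≤ ∑ _σ : Spin, Λ := by
          refine Finset.sum_le_sum fun σ _ => ?_
          rw [norm_smul, Complex.norm_real, Real.norm_eq_abs]
          calc _ ≤ Λ * 1 := by
                gcongr
                · exact hc.ω k σ
                · exact norm_num_le _
            _ = Λ := mul_one _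
      _ = 2 * Λ := by simp
  have h3 : ‖(c.ξ k : ℂ) • (num (sysMode A k 0) * num (sysMode A k 1))‖ ≤ Λ := by
    rw [norm_smul, Complex.norm_real, Real.norm_eq_abs]
    calc _ ≤ Λ * (1 * 1) := by
          gcongr
          · exact hc.ξ k
          · refine (norm_mul_le _ _).trans ?_
            gcongr <;> exact norm_num_le _
      _ = Λ := by ring
  refine (norm_add_le _ _).trans ?_
  have := norm_add_le (∑ j, ∑ σ, c.h k j σ • (cre (sysMode A k σ) * ann (sysMode A j σ)))
    (∑ σ, (c.ω k σ : ℂ) • num (sysMode A k σ))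
  linarith

/-- A bound for the double commutator of the Hamiltonian with an operator on two sites. -/
def commutatorBound (D : ℕ) (Λ : ℝ) : ℝ :=
  ((2 * (D + 1) : ℕ) : ℝ) * (((D + 3) * (D + 1) : ℕ) : ℝ) * (2 * ((2 * D + 3) * Λ)) ^ 2

lemma commutatorBound_nonneg (D : ℕ) (Λ : ℝ) : 0 ≤ commutatorBound D Λ := by
  unfold commutatorBound; positivity

lemma Coeffs.norm_double_commutator_le {D : ℕ} (hD : ∀ v, (G.neighborSet v).ncard ≤ D) {Λ : ℝ}
    (hc : c.BoundedBy Λ) (hΛ : 0 ≤ Λ) {X : Op (Mode N A)} {T : Finset (Fin N)} (hT : T.card ≤ 2)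
    (hX : ‖X‖ ≤ 1) (hXT : ∀ j, j ∉ T → ∀ τ, Avoids X (sysMode A j τ)) :
    ‖c.hamiltonian A * (c.hamiltonian A * X - X * c.hamiltonian A) -
      (c.hamiltonian A * X - X * c.hamiltonian A) * c.hamiltonian A‖ ≤ commutatorBound D Λ := by
  have hcomm : ∀ {Y : Op (Mode N A)} {U : Finset (Fin N)},
      (∀ j, j ∉ U → ∀ τ, Avoids Y (sysMode A j τ)) → ∀ k, k ∉ U.biUnion (nbhd G) →
        Commute (c.siteTerm A k) Y := by
    intro Y U hY k hk
    refine siteTerm_commute fun j hj τ => hY j (fun hjU => hk ?_) τ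
    exact Finset.mem_biUnion.mpr ⟨j, hjU, mem_nbhd_comm.mp hj⟩
  rw [hamiltonian_eq_sum]
  -- A site term can act nontrivially only on its closed neighbourhood. Hence only the neighbours of
  -- T contribute to [H, X], and the commutator with the term at k lives on T and the neighbourhood
  -- of k, at most D + 3 sites.
  refine Hubbard.norm_double_commutator_le (s := T.biUnion (nbhd G))
    (t := fun k => (T ∪ nbhd G k).biUnion (nbhd G)) (by positivity)
    (fun k => norm_siteTerm_le hD hc k) hX ?_ ?_ (hcomm hXT) ?_
  · exact (card_biUnion_nbhd hD T).trans (Nat.mul_le_mul_right _ hT)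
  · intro k
    refine (card_biUnion_nbhd hD _).trans (Nat.mul_le_mul_right _ ?_)
    refine (Finset.card_union_le _ _).trans ?_
    have := card_nbhd hD k
    omega
  · intro k l hl
    refine hcomm (U := T ∪ nbhd G k) (fun j hj τ => ?_) l hl
    rw [Finset.mem_union, not_or] at hj
    have h1 := hXT j hj.1 τ
    have h2 := siteTerm_avoids (c := c) (A := A) hj.2 τ
    exact (h2.mul h1).sub (h1.mul h2)

end Terms

end Hubbard

namespace Hubbard

open scoped Matrix.Norms.L2Operator

/-! ### Diagonal parts and supports after a linear mixing of modes. -/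

section Diagonal

variable {M : Type} [Fintype M] [LinearOrder M]

/-- The occupation number of a mode. -/
def occ (S : Finset M) (m : M) : ℂ := if m ∈ S then 1 else 0

lemma cre_mul_ann_apply_self (a b : M) (S : Finset M) :
    (cre a * ann b) S S = if a = b then occ S a else 0 := by
  by_cases h : a = b
  · subst h
    rw [if_pos rfl]
    change num a S S = _
    rw [num_eq_diagonal, Matrix.diagonal_apply_eq, occ]
  · rw [if_neg h, mul_ann_apply]
    split_ifs with hb
    · have : cre a S (S.erase b) = 0 := by
        rw [cre, Matrix.conjTranspose_apply, ann, if_neg, star_zero]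
        rintro ⟨ha, h1⟩
        have : b ∈ S.erase a := Finset.mem_erase.mpr ⟨Ne.symm h, hb⟩
        rw [← h1] at this
        exact Finset.notMem_erase b S this
      rw [this, mul_zero]
    · rfl

lemma conj_mul_of_mem_unitary {F : Op M} (hF : F ∈ unitary (Op M)) (X Y : Op M) :
    Fᴴ * (X * Y) * F = (Fᴴ * X * F) * (Fᴴ * Y * F) := by
  have h := (Unitary.mem_iff.mp hF).2
  rw [Matrix.star_eq_conjTranspose] at h
  calc Fᴴ * (X * Y) * F = Fᴴ * X * 1 * Y * F := by simp only [mul_assoc, mul_one]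
    _ = _ := by rw [← h]; simp only [mul_assoc]

/-- The diagonal part of a hopping term in a frame in which the modes are mixed linearly. -/
lemma conj_cre_mul_ann_apply_self {F : Op M} (hF : F ∈ unitary (Op M)) {ι : Type} [Fintype ι]
    [DecidableEq ι] {g : ι → M} (hg : Function.Injective g) {a b : M} {u v : ι → ℂ}
    (ha : Fᴴ * ann a * F = ∑ m, u m • ann (g m)) (hb : Fᴴ * ann b * F = ∑ m, v m • ann (g m))
    (S : Finset M) :
    (Fᴴ * (cre a * ann b) * F) S S = ∑ m, star (u m) * v m * occ S (g m) := by
  have hc : Fᴴ * cre a * F = ∑ m, star (u m) • cre (g m) := by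
    have := congrArg Matrix.conjTranspose ha
    rw [Matrix.conjTranspose_mul, Matrix.conjTranspose_mul, Matrix.conjTranspose_conjTranspose,
      ann_conjTranspose, Matrix.conjTranspose_sum, ← mul_assoc] at this
    rw [this]
    exact Finset.sum_congr rfl fun m _ => Matrix.conjTranspose_smul _ _
  rw [conj_mul_of_mem_unitary hF, hc, hb, Finset.sum_mul_sum, Matrix.sum_apply]
  refine Finset.sum_congr rfl fun m _ => ?_
  -- A hop between different modes changes the configuration and has no diagonal entry, so only
  -- equal indices survive in the double sum.
  rw [Matrix.sum_apply, Finset.sum_eq_single m]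
  · rw [smul_mul_smul_comm, Matrix.smul_apply, cre_mul_ann_apply_self, if_pos rfl, smul_eq_mul]
  · intro k _ hk
    rw [smul_mul_smul_comm, Matrix.smul_apply, cre_mul_ann_apply_self,
      if_neg (fun h => hk (hg h).symm), smul_zero]
  · simp

/-- An operator is moved by a frame change to one that avoids a mode, if it commutes with the
image of the mode. -/
lemma avoids_conj_of_ann_eq {F : Op M} (hF : F ∈ unitary (Op M)) {ι : Type} [Fintype ι]
    {g : ι → M} {a : M} {u : ι → ℂ} (ha : Fᴴ * ann a * F = ∑ m, u m • ann (g m)) {X : Op M}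
    (hX : ∀ m, u m ≠ 0 → Avoids X (g m)) : Avoids (F * X * Fᴴ) a := by
  have h1 := (Unitary.mem_iff.mp hF).1
  have h2 := (Unitary.mem_iff.mp hF).2
  rw [Matrix.star_eq_conjTranspose] at h1 h2
  have key : ∀ Y : Op M, Commute X (Fᴴ * Y * F) → Commute (F * X * Fᴴ) Y := by
    intro Y h
    have e1 : F * X * Fᴴ * Y = F * (X * (Fᴴ * Y * F)) * Fᴴ := by
      calc _ = F * X * Fᴴ * Y * 1 := (mul_one _).symm
        _ = _ := by rw [← h2]; simp only [mul_assoc]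
    have e2 : Y * (F * X * Fᴴ) = F * ((Fᴴ * Y * F) * X) * Fᴴ := by
      calc _ = 1 * (Y * (F * X * Fᴴ)) := (one_mul _).symm
        _ = _ := by rw [← h2]; simp only [mul_assoc]
    rw [Commute, SemiconjBy, e1, e2, h.eq]
  have hc : Fᴴ * cre a * F = ∑ m, star (u m) • cre (g m) := by
    have := congrArg Matrix.conjTranspose ha
    rw [Matrix.conjTranspose_mul, Matrix.conjTranspose_mul, Matrix.conjTranspose_conjTranspose,
      ann_conjTranspose, Matrix.conjTranspose_sum, ← mul_assoc] at this
    rw [this]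
    exact Finset.sum_congr rfl fun m _ => Matrix.conjTranspose_smul _ _
  constructor
  · apply key
    rw [ha]
    refine Commute.sum_right _ _ _ fun m _ => ?_
    by_cases h : u m = 0
    · rw [h, zero_smul]; exact Commute.zero_right _
    · exact (hX m h).1.smul_right _
  · apply key
    rw [hc]
    refine Commute.sum_right _ _ _ fun m _ => ?_
    by_cases h : u m = 0
    · rw [h, star_zero, zero_smul]; exact Commute.zero_right _
    · exact (hX m h).2.smul_right _

end Diagonal

/-! ### The concrete layouts. -/

section Instances

variable {N : ℕ}

/-- The ancilla modes. -/
def ancMode (N : ℕ) {A : ℕ} (i : Fin A) : Mode N A := Sum.inrₗ i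

lemma sysMode_ne_ancMode {A : ℕ} (i : Fin N) (σ : Spin) (j : Fin A) :
    sysMode A i σ ≠ ancMode N j := by
  intro h
  have := toLex.injective h
  exact Sum.inl_ne_inr this

lemma ancMode_injective {A : ℕ} : Function.Injective (ancMode N : Fin A → Mode N A) := by
  intro i j h
  exact Sum.inr.inj (toLex.injective h)

/-- A mode that is different from the given one. -/
def spectator (m : Mode N N) : Mode N N :=
  match ofLex m with
  | Sum.inl x => ancMode N (ofLex x).1
  | Sum.inr i => sysMode N i 0

lemma ne_spectator (m : Mode N N) : m ≠ spectator m := by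
  unfold spectator
  rcases h : ofLex m with x | i
  · intro h'
    have := congrArg ofLex h'
    rw [h] at this
    exact Sum.inl_ne_inr this
  · intro h'
    have := congrArg ofLex h'
    rw [h] at this
    exact Sum.inr_ne_inl this

/-- The gates that mix the modes of spin `σ` of the sites `i` and `p i`. -/
def mixGate (σ : Spin) (p : Fin N → Fin N) (η : ℂ) (i : Fin N) : FLO (Mode N N) :=
  -- Each matched pair is mixed once, by the gate indexed by its smaller site; the other indices
  -- carry trivial gates.
  if h : i < p i then
    hopGate (sysMode N i σ) (sysMode N (p i) σ) (fun h' => h.ne (sysMode_injective N h').1) η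
  else idGate (sysMode N i σ) (ancMode N i) (sysMode_ne_ancMode i σ i)

lemma spin_sub_ne (σ : Spin) : 1 - σ ≠ σ := by fin_cases σ <;> decide

lemma eq_spin_sub {σ τ : Spin} (h : τ ≠ σ) : τ = 1 - σ := by
  fin_cases σ <;> fin_cases τ <;> first | rfl | exact absurd rfl h

/-- The layout that probes the modes of spin `σ`, after mixing the sites `i` and `p i`. -/
def mixLayout (σ : Spin) (p : Fin N → Fin N) (η : ℂ) : Layout (Mode N N) N where
  a := fun i => sysMode N i σ
  -- The ancilla has no energy, so the frequency of the pair is the energy of the mixed system mode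
  -- alone.
  b := fun i => ancMode N i
  ne := fun i => sysMode_ne_ancMode i σ i
  disj := fun i j h => by
    rw [Finset.disjoint_left]
    intro m hm hm'
    simp only [Finset.mem_insert, Finset.mem_singleton] at hm hm'
    rcases hm with rfl | rfl
    · rcases hm' with h' | h'
      · exact h (sysMode_injective N h').1
      · exact sysMode_ne_ancMode _ _ _ h'
    · rcases hm' with h' | h'
      · exact sysMode_ne_ancMode _ _ _ h'.symm
      · exact h (ancMode_injective h')
  -- With the opposite spin absent at both mixed sites, the interaction does not shift the energy of
  -- the probed mode.
  z := fun i => {sysMode N i (1 - σ), sysMode N (p i) (1 - σ)}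
  zdisj := fun i j => by
    rw [Finset.disjoint_left]
    intro m hm hm'
    simp only [Finset.mem_insert, Finset.mem_singleton] at hm hm'
    rcases hm with rfl | rfl <;> rcases hm' with h' | h'
    · exact spin_sub_ne σ (sysMode_injective N h').2
    · exact sysMode_ne_ancMode _ _ _ h'
    · exact spin_sub_ne σ (sysMode_injective N h').2
    · exact sysMode_ne_ancMode _ _ _ h'
  zcard := fun i => Finset.card_le_two
  frame := (List.finRange N).map (mixGate σ p η)
  w := spectator
  hw := ne_spectator

/-- The layout that probes the pairs of modes of the sites. -/
def siteLayout (N : ℕ) : Layout (Mode N N) N where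
  a := fun i => sysMode N i 0
  b := fun i => sysMode N i 1
  ne := fun i h => by have := (sysMode_injective N h).2; exact absurd this (by decide)
  disj := fun i j h => by
    rw [Finset.disjoint_left]
    intro m hm hm'
    simp only [Finset.mem_insert, Finset.mem_singleton] at hm hm'
    rcases hm with rfl | rfl <;> rcases hm' with h' | h' <;>
      exact h (sysMode_injective N h').1
  z := fun _ => ∅
  zdisj := fun i j => Finset.disjoint_empty_left _
  zcard := fun i => by simp
  frame := []
  w := spectator
  hw := ne_spectator

variable {σ : Spin} {p : Fin N → Fin N} {η : ℂ}

lemma mixGate_conjTranspose (hη : star η * η = 1) (i : Fin N) :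
    ((mixGate σ p η i).unitary)ᴴ = (mixGate σ p η i).unitary := by
  unfold mixGate
  split_ifs with h
  · rw [hopGate_unitary _ _ _ hη, splitter_conjTranspose]
  · rw [idGate_unitary, Matrix.conjTranspose_one]

lemma mixGate_avoids {k m : Fin N} {τ : Spin} (h : k < p k → m ≠ k ∧ m ≠ p k ∨ τ ≠ σ) :
    Avoids (mixGate σ p η k).unitary (sysMode N m τ) := by
  unfold mixGate
  split_ifs with hk
  · apply Avoids.unitary
    intro hm
    change _ ∈ ({sysMode N k σ, sysMode N (p k) σ} : Finset (Mode N N)) at hm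
    simp only [Finset.mem_insert, Finset.mem_singleton, sysMode_inj] at hm
    have := h hk
    tauto
  · rw [idGate_unitary]; exact Avoids.one

/-- The coefficients of the linear mixing of the modes of spin `σ`. -/
def mixCoeff (p : Fin N → Fin N) (η : ℂ) (k m : Fin N) : ℂ :=
  if k < p k then (if m = k then ((√2 / 2 : ℝ) : ℂ) else 0) +
    (if m = p k then ((√2 / 2 : ℝ) : ℂ) * η else 0)
  else if p k < k then (if m = p k then ((√2 / 2 : ℝ) : ℂ) * star η else 0) -
    (if m = k then ((√2 / 2 : ℝ) : ℂ) else 0)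
  else if m = k then 1 else 0

lemma mixCoeff_eq_zero {k m : Fin N} (h1 : m ≠ k) (h2 : m ≠ p k) : mixCoeff p η k m = 0 := by
  simp [mixCoeff, h1, h2]

/-- Only the gate of the pair {k, p k} touches this mode. The splitter sends the smaller site to the
sum and the larger site to the difference combination, and leaves fixed points of `p` alone. -/
lemma mixFrame_conj_ann (hp : ∀ i, p (p i) = i) (hη : star η * η = 1) (k : Fin N) :
    (gatesU (mixLayout σ p η).frame)ᴴ * ann (sysMode N k σ) * gatesU (mixLayout σ p η).frame =
      ∑ m, mixCoeff p η k m • ann (sysMode N m σ) := by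
  change (gatesU ((List.finRange N).map (mixGate σ p η)))ᴴ * _ *
    gatesU ((List.finRange N).map (mixGate σ p η)) = _
  rcases lt_trichotomy k (p k) with hk | hk | hk
  · have e : ∑ m, mixCoeff p η k m • ann (sysMode N m σ) = ((√2 / 2 : ℝ) : ℂ) •
        (ann (sysMode N k σ) + η • ann (sysMode N (p k) σ)) := by
      simp [mixCoeff, hk, add_smul, Finset.sum_add_distrib, mul_smul]
    rw [e]
    have hav : ∀ l : Fin N, l ≠ k → ∀ m, m = k ∨ m = p k →
        Commute (mixGate σ p η l).unitary (ann (sysMode N m σ)) := by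
      intro l hl m hm
      refine (mixGate_avoids fun hlp => Or.inl ?_).1
      have h1 : l ≠ p k := by
        rintro rfl; rw [hp] at hlp; exact absurd hlp hk.not_gt
      have h2 : p l ≠ k := by rintro rfl; exact h1 (hp l).symm
      have h3 : p l ≠ p k := fun h => hl (by rw [← hp l, h, hp])
      rcases hm with rfl | rfl
      · exact ⟨hl.symm, h2.symm⟩
      · exact ⟨h1.symm, h3.symm⟩
    refine gatesU_conj (List.nodup_finRange N) (List.mem_finRange k)
      (fun l _ hl => hav l hl k (Or.inl rfl))
      (fun l _ hl => ((hav l hl k (Or.inl rfl)).add_right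
        ((hav l hl _ (Or.inr rfl)).smul_right _)).smul_right _) ?_
    rw [mixGate_conjTranspose hη, mixGate, dif_pos hk, hopGate_unitary _ _ _ hη]
    exact (splitProj_idem (isCARPair_ann_ann fun h' => hk.ne (sysMode_injective N h').1) hη).2.1
  · have e : ∑ m, mixCoeff p η k m • ann (sysMode N m σ) = ann (sysMode N k σ) := by
      simp [mixCoeff, ← hk]
    rw [e]
    apply gatesU_conj_of_commute
    intro l _
    refine (mixGate_avoids fun hlp => Or.inl ?_).1
    constructor
    · rintro rfl; exact hlp.ne hk
    · intro h
      have : p k = l := by rw [h, hp]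
      rw [← hk] at this
      rw [← this, ← hk] at hlp
      exact hlp.false
  · have hk' : ¬ k < p k := hk.not_gt
    have hpk : p k < p (p k) := by rwa [hp]
    have e : ∑ m, mixCoeff p η k m • ann (sysMode N m σ) = ((√2 / 2 : ℝ) : ℂ) •
        (star η • ann (sysMode N (p k) σ) - ann (sysMode N k σ)) := by
      simp [mixCoeff, hk, hk', sub_smul, smul_sub, Finset.sum_sub_distrib, mul_smul]
    rw [e]
    have hav : ∀ l : Fin N, l ≠ p k → ∀ m, m = k ∨ m = p k →
        Commute (mixGate σ p η l).unitary (ann (sysMode N m σ)) := by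
      intro l hl m hm
      refine (mixGate_avoids fun hlp => Or.inl ?_).1
      have h1 : l ≠ k := by
        rintro rfl; exact hk' hlp
      have h2 : p l ≠ k := by rintro rfl; exact hl (hp l).symm
      have h3 : p l ≠ p k := fun h => h1 (by rw [← hp l, h, hp])
      rcases hm with rfl | rfl
      · exact ⟨h1.symm, h2.symm⟩
      · exact ⟨hl.symm, h3.symm⟩
    refine gatesU_conj (List.nodup_finRange N) (List.mem_finRange (p k))
      (fun l _ hl => hav l hl k (Or.inl rfl))
      (fun l _ hl => (((hav l hl _ (Or.inr rfl)).smul_right _).sub_right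
        (hav l hl k (Or.inl rfl))).smul_right _) ?_
    rw [mixGate_conjTranspose hη, mixGate, dif_pos hpk, hopGate_unitary _ _ _ hη]
    have := (splitProj_idem (isCARPair_ann_ann (a := sysMode N (p k) σ) (b := sysMode N (p (p k)) σ)
      (fun h' => hpk.ne (sysMode_injective N h').1)) hη).2.2
    rw [hp] at this ⊢
    exact this

lemma mixFrame_commute_ann (k : Fin N) :
    (gatesU (mixLayout σ p η).frame)ᴴ * ann (sysMode N k (1 - σ)) * gatesU (mixLayout σ p η).frame =
      ann (sysMode N k (1 - σ)) :=
  gatesU_conj_of_commute fun _ _ => (mixGate_avoids fun _ => Or.inr (spin_sub_ne σ)).1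

/-- The coefficients of the linear mixing of all modes. -/
def mixCoeff' (σ : Spin) (p : Fin N → Fin N) (η : ℂ) (τ : Spin) (k m : Fin N) : ℂ :=
  if τ = σ then mixCoeff p η k m else if m = k then 1 else 0

lemma mixFrame_conj (hp : ∀ i, p (p i) = i) (hη : star η * η = 1) (k : Fin N) (τ : Spin) :
    (gatesU (mixLayout σ p η).frame)ᴴ * ann (sysMode N k τ) * gatesU (mixLayout σ p η).frame =
      ∑ m, mixCoeff' σ p η τ k m • ann (sysMode N m τ) := by
  by_cases h : τ = σ
  · subst h
    rw [mixFrame_conj_ann hp hη]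
    simp [mixCoeff']
  · obtain rfl := eq_spin_sub h
    rw [mixFrame_commute_ann]
    simp [mixCoeff', spin_sub_ne]

end Instances

end Hubbard

namespace Hubbard

open scoped Matrix.Norms.L2Operator

/-! ### The frequencies seen by each layout. -/

section Energies

variable {N : ℕ} {G : SimpleGraph (Fin N)} (c : Coeffs G)

lemma Coeffs.conj_hamiltonian_apply {A : ℕ} {F : Op (Mode N A)} (hF : F ∈ unitary (Op (Mode N A)))
    {W : Spin → Fin N → Fin N → ℂ}
    (hW : ∀ k τ, Fᴴ * ann (sysMode A k τ) * F = ∑ m, W τ k m • ann (sysMode A m τ))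
    (S : Finset (Mode N A)) :
    (Fᴴ * c.hamiltonian A * F) S S =
      (∑ k, ∑ j, ∑ τ, c.h k j τ * ∑ m, star (W τ k m) * W τ j m * occ S (sysMode A m τ)) +
      (∑ k, ∑ τ, (c.ω k τ : ℂ) * ∑ m, star (W τ k m) * W τ k m * occ S (sysMode A m τ)) +
      ∑ k, (c.ξ k : ℂ) * (Fᴴ * (num (sysMode A k 0) * num (sysMode A k 1)) * F) S S := by
  have hg : ∀ τ, Function.Injective fun m : Fin N => sysMode A m τ :=
    fun τ m m' h => (sysMode_injective A h).1
  rw [hamiltonian, mul_add, mul_add, add_mul, add_mul, Matrix.add_apply, Matrix.add_apply]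
  congr 1
  · congr 1
    · simp only [Finset.mul_sum, Finset.sum_mul, Matrix.sum_apply]
      refine Finset.sum_congr rfl fun k _ => Finset.sum_congr rfl fun j _ =>
        Finset.sum_congr rfl fun τ _ => ?_
      rw [mul_smul_comm, smul_mul_assoc, Matrix.smul_apply, smul_eq_mul,
        conj_cre_mul_ann_apply_self hF (hg τ) (hW k τ) (hW j τ), Finset.mul_sum]
    · simp only [Finset.mul_sum, Finset.sum_mul, Matrix.sum_apply]
      refine Finset.sum_congr rfl fun k _ => Finset.sum_congr rfl fun τ _ => ?_
      rw [mul_smul_comm, smul_mul_assoc, Matrix.smul_apply, smul_eq_mul, num,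
        conj_cre_mul_ann_apply_self hF (hg τ) (hW k τ) (hW k τ), Finset.mul_sum]
  · simp only [Finset.mul_sum, Finset.sum_mul, Matrix.sum_apply]
    refine Finset.sum_congr rfl fun k _ => ?_
    rw [mul_smul_comm, smul_mul_assoc, Matrix.smul_apply, smul_eq_mul]

lemma Coeffs.h_self (i : Fin N) (σ : Spin) : c.h i i σ = 0 := c.h_supp i i σ (G.loopless.irrefl i)

/-- The frequencies that are measured with the layout `siteLayout`. -/
def Coeffs.siteFreq (i : Fin N) : ℝ := c.ω i 0 + c.ω i 1 + c.ξ i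

/-- The frequencies that are measured with the layout `mixLayout`. -/
def Coeffs.mixFreq (σ : Spin) (p : Fin N → Fin N) (η : ℂ) (i : Fin N) : ℝ :=
  if p i = i then c.ω i σ
  else (c.ω i σ + c.ω (p i) σ) / 2 +
    if i < p i then (star η * c.h i (p i) σ).re else -(η * c.h i (p i) σ).re

lemma occ_insert_insert {A : ℕ} {S : Finset (Mode N A)} {i : Fin N} {σ : Spin} {b : Mode N A}
    (hi : sysMode A i σ ∉ S) {m : Fin N} {τ : Spin} (hb : b ≠ sysMode A m τ) :
    occ (insert (sysMode A i σ) (insert b S)) (sysMode A m τ) =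
      occ S (sysMode A m τ) + if m = i ∧ τ = σ then 1 else 0 := by
  unfold occ
  by_cases h : m = i ∧ τ = σ
  · obtain ⟨rfl, rfl⟩ := h
    simp [hi]
  · have : sysMode A m τ ≠ sysMode A i σ := fun h' => h (sysMode_injective A h')
    simp [this, hb.symm, h]

lemma sqrt_two_half_sq : ((√2 / 2 : ℝ) : ℂ) * ((√2 / 2 : ℝ) : ℂ) = 1 / 2 := by
  rw [← Complex.ofReal_mul]
  have : √2 / 2 * (√2 / 2) = 1 / 2 := by
    have := Real.mul_self_sqrt (show (0 : ℝ) ≤ 2 by norm_num)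
    linarith
  rw [this]; norm_num

/-- The one-particle energy of the mixed mode i: its weight 1/2 on each of the two sites averages
the potentials, and the hopping enters through the cross terms, with opposite signs for the two
orthogonal combinations. -/
lemma Coeffs.sum_mixCoeff {σ : Spin} {p : Fin N → Fin N} {η : ℂ} (hp : ∀ i, p (p i) = i)
    (hη : star η * η = 1) (i : Fin N) :
    (∑ k, ∑ j, c.h k j σ * (star (mixCoeff p η k i) * mixCoeff p η j i)) +
      ∑ k, (c.ω k σ : ℂ) * (star (mixCoeff p η k i) * mixCoeff p η k i) = c.mixFreq σ p η i := by
  by_cases h : p i = i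
  · have hw : ∀ k, mixCoeff p η k i = if k = i then 1 else 0 := by
      intro k
      by_cases hk : k = i
      · subst hk; simp [mixCoeff, h]
      · rw [if_neg hk]
        refine mixCoeff_eq_zero (Ne.symm hk) fun h' => hk ?_
        rw [← hp k, ← h', h]
    simp [hw, mixFreq, h, c.h_self]
  · have hw : ∀ k, mixCoeff p η k i = (if k = i then mixCoeff p η i i else 0) +
        (if k = p i then mixCoeff p η (p i) i else 0) := by
      intro k
      by_cases hk : k = i
      · subst hk; simp [Ne.symm h]
      · by_cases hk' : k = p i
        · subst hk'; simp [h]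
        · rw [if_neg hk, if_neg hk', add_zero]
          refine mixCoeff_eq_zero (Ne.symm hk) fun h' => hk' ?_
          rw [h', hp]
    have hs : ∀ f : Fin N → ℂ, (∀ k, k ≠ i → k ≠ p i → f k = 0) → ∑ k, f k = f i + f (p i) := by
      intro f hf
      rw [← Finset.sum_pair (Ne.symm h)]
      symm
      refine Finset.sum_subset (Finset.subset_univ _) fun k _ hk => ?_
      simp only [Finset.mem_insert, Finset.mem_singleton, not_or] at hk
      exact hf k hk.1 hk.2
    have hz : ∀ k, k ≠ i → k ≠ p i → mixCoeff p η k i = 0 := by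
      intro k h1 h2
      rw [hw, if_neg h1, if_neg h2, add_zero]
    rw [hs _ fun k h1 h2 => by simp [hz k h1 h2], hs _ fun k h1 h2 => by simp [hz k h1 h2],
      hs _ fun k h1 h2 => by simp [hz k h1 h2], hs _ fun k h1 h2 => by simp [hz k h1 h2],
      c.h_self, c.h_self, ← c.h_conj i (p i)]
    have hsq := sqrt_two_half_sq
    have hss : star ((√2 / 2 : ℝ) : ℂ) = ((√2 / 2 : ℝ) : ℂ) := Complex.conj_ofReal _
    set s : ℂ := ((√2 / 2 : ℝ) : ℂ) with hs'
    rw [mixFreq, if_neg h]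
    have hre : ∀ z : ℂ, ((z.re : ℝ) : ℂ) = (z + star z) / 2 := fun z => by
      rw [RCLike.star_def, Complex.add_conj]; simp
    rcases lt_or_gt_of_ne h with h1 | h1
    · have h2 : ¬ i < p i := h1.not_gt
      have e1 : mixCoeff p η i i = -s := by simp [mixCoeff, h1, h2, Ne.symm h, hs']
      have e2 : mixCoeff p η (p i) i = s * η := by simp [mixCoeff, h1, hp, Ne.symm h, hs']
      rw [e1, e2, if_neg h2]
      push_cast
      rw [hre]
      simp only [star_mul', star_neg, hss]
      linear_combination (-(c.h i (p i) σ * η) - star (c.h i (p i) σ) * star η +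
        (c.ω i σ : ℂ) + (c.ω (p i) σ : ℂ)) * hsq + (c.ω (p i) σ : ℂ) * s * s * hη
    · have h2 : ¬ p i < i := not_lt_of_gt h1
      have e1 : mixCoeff p η i i = s := by simp [mixCoeff, h1, Ne.symm h, hs']
      have e2 : mixCoeff p η (p i) i = s * star η := by simp [mixCoeff, h1, h2, hp, Ne.symm h, hs']
      rw [e1, e2, if_pos h1]
      push_cast
      rw [hre]
      simp only [star_mul', star_star, hss]
      linear_combination ((c.h i (p i) σ * star η) + star (c.h i (p i) σ) * η +
        (c.ω i σ : ℂ) + (c.ω (p i) σ : ℂ)) * hsq + (c.ω (p i) σ : ℂ) * s * s * hη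

/-- The quadratic part of the diagonal is linear in the occupations, so only the coefficient of mode
i remains in the difference, whatever the other blocks contain. The interaction part drops out. -/
lemma Coeffs.mixLayout_energy {σ : Spin} {p : Fin N → Fin N} {η : ℂ} (hp : ∀ i, p (p i) = i)
    (hη : star η * η = 1) (i : Fin N) {S : Finset (Mode N N)} (ha : sysMode N i σ ∉ S)
    (hz : Disjoint ({sysMode N i (1 - σ), sysMode N (p i) (1 - σ)} : Finset (Mode N N)) S) :
    ((gatesU (mixLayout σ p η).frame)ᴴ * c.hamiltonian N * gatesU (mixLayout σ p η).frame)
        (insert (sysMode N i σ) (insert (ancMode N i) S))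
        (insert (sysMode N i σ) (insert (ancMode N i) S)) -
      ((gatesU (mixLayout σ p η).frame)ᴴ * c.hamiltonian N * gatesU (mixLayout σ p η).frame) S S =
      c.mixFreq σ p η i := by
  set F := gatesU (mixLayout σ p η).frame with hFdef
  have hF : F ∈ unitary (Op (Mode N N)) := gatesU_mem _
  have hW := fun k τ => mixFrame_conj (σ := σ) hp hη k τ
  have hg : ∀ τ, Function.Injective fun m : Fin N => sysMode N m τ :=
    fun τ m m' h => (sysMode_injective N h).1
  set S' := insert (sysMode N i σ) (insert (ancMode N i) S) with hS'
  have hocc : ∀ m τ, occ S' (sysMode N m τ) =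
      occ S (sysMode N m τ) + if m = i ∧ τ = σ then 1 else 0 :=
    fun m τ => occ_insert_insert ha (sysMode_ne_ancMode m τ i).symm
  have hd : ∀ k j τ, ∑ m, star (mixCoeff' σ p η τ k m) * mixCoeff' σ p η τ j m * occ S' (sysMode N m τ) =
      ∑ m, star (mixCoeff' σ p η τ k m) * mixCoeff' σ p η τ j m * occ S (sysMode N m τ) +
        if τ = σ then star (mixCoeff p η k i) * mixCoeff p η j i else 0 := by
    intro k j τ
    simp only [hocc, mul_add, Finset.sum_add_distrib]
    congr 1
    by_cases h : τ = σ
    · simp [h, mixCoeff']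
    · simp [h]
  -- Each interaction is a mixed spin-σ number operator times the unmixed opposite spin at k. For k
  -- = i or p i the latter is absent; for other k the former does not involve mode i.
  have hint : ∀ k : Fin N, (Fᴴ * (num (sysMode N k 0) * num (sysMode N k 1)) * F) S' S' =
      (Fᴴ * (num (sysMode N k 0) * num (sysMode N k 1)) * F) S S := by
    intro k
    have e1 : num (sysMode N k 0) * num (sysMode N k 1) =
        num (sysMode N k σ) * num (sysMode N k (1 - σ)) := by
      fin_cases σ
      · rfl
      · exact num_mul_num_comm _ _
    have e2 : Fᴴ * num (sysMode N k (1 - σ)) * F = num (sysMode N k (1 - σ)) :=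
      gatesU_conj_of_commute fun _ _ => (mixGate_avoids fun _ => Or.inr (spin_sub_ne σ)).commute_num
    have e3 : ∀ R, (Fᴴ * (num (sysMode N k 0) * num (sysMode N k 1)) * F) R R =
        (∑ m, star (mixCoeff' σ p η σ k m) * mixCoeff' σ p η σ k m * occ R (sysMode N m σ)) *
          occ R (sysMode N k (1 - σ)) := by
      intro R
      rw [e1, conj_mul_of_mem_unitary hF, e2, num_eq_diagonal (sysMode N k (1 - σ)),
        Matrix.mul_diagonal, num, conj_cre_mul_ann_apply_self hF (hg σ) (hW k σ) (hW k σ)]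
      rfl
    rw [e3, e3, hd, hocc, if_pos rfl, if_neg (fun h : k = i ∧ 1 - σ = σ => spin_sub_ne σ h.2), add_zero]
    by_cases h1 : k = i ∨ k = p i
    · have : occ S (sysMode N k (1 - σ)) = 0 := by
        rw [occ, if_neg]
        apply Finset.disjoint_left.mp hz
        rcases h1 with rfl | rfl <;> simp
      rw [this, mul_zero, mul_zero]
    · rw [not_or] at h1
      rw [mixCoeff_eq_zero (k := k) (Ne.symm h1.1) fun h => h1.2 (by rw [h, hp])]
      simp
  rw [c.conj_hamiltonian_apply hF hW, c.conj_hamiltonian_apply hF hW]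
  simp only [hd, hint, mul_add, Finset.sum_add_distrib, mul_ite, mul_zero, Finset.sum_ite_eq',
    Finset.mem_univ, if_true]
  rw [← c.sum_mixCoeff hp hη i]
  ring

/-- In the unmixed frame hopping has no diagonal part, and filling both spins of site i switches on
its two potentials and its interaction. -/
lemma Coeffs.siteLayout_energy (i : Fin N) {S : Finset (Mode N N)} (ha : sysMode N i 0 ∉ S)
    (hb : sysMode N i 1 ∉ S) :
    ((gatesU (siteLayout N).frame)ᴴ * c.hamiltonian N * gatesU (siteLayout N).frame)
        (insert (sysMode N i 0) (insert (sysMode N i 1) S))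
        (insert (sysMode N i 0) (insert (sysMode N i 1) S)) -
      ((gatesU (siteLayout N).frame)ᴴ * c.hamiltonian N * gatesU (siteLayout N).frame) S S =
      c.siteFreq i := by
  have hF1 : gatesU (siteLayout N).frame = 1 := rfl
  rw [hF1]
  have hW : ∀ k τ, (1 : Op (Mode N N))ᴴ * ann (sysMode N k τ) * 1 =
      ∑ m, (if m = k then (1 : ℂ) else 0) • ann (sysMode N m τ) := by
    intro k τ; simp
  have hocc : ∀ m τ, occ (insert (sysMode N i 0) (insert (sysMode N i 1) S)) (sysMode N m τ) =
      if m = i then 1 else occ S (sysMode N m τ) := by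
    intro m τ
    unfold occ
    by_cases h : m = i
    · subst h
      have : τ = 0 ∨ τ = 1 := by fin_cases τ <;> simp
      rcases this with rfl | rfl <;> simp
    · simp [sysMode_inj, h]
  have h0 : ∀ τ, occ S (sysMode N i τ) = 0 := by
    intro τ
    have : τ = 0 ∨ τ = 1 := by fin_cases τ <;> simp
    rcases this with rfl | rfl <;> simp [occ, ha, hb]
  have hint : ∀ (k : Fin N) (R : Finset (Mode N N)), ((1 : Op (Mode N N))ᴴ * (num (sysMode N k 0) * num (sysMode N k 1)) * 1 : Op (Mode N N)) R R =
      occ R (sysMode N k 0) * occ R (sysMode N k 1) := by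
    intro k R
    rw [Matrix.conjTranspose_one, one_mul, mul_one, num_eq_diagonal, num_eq_diagonal,
      Matrix.diagonal_mul_diagonal, Matrix.diagonal_apply_eq]
    rfl
  rw [c.conj_hamiltonian_apply (one_mem _) (W := fun _ k m => if m = k then 1 else 0) hW,
    c.conj_hamiltonian_apply (one_mem _) (W := fun _ k m => if m = k then 1 else 0) hW]
  have hd : ∀ (R : Finset (Mode N N)) (k j : Fin N) (τ : Spin), ∑ m, star (if m = k then (1 : ℂ) else 0) * (if m = j then 1 else 0) *
      occ R (sysMode N m τ) = if k = j then occ R (sysMode N k τ) else 0 := by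
    intro R k j τ
    rw [Finset.sum_eq_single k] <;> simp +contextual
  simp only [hint, hd, if_true]
  have hhop : ∀ R : Finset (Mode N N), ∑ k, ∑ j, ∑ τ, c.h k j τ *
      (if k = j then occ R (sysMode N k τ) else 0) = 0 := by
    intro R
    refine Finset.sum_eq_zero fun k _ => Finset.sum_eq_zero fun j _ => Finset.sum_eq_zero fun τ _ => ?_
    by_cases h : k = j
    · subst h; rw [c.h_self, zero_mul]
    · rw [if_neg h, mul_zero]
  rw [hhop, hhop, zero_add, zero_add, add_sub_add_comm, ← Finset.sum_sub_distrib, ← Finset.sum_sub_distrib, siteFreq]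
  have e1 : ∀ k : Fin N, (c.ξ k : ℂ) * (occ (insert (sysMode N i 0) (insert (sysMode N i 1) S)) (sysMode N k 0) *
      occ (insert (sysMode N i 0) (insert (sysMode N i 1) S)) (sysMode N k 1)) -
      (c.ξ k : ℂ) * (occ S (sysMode N k 0) * occ S (sysMode N k 1)) = if k = i then (c.ξ k : ℂ) else 0 := by
    intro k
    rw [hocc, hocc]
    by_cases h : k = i
    · subst h; simp [h0]
    · simp [h]
  have e2 : ∀ (τ : Spin) (k : Fin N), (c.ω k τ : ℂ) * occ (insert (sysMode N i 0) (insert (sysMode N i 1) S)) (sysMode N k τ) -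
      (c.ω k τ : ℂ) * occ S (sysMode N k τ) = if k = i then (c.ω k τ : ℂ) else 0 := by
    intro τ k
    rw [hocc]
    by_cases h : k = i
    · subst h; simp [h0]
    · simp [h]
  simp only [Fin.sum_univ_two, add_sub_add_comm, e1, e2]
  simp only [Finset.sum_add_distrib, Finset.sum_ite_eq', Finset.mem_univ, if_true]
  push_cast; ring

end Energies

/-! ### The layouts satisfy the hypotheses of the frequency estimation. -/

section ProbeInstances

variable {N : ℕ} {G : SimpleGraph (Fin N)} {c : Coeffs G} {D : ℕ} {Λ : ℝ}

lemma pairOp_avoids {M : Type} [Fintype M] [LinearOrder M] {a b m : M} {z : Finset M} (ha : a ≠ m)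
    (hb : b ≠ m) (hz : m ∉ z) : Avoids (pairOp a b z) m :=
  (Avoids.ann_ann hb ha).mul (Avoids.emptyProj hz)

lemma norm_conj_unitary' {M : Type} [Fintype M] [LinearOrder M] {U : Op M}
    (hU : U ∈ unitary (Op M)) (X : Op M) : ‖U * X * Uᴴ‖ = ‖X‖ := by
  have := norm_conj_unitary (Unitary.star_mem hU) X
  rwa [Matrix.star_eq_conjTranspose, Matrix.conjTranspose_conjTranspose] at this

/-- For locality it matters that matched pairs are disjoint: the frame change of an operator on the
sites {i, p i} stays on these two sites. -/
lemma mixLayout_probes (hD : ∀ v, (G.neighborSet v).ncard ≤ D) (hΛ : 0 ≤ Λ) (hc : c.BoundedBy Λ)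
    (σ : Spin) {p : Fin N → Fin N} {η : ℂ} (hp : ∀ i, p (p i) = i) (hη : star η * η = 1) :
    (mixLayout σ p η).Probes (c.hamiltonian N) (c.mixFreq σ p η) (commutatorBound D Λ) where
  hermitian := c.hamiltonian_conjTranspose N
  frame := by
    intro g hg
    obtain ⟨i, _, rfl⟩ := List.mem_map.mp hg
    exact mixGate_conjTranspose hη i
  energy := fun i S ha _ hz => c.mixLayout_energy hp hη i ha hz
  local_bound := by
    intro i X hX
    have hF := gatesU_mem (mixLayout σ p η).frame
    refine Coeffs.norm_double_commutator_le hD hc hΛ (T := {i, p i}) Finset.card_le_two ?_ ?_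
    · rw [hX, norm_conj_unitary' hF]
      exact norm_pairOp_le _ _ _
    · intro j hj τ
      simp only [Finset.mem_insert, Finset.mem_singleton, not_or] at hj
      rw [hX]
      refine avoids_conj_of_ann_eq hF (mixFrame_conj hp hη j τ) fun m hm => ?_
      have hm' : m = j ∨ m = p j := by
        by_contra hne
        rw [not_or] at hne
        apply hm
        unfold mixCoeff'
        split_ifs with h1 h2
        · exact mixCoeff_eq_zero hne.1 hne.2
        · exact absurd h2 hne.1
        · rfl
      have hmi : m ≠ i ∧ m ≠ p i := by
        rcases hm' with rfl | rfl
        · exact hj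
        · exact ⟨fun h => hj.2 (by rw [← h, hp]), fun h => hj.1 (by rw [← hp j, h, hp])⟩
      refine pairOp_avoids ?_ ?_ ?_
      · exact fun h => hmi.1 (sysMode_injective N h).1.symm
      · exact (sysMode_ne_ancMode _ _ _).symm
      · change _ ∉ ({sysMode N i (1 - σ), sysMode N (p i) (1 - σ)} : Finset (Mode N N))
        simp only [Finset.mem_insert, Finset.mem_singleton, sysMode_inj]
        tauto

lemma siteLayout_probes (hD : ∀ v, (G.neighborSet v).ncard ≤ D) (hΛ : 0 ≤ Λ)
    (hc : c.BoundedBy Λ) :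
    (siteLayout N).Probes (c.hamiltonian N) c.siteFreq (commutatorBound D Λ) where
  hermitian := c.hamiltonian_conjTranspose N
  frame := fun g hg => absurd hg List.not_mem_nil
  energy := fun i S ha hb _ => c.siteLayout_energy i ha hb
  local_bound := by
    intro i X hX
    have hX' : X = pairOp (sysMode N i 0) (sysMode N i 1) ∅ := by
      rw [hX]
      change 1 * _ * (1 : Op (Mode N N))ᴴ = _
      rw [one_mul, Matrix.conjTranspose_one, mul_one]
      rfl
    refine Coeffs.norm_double_commutator_le hD hc hΛ (T := {i}) (by simp) ?_ ?_
    · rw [hX']; exact norm_pairOp_le _ _ _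
    · intro j hj τ
      rw [Finset.mem_singleton] at hj
      rw [hX']
      exact pairOp_avoids (fun h => hj (sysMode_injective N h).1.symm)
        (fun h => hj (sysMode_injective N h).1.symm) (Finset.notMem_empty _)

lemma abs_siteFreq_le (hc : c.BoundedBy Λ) (i : Fin N) : |c.siteFreq i| ≤ 3 * Λ := by
  have h1 := hc.ω i 0
  have h2 := hc.ω i 1
  have h3 := hc.ξ i
  have := abs_add_three (c.ω i 0) (c.ω i 1) (c.ξ i)
  rw [Coeffs.siteFreq]; linarith

lemma abs_mixFreq_le (hc : c.BoundedBy Λ) (σ : Spin) (p : Fin N → Fin N) {η : ℂ}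
    (hη : star η * η = 1) (i : Fin N) : |c.mixFreq σ p η i| ≤ 2 * Λ := by
  have hη1 : ‖η‖ = 1 := by
    have : ‖star η * η‖ = 1 := by rw [hη]; simp
    rw [norm_mul, norm_star] at this
    nlinarith [norm_nonneg η]
  have h1 := abs_le.mp (hc.ω i σ)
  have h2 := abs_le.mp (hc.ω (p i) σ)
  have h3 : ∀ z : ℂ, ‖z‖ = 1 → |(z * c.h i (p i) σ).re| ≤ Λ := by
    intro z hz
    refine (Complex.abs_re_le_norm _).trans ?_
    rw [norm_mul, hz, one_mul]
    exact hc.h i (p i) σ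
  have h4 := abs_le.mp (h3 (star η) (by rw [norm_star, hη1]))
  have h5 := abs_le.mp (h3 η hη1)
  unfold Coeffs.mixFreq
  rw [abs_le]
  split_ifs <;> constructor <;> linarith

end ProbeInstances

end Hubbard

namespace Hubbard

/-! ### Covering the edges by boundedly many matchings. -/

section Colouring

variable {N : ℕ} (G : SimpleGraph (Fin N))

/-- A graph on a finite linearly ordered set in which every vertex has at most `m` neighbours has a
colouring with `m + 1` colours. -/
lemma exists_colouring {r : Fin N → Finset (Fin N)} (hr : ∀ i j, j ∈ r i → i ∈ r j) {m : ℕ}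
    (hm : ∀ i, (r i).card ≤ m) :
    ∃ κ : Fin N → Fin (m + 1), ∀ i j, j ∈ r i → i ≠ j → κ i ≠ κ j := by
  classical
  have key : ∀ s : Finset (Fin N), ∃ κ : Fin N → Fin (m + 1),
      ∀ i ∈ s, ∀ j ∈ s, j ∈ r i → i ≠ j → κ i ≠ κ j := by
    intro s
    induction s using Finset.induction_on with
    | empty => exact ⟨fun _ => 0, by simp⟩
    | insert k s hk ih =>
      obtain ⟨κ, hκ⟩ := ih
      -- Greedy colouring: the neighbours of the new vertex use at most m of the m + 1 colours.
      have hcard : ((r k).image κ).card < Fintype.card (Fin (m + 1)) := by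
        rw [Fintype.card_fin]
        exact Nat.lt_succ_of_le (Finset.card_image_le.trans (hm k))
      obtain ⟨x, hx⟩ : ∃ x, x ∉ (r k).image κ := by
        by_contra h
        push Not at h
        rw [Finset.eq_univ_iff_forall.mpr h, Finset.card_univ] at hcard
        exact hcard.false
      have hx' : ∀ j ∈ r k, κ j ≠ x := fun j hj h => hx (Finset.mem_image.mpr ⟨j, hj, h⟩)
      have hs : ∀ j ∈ s, j ≠ k := fun j hj h => hk (h ▸ hj)
      refine ⟨Function.update κ k x, fun i hi j hj hij hne => ?_⟩
      rcases Finset.mem_insert.mp hi with rfl | hi'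
      · rcases Finset.mem_insert.mp hj with rfl | hj'
        · exact absurd rfl hne
        · rw [Function.update_self, Function.update_of_ne (hs j hj')]
          exact (hx' j hij).symm
      · rcases Finset.mem_insert.mp hj with rfl | hj'
        · rw [Function.update_self, Function.update_of_ne (hs i hi')]
          exact hx' i (hr i j hij)
        · rw [Function.update_of_ne (hs i hi'), Function.update_of_ne (hs j hj')]
          exact hκ i hi' j hj' hij hne
  obtain ⟨κ, hκ⟩ := key Finset.univ
  exact ⟨κ, fun i j => hκ i (Finset.mem_univ i) j (Finset.mem_univ j)⟩

variable {G} {D : ℕ}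

/-- A colouring of the sites such that no two sites at distance at most `2` have the same colour. -/
lemma exists_square_colouring (hD : ∀ v, (G.neighborSet v).ncard ≤ D) :
    ∃ κ : Fin N → Fin ((D + 1) * (D + 1) + 1),
      (∀ i j, G.Adj i j → κ i ≠ κ j) ∧ ∀ i j k, G.Adj k i → G.Adj k j → κ i = κ j → i = j := by
  obtain ⟨κ, hκ⟩ := exists_colouring (r := fun i => (nbhd G i).biUnion (nbhd G))
    (m := (D + 1) * (D + 1)) (by
      intro i j h
      obtain ⟨k, hk, hj⟩ := Finset.mem_biUnion.mp h
      exact Finset.mem_biUnion.mpr ⟨k, mem_nbhd_comm.mp hj, mem_nbhd_comm.mp hk⟩)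
    (fun i => (card_biUnion_nbhd hD _).trans (Nat.mul_le_mul_right _ (card_nbhd hD i)))
  refine ⟨κ, fun i j h => ?_, fun i j k hi hj h => ?_⟩
  · exact hκ i j (Finset.mem_biUnion.mpr ⟨j, mem_nbhd.mpr (Or.inr h), mem_nbhd.mpr (Or.inl rfl)⟩) h.ne
  · by_contra hne
    exact hκ i j (Finset.mem_biUnion.mpr ⟨k, mem_nbhd.mpr (Or.inr hi.symm),
      mem_nbhd.mpr (Or.inr hj)⟩) hne h

/-- The sites are covered by few matchings, such that every edge belongs to one of them. -/
lemma exists_matchings (hD : ∀ v, (G.neighborSet v).ncard ≤ D) :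
    ∃ p : Fin ((D + 1) * (D + 1) + 1) × Fin ((D + 1) * (D + 1) + 1) → Fin N → Fin N,
      (∀ x i, p x (p x i) = i) ∧ ∀ i j, G.Adj i j → ∃ x, p x i = j := by
  classical
  obtain ⟨κ, h1, h2⟩ := exists_square_colouring hD
  -- Edges between two given colour classes form a matching, since two neighbours of one site never
  -- share a colour. Sites without a partner become fixed points of `p`.
  let Q : _ × _ → Fin N → Fin N → Prop := fun x i j =>
    G.Adj i j ∧ (κ i = x.1 ∧ κ j = x.2 ∨ κ i = x.2 ∧ κ j = x.1)
  have hsymm : ∀ x i j, Q x i j → Q x j i := fun x i j h =>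
    ⟨h.1.symm, by rcases h.2 with h | h; exacts [Or.inr ⟨h.2, h.1⟩, Or.inl ⟨h.2, h.1⟩]⟩
  have huniq : ∀ x i j k, Q x i j → Q x i k → j = k := by
    rintro x i j k ⟨ha, hj⟩ ⟨hb, hk⟩
    refine h2 j k i ha hb ?_
    rcases hj with hj | hj <;> rcases hk with hk | hk
    · rw [hj.2, hk.2]
    · rw [hj.2, hk.2, ← hj.1, ← hk.1]
    · rw [hj.2, hk.2, ← hj.1, ← hk.1]
    · rw [hj.2, hk.2]
  let p : _ × _ → Fin N → Fin N := fun x i => if h : ∃ j, Q x i j then h.choose else i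
  have hp : ∀ x i j, Q x i j → p x i = j := by
    intro x i j h
    have hex : ∃ j, Q x i j := ⟨j, h⟩
    change (if h : ∃ j, Q x i j then h.choose else i) = j
    rw [dif_pos hex]
    exact huniq x i _ _ hex.choose_spec h
  refine ⟨p, fun x i => ?_, fun i j hij => ⟨(κ i, κ j), hp _ i j ⟨hij, Or.inl ⟨rfl, rfl⟩⟩⟩⟩
  by_cases h : ∃ j, Q x i j
  · obtain ⟨j, hj⟩ := h
    rw [hp x i j hj, hp x j i (hsymm x i j hj)]
  · have e : p x i = i := dif_neg h
    rw [e, e]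

end Colouring

end Hubbard

namespace Hubbard

/-! ### From frequencies to coefficients, and the choice of parameters. -/

section Learning

/-- The settings of the learning protocol: the modes of each site together (for the interactions),
the modes of each spin separately (for the chemical potentials), and the modes of each spin after
mixing the sites along a matching (for the hopping amplitudes). -/
abbrev Setting (m : ℕ) : Type := Option (Spin × Option ((Fin m × Fin m) × Bool))

/-- The parameter of the gates that give access to the real or to the imaginary part of the hopping
amplitudes. -/
def hopPhase (b : Bool) : ℂ := if b then 1 else Complex.I

lemma star_hopPhase_mul (b : Bool) : star (hopPhase b) * hopPhase b = 1 := by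
  cases b <;> simp [hopPhase]

variable {N m : ℕ} (p : Fin m × Fin m → Fin N → Fin N)

/-- The layouts of the learning protocol. -/
def settingLayout : Setting m → Layout (Mode N N) N
  | none => siteLayout N
  | some (σ, none) => mixLayout σ id 1
  | some (σ, some (x, b)) => mixLayout σ (p x) (hopPhase b)

/-- The frequencies that are measured by the learning protocol. -/
def settingFreq {G : SimpleGraph (Fin N)} (c : Coeffs G) : Setting m → Fin N → ℝ
  | none => c.siteFreq
  | some (σ, none) => c.mixFreq σ id 1
  | some (σ, some (x, b)) => c.mixFreq σ (p x) (hopPhase b)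

/-- The position of a setting in the list of all settings. -/
def settingPos (m : ℕ) : Setting m ≃ Fin (Fintype.card (Setting m)) := Fintype.equivFin _

/-- Chemical potentials from frequencies. -/
def potentialOf (v : Setting m → Fin N → ℝ) (i : Fin N) (σ : Spin) : ℝ := v (some (σ, none)) i

/-- Interactions from frequencies. -/
def interactionOf (v : Setting m → Fin N → ℝ) (i : Fin N) : ℝ :=
  v none i - potentialOf v i 0 - potentialOf v i 1

/-- The hopping amplitude between `i` and `j` from the frequencies measured in the matching `x`. -/
def hopOf (v : Setting m → Fin N → ℝ) (x : Fin m × Fin m) (i j : Fin N) (σ : Spin) : ℂ :=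
  ((v (some (σ, some (x, true))) i - (potentialOf v i σ + potentialOf v j σ) / 2 : ℝ) : ℂ) +
    Complex.I *
      ((v (some (σ, some (x, false))) i - (potentialOf v i σ + potentialOf v j σ) / 2 : ℝ) : ℂ)

open Classical in
/-- Hopping amplitudes from frequencies. -/
def hoppingOf (G : SimpleGraph (Fin N)) (X : Fin N → Fin N → Fin m × Fin m)
    (v : Setting m → Fin N → ℝ) (i j : Fin N) (σ : Spin) : ℂ :=
  if G.Adj i j then
    if i < j then hopOf v (X i j) i j σ else star (hopOf v (X j i) j i σ)
  else 0

/-- The learning protocol. -/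
def learnProtocol (G : SimpleGraph (Fin N)) (X : Fin N → Fin N → Fin m × Fin m) (B : ℝ)
    (J R : ℕ) : Protocol N N :=
  freqProtocol (fun s => settingLayout p ((settingPos m).symm s)) B J R
    (fun v => hoppingOf G X fun s => v (settingPos m s))
    (fun v => potentialOf fun s => v (settingPos m s))
    (fun v => interactionOf fun s => v (settingPos m s))

variable {p} {G : SimpleGraph (Fin N)} {c : Coeffs G} {D : ℕ} {Λ : ℝ}

lemma length_settingLayout_frame (s : Setting m) : (settingLayout p s).frame.length ≤ N := by
  rcases s with _ | ⟨σ, _ | ⟨x, b⟩⟩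
  · exact Nat.zero_le _
  · simp [settingLayout, mixLayout]
  · simp [settingLayout, mixLayout]

lemma settingLayout_probes (hD : ∀ v, (G.neighborSet v).ncard ≤ D) (hΛ : 0 ≤ Λ)
    (hc : c.BoundedBy Λ) (hp : ∀ x i, p x (p x i) = i) (s : Setting m) :
    (settingLayout p s).Probes (c.hamiltonian N) (settingFreq p c s) (commutatorBound D Λ) := by
  rcases s with _ | ⟨σ, _ | ⟨x, b⟩⟩
  · exact siteLayout_probes hD hΛ hc
  · exact mixLayout_probes hD hΛ hc σ (fun _ => rfl) (by simp)
  · exact mixLayout_probes hD hΛ hc σ (hp x) (star_hopPhase_mul b)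

lemma abs_settingFreq_le (hΛ : 0 ≤ Λ) (hc : c.BoundedBy Λ) (s : Setting m) (i : Fin N) :
    |settingFreq p c s i| ≤ 3 * Λ := by
  rcases s with _ | ⟨σ, _ | ⟨x, b⟩⟩
  · exact abs_siteFreq_le hc i
  · exact (abs_mixFreq_le hc σ id (by simp) i).trans (by linarith)
  · exact (abs_mixFreq_le hc σ (p x) (star_hopPhase_mul b) i).trans (by linarith)

/-- For the identity matching every site is a fixed point, so nothing is mixed and the bare
potential is measured. -/
lemma settingFreq_potential (σ : Spin) (i : Fin N) :
    settingFreq p c (some (σ, none)) i = c.ω i σ := by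
  simp [settingFreq, Coeffs.mixFreq]

/-- The phases η = 1 and η = i turn Re(conj(η) h) into the real and the imaginary part of h. -/
lemma settingFreq_hop {x : Fin m × Fin m} {i j : Fin N} (hij : i < j) (hx : p x i = j) (σ : Spin) :
    settingFreq p c (some (σ, some (x, true))) i = (c.ω i σ + c.ω j σ) / 2 + (c.h i j σ).re ∧
    settingFreq p c (some (σ, some (x, false))) i = (c.ω i σ + c.ω j σ) / 2 + (c.h i j σ).im := by
  simp [settingFreq, Coeffs.mixFreq, hx, hij, hij.ne', hopPhase]

/-- Both parts contain the same error W/2 of the averaged potentials. The bound (u - W/2)² ≤ 2u² +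
W²/2 is used twice, and W² is split over the two sites. -/
lemma sq_norm_hopOf_sub_le {v : Setting m → Fin N → ℝ} {x : Fin m × Fin m} {i j : Fin N}
    (hij : i < j) (hx : p x i = j) (σ : Spin) :
    ‖hopOf v x i j σ - c.h i j σ‖ ^ 2 ≤
      2 * (v (some (σ, some (x, true))) i - settingFreq p c (some (σ, some (x, true))) i) ^ 2 +
      2 * (v (some (σ, some (x, false))) i - settingFreq p c (some (σ, some (x, false))) i) ^ 2 +
      2 * (v (some (σ, none)) i - settingFreq p c (some (σ, none)) i) ^ 2 +
      2 * (v (some (σ, none)) j - settingFreq p c (some (σ, none)) j) ^ 2 := by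
  rw [settingFreq_potential, settingFreq_potential, (settingFreq_hop hij hx σ).1,
    (settingFreq_hop hij hx σ).2, Complex.sq_norm, Complex.normSq_apply]
  simp only [hopOf, potentialOf, Complex.sub_re, Complex.add_re, Complex.ofReal_re,
    Complex.I_mul_re, Complex.ofReal_im, neg_zero, add_zero, Complex.sub_im, Complex.add_im,
    Complex.I_mul_im, zero_add]
  set a := v (some (σ, some (x, true))) i
  set b := v (some (σ, some (x, false))) i
  set w := v (some (σ, none)) i
  set w' := v (some (σ, none)) j
  set W := (w - c.ω i σ) + (w' - c.ω j σ) with hW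
  set u := a - ((c.ω i σ + c.ω j σ) / 2 + (c.h i j σ).re) with hu
  set y := b - ((c.ω i σ + c.ω j σ) / 2 + (c.h i j σ).im) with hy
  have e1 : a - (w + w') / 2 - (c.h i j σ).re = u - W / 2 := by rw [hu, hW]; ring
  have e2 : b - (w + w') / 2 - (c.h i j σ).im = y - W / 2 := by rw [hy, hW]; ring
  have e3 : W ^ 2 ≤ 2 * (w - c.ω i σ) ^ 2 + 2 * (w' - c.ω j σ) ^ 2 := by
    rw [hW]; nlinarith [sq_nonneg ((w - c.ω i σ) - (w' - c.ω j σ))]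
  rw [e1, e2]
  nlinarith [sq_nonneg (u + W / 2), sq_nonneg (y + W / 2)]

/-- The learning protocol learns all coefficients if the last round is long enough. -/
lemma learnProtocol_learns (hD : ∀ v, (G.neighborSet v).ncard ≤ D) (hΛ : 0 ≤ Λ)
    (hc : c.BoundedBy Λ) (hp : ∀ x i, p x (p x i) = i) {X : Fin N → Fin N → Fin m × Fin m}
    (hX : ∀ i j, G.Adj i j → p (X i j) i = j) {B : ℝ} (hB : 0 < B) (hΛB : 3 * Λ ≤ B) {J R : ℕ}
    (hR : 64 * (commutatorBound D Λ + B ^ 2) * (2 ^ J / B) ^ 2 ≤ R) {ε : ℝ} (hε : 0 ≤ ε)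
    (hJ : 117 * (B / 2 ^ J) ^ 2 ≤ ε ^ 2)
    {n : Fin (learnProtocol p G X B J R).numExp → Spam (Mode N N)}
    (hn : ∀ e, (n e).IsBounded ((learnProtocol p G X B J R).exp e).prep (1 / 10 ^ 6)) :
    (learnProtocol p G X B J R).Learns c n ε := by
  obtain ⟨hprob, herr⟩ := freqExp_error (L := fun s => settingLayout p ((settingPos m).symm s)) hB
    (commutatorBound_nonneg D Λ) hR
    (lam := fun s => settingFreq p c ((settingPos m).symm s))
    (fun s => settingLayout_probes hD hΛ hc hp _)
    (fun s i => (abs_settingFreq_le hΛ hc _ i).trans hΛB)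
    (c.hamiltonian_conjTranspose N) hn
  set P := fun e y => (freqExp (fun s => settingLayout p ((settingPos m).symm s)) B J R
    ((freqPos _ J).symm e)).prob (c.hamiltonian N) (n e) y with hP
  set V : (Fin (Fintype.card (FreqIdx (Fintype.card (Setting m)) J)) → Finset (Mode N N)) →
      Setting m → Fin N → ℝ := fun r s => freqValue
    (fun s => settingLayout p ((settingPos m).symm s)) B J r (settingPos m s) with hV
  have hmse : ∀ s i, prodExpect P (fun r => (V r s i - settingFreq p c s i) ^ 2) ≤
      13 * (B / 2 ^ J) ^ 2 := by
    intro s i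
    have := herr (settingPos m s) i
    simpa only [Equiv.symm_apply_apply] using this
  -- 117 = 9·13 covers the worst case: an interaction combines three frequencies with weight 3 each,
  -- a hopping amplitude four with weight 2 each, and each has mean square error at most 13
  -- (B/2^J)².
  have hsqrt : ∀ f, prodExpect P f ≤ 117 * (B / 2 ^ J) ^ 2 → √(prodExpect P f) ≤ ε := by
    intro f hf
    rw [Real.sqrt_le_left hε]
    exact hf.trans hJ
  have hpos : 0 ≤ (B / 2 ^ J) ^ 2 := by positivity
  have hhop : ∀ i j σ, i < j → G.Adj i j →
      prodExpect P (fun r => ‖hopOf (V r) (X i j) i j σ - c.h i j σ‖ ^ 2) ≤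
        117 * (B / 2 ^ J) ^ 2 := by
    intro i j σ hij ha
    refine (prodExpect_mono hprob fun r =>
      sq_norm_hopOf_sub_le (v := V r) hij (hX i j ha) σ).trans ?_
    rw [prodExpect_add, prodExpect_add, prodExpect_add, prodExpect_const_mul, prodExpect_const_mul,
      prodExpect_const_mul, prodExpect_const_mul]
    have := hmse (some (σ, some (X i j, true))) i
    have := hmse (some (σ, some (X i j, false))) i
    have := hmse (some (σ, none)) i
    have := hmse (some (σ, none)) j
    linarith
  refine ⟨fun i j σ => hsqrt _ ?_, fun i σ => hsqrt _ ?_, fun i => hsqrt _ ?_⟩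
  · change prodExpect P (fun r => ‖hoppingOf G X (V r) i j σ - c.h i j σ‖ ^ 2) ≤ _
    by_cases ha : G.Adj i j
    · rcases lt_or_gt_of_ne ha.ne with hij | hij
      · simp only [hoppingOf, if_pos ha, if_pos hij]
        exact hhop i j σ hij ha
      · simp only [hoppingOf, if_pos ha, if_neg hij.not_gt]
        refine le_of_eq_of_le ?_ (hhop j i σ hij ha.symm)
        congr 1; ext r
        rw [← c.h_conj j i σ, ← star_sub, norm_star]
    · simp only [hoppingOf, if_neg ha, c.h_supp i j σ ha, sub_zero, norm_zero]
      rw [prodExpect_const hprob]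
      norm_num
      positivity
  · change prodExpect P (fun r => (V r (some (σ, none)) i - c.ω i σ) ^ 2) ≤ _
    rw [← settingFreq_potential (p := p) (c := c)]
    have := hmse (some (σ, none)) i
    linarith
  · change prodExpect P (fun r => (interactionOf (V r) i - c.ξ i) ^ 2) ≤ _
    have h1 : ∀ r, (interactionOf (V r) i - c.ξ i) ^ 2 ≤
        3 * (V r none i - settingFreq p c none i) ^ 2 +
        3 * (V r (some (0, none)) i - settingFreq p c (some (0, none)) i) ^ 2 +
        3 * (V r (some (1, none)) i - settingFreq p c (some (1, none)) i) ^ 2 := by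
      intro r
      rw [settingFreq_potential, settingFreq_potential]
      have e : settingFreq p c none i = c.ω i 0 + c.ω i 1 + c.ξ i := rfl
      rw [e]
      simp only [interactionOf, potentialOf]
      set a := V r none i - (c.ω i 0 + c.ω i 1 + c.ξ i) with ha
      set b := V r (some (0, none)) i - c.ω i 0 with hb
      set d := V r (some (1, none)) i - c.ω i 1 with hd
      have e2 : V r none i - V r (some (0, none)) i - V r (some (1, none)) i - c.ξ i = a - b - d := by
        rw [ha, hb, hd]; ring
      rw [e2]
      nlinarith [sq_nonneg (a + b), sq_nonneg (a + d), sq_nonneg (b - d)]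
    refine (prodExpect_mono hprob h1).trans ?_
    rw [prodExpect_add, prodExpect_add, prodExpect_const_mul, prodExpect_const_mul,
      prodExpect_const_mul]
    have := hmse none i
    have := hmse (some (0, none)) i
    have := hmse (some (1, none)) i
    linarith

/-- The number of rounds of the protocol. -/
lemma exists_rounds {B ε : ℝ} (hB : 1 ≤ B) (hε : 0 < ε) (hε2 : ε ≤ 1 / 2) :
    ∃ J : ℕ, 11 * B / ε ≤ 2 ^ J ∧ (2 : ℝ) ^ J ≤ 22 * B / ε ∧
      (J : ℝ) ≤ (Real.log (22 * B) / Real.log 2 ^ 2 + 1 / Real.log 2) * Real.log (1 / ε) := by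
  -- The factor 11 is used because 117 ≤ 11²; rounding up to a power of two at most doubles it.
  have hx : 1 ≤ 11 * B / ε := by
    rw [le_div_iff₀ hε]; linarith
  obtain ⟨n, h1, h2⟩ := exists_nat_pow_near hx (show (1 : ℝ) < 2 by norm_num)
  have h3 : (2 : ℝ) ^ (n + 1) ≤ 22 * B / ε := by
    rw [pow_succ]
    calc (2 : ℝ) ^ n * 2 ≤ 11 * B / ε * 2 := by gcongr
      _ = _ := by ring
  refine ⟨n + 1, h2.le, h3, ?_⟩
  have hl2 : 0 < Real.log 2 := Real.log_pos (by norm_num)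
  have hlB : 0 ≤ Real.log (22 * B) := Real.log_nonneg (by linarith)
  have hle : Real.log 2 ≤ Real.log (1 / ε) := by
    apply Real.log_le_log (by norm_num)
    rw [le_div_iff₀ hε]; linarith
  have h4 : ((n + 1 : ℕ) : ℝ) * Real.log 2 ≤ Real.log (22 * B) + Real.log (1 / ε) := by
    rw [← Real.log_mul (by positivity) (by positivity), ← Real.log_pow]
    apply Real.log_le_log (by positivity)
    rw [mul_one_div]; exact h3
  -- As ε ≤ 1/2, log(1/ε) is at least log 2, so additive constants are absorbed into a multiple of
  -- log(1/ε).
  have h5 : Real.log (22 * B) ≤ Real.log (22 * B) / Real.log 2 * Real.log (1 / ε) := by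
    rw [div_mul_eq_mul_div, le_div_iff₀ hl2]
    gcongr
  rw [← mul_le_mul_iff_left₀ hl2]
  calc _ ≤ Real.log (22 * B) / Real.log 2 * Real.log (1 / ε) + Real.log (1 / ε) := by linarith
    _ = _ := by field_simp

end Learning

end Hubbard

end

theorem theorem1 :
    ∃ (k : ℕ) (δ : ℝ), 0 < δ ∧
      ∀ (D : ℕ) (Λ : ℝ), 0 < Λ →
        ∃ C : ℝ, 0 < C ∧
          ∀ (N : ℕ) (G : SimpleGraph (Fin N)), (∀ v, (G.neighborSet v).ncard ≤ D) →
            ∀ ε : ℝ, 0 < ε → ε ≤ 1 / 2 →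
              ∃ (A : ℕ) (P : Hubbard.Protocol N A),
                P.TimeLE (C / ε) ∧
                (P.numExp : ℝ) ≤ C * Real.log (1 / ε) ^ k ∧
                (A : ℝ) ≤ C * N ∧
                P.GatesLE (C * N * (1 / ε ^ 2) * Real.log (1 / ε) ^ k) ∧
                ∀ c : Hubbard.Coeffs G, c.BoundedBy Λ →
                  P.Learns c (fun e => Hubbard.idealSpam (P.exp e).prep) ε ∧
                  ∀ n : Fin P.numExp → Hubbard.Spam (Hubbard.Mode N A),
                    (∀ e, (n e).IsBounded (P.exp e).prep δ) → P.Learns c n ε := by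
  -- The exponent is 2 because there are J rounds with O(J) repetitions each, and J is of order
  -- log(1/ε).
  refine ⟨2, 1 / 10 ^ 6, by norm_num, fun D Λ hΛ => ?_⟩
  -- 3Λ bounds every measured frequency; adding 1 makes B ≥ 1, so that logarithms of multiples of B
  -- are nonnegative.
  set B : ℝ := 3 * Λ + 1 with hBdef
  have hB1 : 1 ≤ B := by linarith
  have hB : 0 < B := by linarith
  set K : ℝ := Hubbard.commutatorBound D Λ with hKdef
  have hK : 0 ≤ K := Hubbard.commutatorBound_nonneg D Λ
  set q : ℕ := Fintype.card (Hubbard.Setting ((D + 1) * (D + 1) + 1)) with hq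
  set u : ℝ := Real.log (22 * B) / Real.log 2 ^ 2 + 1 / Real.log 2 with hu
  set w : ℝ := 64 * (K + B ^ 2) * 22 ^ 2 + 1 with hw
  have hw0 : 0 ≤ w := by positivity
  -- The sum of the constants needed for the ancillas, the time, the experiments and the gates, in
  -- this order.
  refine ⟨1 + 49152 * q * 22 + 24576 * q * u ^ 2 + 9 * w * (24576 * q * u ^ 2), by positivity,
    fun N G hD ε hε hε2 => ?_⟩
  set C : ℝ := 1 + 49152 * q * 22 + 24576 * q * u ^ 2 + 9 * w * (24576 * q * u ^ 2) with hC
  obtain ⟨J, hJ1, hJ2, hJ3⟩ := Hubbard.exists_rounds hB1 hε hε2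
  obtain ⟨p, hp, hpX⟩ := Hubbard.exists_matchings hD
  have hXex : ∀ i j, ∃ x, G.Adj i j → p x i = j := by
    intro i j
    by_cases h : G.Adj i j
    · obtain ⟨x, hx⟩ := hpX i j h
      exact ⟨x, fun _ => hx⟩
    · exact ⟨(0, 0), fun h' => absurd h' h⟩
  choose X hX using hXex
  set t : ℝ := 2 ^ J / B with ht
  have ht0 : 0 < t := by positivity
  have ht2 : t ≤ 22 / ε := by
    rw [ht, div_le_iff₀ hB]
    calc (2 : ℝ) ^ J ≤ 22 * B / ε := hJ2
      _ = _ := by ring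
  set R : ℕ := ⌈64 * (K + B ^ 2) * t ^ 2⌉₊ with hRdef
  have hR : 64 * (K + B ^ 2) * t ^ 2 ≤ R := Nat.le_ceil _
  have hR0 : 0 < R := Nat.ceil_pos.mpr (by positivity)
  have hR2 : (R : ℝ) ≤ w * (1 / ε ^ 2) := by
    have h1 : (R : ℝ) < 64 * (K + B ^ 2) * t ^ 2 + 1 := Nat.ceil_lt_add_one (by positivity)
    have h2 : t ^ 2 ≤ 22 ^ 2 * (1 / ε ^ 2) := by
      calc t ^ 2 ≤ (22 / ε) ^ 2 := by gcongr
        _ = _ := by ring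
    have h3 : 1 ≤ 1 / ε ^ 2 := by
      rw [le_div_iff₀ (by positivity)]; nlinarith
    calc (R : ℝ) ≤ 64 * (K + B ^ 2) * (22 ^ 2 * (1 / ε ^ 2)) + 1 * (1 / ε ^ 2) := by
          have : 64 * (K + B ^ 2) * t ^ 2 ≤ 64 * (K + B ^ 2) * (22 ^ 2 * (1 / ε ^ 2)) := by gcongr
          linarith
      _ = _ := by rw [hw]; ring
  have hJsq : (J : ℝ) ^ 2 ≤ u ^ 2 * Real.log (1 / ε) ^ 2 := by
    rw [← mul_pow]; gcongr
  have hacc : 117 * (B / 2 ^ J) ^ 2 ≤ ε ^ 2 := by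
    have h1 : B / 2 ^ J ≤ ε / 11 := by
      rw [div_le_div_iff₀ (by positivity) (by norm_num)]
      rw [div_le_iff₀ hε] at hJ1
      linarith
    calc 117 * (B / 2 ^ J) ^ 2 ≤ 117 * (ε / 11) ^ 2 := by gcongr
      _ ≤ ε ^ 2 := by nlinarith [sq_nonneg ε]
  have hlog : 0 ≤ Real.log (1 / ε) ^ 2 := sq_nonneg _
  have hqu : 0 ≤ 24576 * (q : ℝ) * u ^ 2 := by positivity
  have hwqu : 0 ≤ 9 * w * (24576 * (q : ℝ) * u ^ 2) := by positivity
  have hq0 : 0 ≤ 49152 * (q : ℝ) * 22 := by positivity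
  refine ⟨N, Hubbard.learnProtocol p G X B J R, ?_, ?_, ?_, ?_, fun c hc => ?_⟩
  · intro s
    refine (Hubbard.freqProtocol_timeLE _ J R _ _ _ hB hR0 s).trans ?_
    calc 49152 * (q : ℝ) * t ≤ 49152 * q * (22 / ε) := by gcongr
      _ = 49152 * q * 22 / ε := by ring
      _ ≤ C / ε := by
          gcongr; linarith
  · refine (Hubbard.card_freqIdx_le q J).trans ?_
    calc 24576 * (q : ℝ) * J ^ 2 ≤ 24576 * q * (u ^ 2 * Real.log (1 / ε) ^ 2) := by gcongr
      _ = 24576 * q * u ^ 2 * Real.log (1 / ε) ^ 2 := by ring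
      _ ≤ C * Real.log (1 / ε) ^ 2 := by
          gcongr; linarith
  · have : (1 : ℝ) ≤ C := by linarith
    exact le_mul_of_one_le_left (Nat.cast_nonneg N) this
  · intro s
    refine (Hubbard.freqProtocol_gatesLE _ J R _ _ _ rfl hR0
      (fun s => Hubbard.length_settingLayout_frame _) s).trans ?_
    calc 9 * (N : ℝ) * R * (24576 * q * J ^ 2) ≤
          9 * N * (w * (1 / ε ^ 2)) * (24576 * q * (u ^ 2 * Real.log (1 / ε) ^ 2)) := by gcongr
      _ = 9 * w * (24576 * q * u ^ 2) * N * (1 / ε ^ 2) * Real.log (1 / ε) ^ 2 := by ring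
      _ ≤ C * N * (1 / ε ^ 2) * Real.log (1 / ε) ^ 2 := by
          gcongr; linarith
  · have key : ∀ n : Fin (Hubbard.learnProtocol p G X B J R).numExp → Hubbard.Spam (Hubbard.Mode N N),
        (∀ e, (n e).IsBounded ((Hubbard.learnProtocol p G X B J R).exp e).prep (1 / 10 ^ 6)) →
        (Hubbard.learnProtocol p G X B J R).Learns c n ε := fun n hn =>
      Hubbard.learnProtocol_learns hD hΛ.le hc hp hX hB (by linarith) hR hε.le hacc hn
    -- Perfect preparation and readout is an instance of bounded SPAM error, so one argument covers
    -- both claims.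
    exact ⟨key _ fun e => Hubbard.idealSpam_isBounded _ (by norm_num), key⟩
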